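/- Let $0<d<2$. *Belief Propagation operator.* For a Borel probability measure $\pi$ on the open interval $(0,1)$ let $\mathrm{BP}_d(\pi)$ be the distribution of the random variable $$\frac{\prod_{i=1}^{d^-}\mu_i}{\prod_{i=1}^{d^-}\mu_i+\prod_{i=1}^{d^+}\mu_{i+d^-}}\in(0,1),$$ where $d^+,d^-$ are Poisson variables with mean $d/2$, the variables $\mu_1,\mu_2,\ldots$ have distribution $\pi$, and all of these are mutually independent. Write $\mathrm{BP}_d^\ell$ for the $\ell$-fold application of $\mathrm{BP}_d$ and $\delta_{1/2}$ for the atom at $1/2$. *Random formula.* For an integer $n\ge2$ let $\Phi=\Phi_n$ be the random 2-SAT formula with Boolean variables $x_1,\ldots,x_n$ and $m$ clauses, where $m$ is Poisson with mean $dn/2$ and, given $m$, the clauses are drawn uniformly and independently from the set of all $4n(n-1)$ (ordered) 2-clauses with two distinct variables. If $\Phi$ is satisfiable, let $\mu_\Phi$ be the uniform distribution on the set of satisfying assignments $\sigma\in\{\pm1\}^{\{x_1,\ldots,x_n\}}$ of $\Phi$ (with $+1$ for 'true' and $-1$ for 'false'), and let $$\pi_\Phi=\frac1n\sum_{i=1}^n\delta_{\mu_\Phi(\sigma_{x_i}=1)}$$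 be the empirical distribution of the marginals, a random probability measure on $[0,1]$. If $\Phi$ is unsatisfiable, let $\pi_\Phi=\kappa$ for an arbitrary fixed probability measure $\kappa$ on $[0,1]$. **Claim.** The limit $\pi_d=\lim_{\ell\to\infty}\mathrm{BP}_d^\ell(\delta_{1/2})$ exists in the space of Borel probability measures on $(0,1)$ with the weak topology and, for any choice of $\kappa$, $\pi_\Phi$ converges to $\pi_d$ weakly in probability; that is, for every continuous function $f:[0,1]\to\mathbb R$, $$\lim_{n\to\infty}\mathbb E\left|\int_0^1 f(z)\,\mathrm d\pi_d(z)-\int_0^1 f(z)\,\mathrm d\pi_{\Phi_n}(z)\right|=0.$$ -/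

import Mathlib

open MeasureTheory ProbabilityTheory Filter Topology
open scoped ENNReal NNReal

noncomputable section

namespace RandomTwoSat

/-! ### The random 2-SAT formula -/

/-- A literal over the variables `x_0, …, x_{n-1}`: a variable together with its sign
(`true` for the positive literal, `false` for the negated one). -/
abbrev Literal (n : ℕ) : Type := Fin n × Bool

/-- A 2-clause with two distinct variables. There are `4 n (n - 1)` of them. -/
abbrev Clause (n : ℕ) : Type := {c : Literal n × Literal n // c.1.1 ≠ c.2.1}

/-- A 2-SAT formula: a number `m` of clauses and a sequence of `m` clauses. -/
abbrev Formula (n : ℕ) : Type := Σ m : ℕ, Fin m → Clause n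

/-- A truth assignment; `true` and `false` stand for the values `+1` and `-1`. -/
abbrev Assignment (n : ℕ) : Type := Fin n → Bool

/-- `σ` satisfies the clause if it satisfies at least one of the two literals. -/
def Clause.Sat {n : ℕ} (c : Clause n) (σ : Assignment n) : Prop :=
  σ c.1.1.1 = c.1.1.2 ∨ σ c.1.2.1 = c.1.2.2

/-- The set `S(Φ)` of satisfying assignments. -/
def solutions {n : ℕ} (Φ : Formula n) : Set (Assignment n) :=
  {σ | ∀ j : Fin Φ.1, (Φ.2 j).Sat σ}

/-- The law of the random formula: the number of clauses is Poisson with mean `d n / 2`, and given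
that number the clauses are independent and uniform on the set of all clauses. -/
def formulaLaw (d : ℝ) (n : ℕ) : Measure (Formula n) :=
  (poissonMeasure (d * n / 2).toNNReal).bind fun m =>
    (Measure.pi fun _ : Fin m => uniformOn (Set.univ : Set (Clause n))).map
      (fun a => (⟨m, a⟩ : Formula n))

/-! ### Marginals of a uniformly random satisfying assignment -/

/-- The uniform distribution `μ_Φ` on the set of satisfying assignments
(a probability measure if and only if `Φ` is satisfiable). -/
def gibbs {n : ℕ} (Φ : Formula n) : Measure (Assignment n) :=
  uniformOn (solutions Φ)

/-- The marginal probability `μ_Φ(σ_{x_i} = 1)`, a number in `[0,1]`. -/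
def marginal {n : ℕ} (Φ : Formula n) (i : Fin n) : unitInterval :=
  ⟨(gibbs Φ).real {σ | σ i = true}, measureReal_nonneg, by
    unfold gibbs uniformOn; exact measureReal_le_one⟩

open Classical in
/-- The empirical distribution `π_Φ = (1/n) ∑ i, δ_{μ_Φ(σ_{x_i} = 1)}` of the marginals of a
satisfiable formula `Φ`. If `Φ` is unsatisfiable, then `μ_Φ` does not exist, and the value is a
prescribed measure `κ`. -/
def empiricalMarginals (κ : Measure unitInterval) {n : ℕ} (Φ : Formula n) :
    Measure unitInterval :=
  if (solutions Φ).Nonempty then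
    (n : ℝ≥0∞)⁻¹ • ∑ i : Fin n, Measure.dirac (marginal Φ i)
  else κ

/-! ### The Belief Propagation operator on probability measures on `(0,1)` -/

/-- The open unit interval `(0,1)`. -/
abbrev OpenUnit : Type := Set.Ioo (0 : ℝ) 1

/-- The number `∏_{i ≤ d⁻} μ_i / (∏_{i ≤ d⁻} μ_i + ∏_{i ≤ d⁺} μ_{i + d⁻})` in `(0,1)`, as a function
of `((d⁺, d⁻), μ)`. (Indices of `μ` start at zero.) -/
def bpMap (x : (ℕ × ℕ) × (ℕ → OpenUnit)) : OpenUnit :=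
  ⟨(∏ i ∈ Finset.range x.1.2, (x.2 i : ℝ)) /
      ((∏ i ∈ Finset.range x.1.2, (x.2 i : ℝ)) +
        ∏ i ∈ Finset.range x.1.1, (x.2 (i + x.1.2) : ℝ)), by
    have hA : 0 < ∏ i ∈ Finset.range x.1.2, (x.2 i : ℝ) :=
      Finset.prod_pos fun i _ => (x.2 i).2.1
    have hB : 0 < ∏ i ∈ Finset.range x.1.1, (x.2 (i + x.1.2) : ℝ) :=
      Finset.prod_pos fun i _ => (x.2 (i + x.1.2)).2.1
    exact ⟨by positivity, (div_lt_one (by positivity)).2 (by linarith)⟩⟩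

lemma measurable_bpMap : Measurable bpMap := by
  refine measurable_from_prod_countable_right (fun p => ?_)
  have hm : ∀ (s : Finset ℕ) (k : ℕ),
      Measurable fun y : ℕ → OpenUnit => ∏ i ∈ s, (y (i + k) : ℝ) := fun s k =>
    Finset.measurable_prod _ fun i _ => measurable_subtype_coe.comp (measurable_pi_apply (i + k))
  exact Measurable.subtype_mk
    ((hm (Finset.range p.2) 0).div
      ((hm (Finset.range p.2) 0).add (hm (Finset.range p.1) p.2)))

/-- The joint law of `((d⁺, d⁻), (μ_i)_i)`: two Poisson variables with mean `d / 2` and a sequence of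
random variables with distribution `π`, all mutually independent. -/
def bpInput (d : ℝ) (π : ProbabilityMeasure OpenUnit) : Measure ((ℕ × ℕ) × (ℕ → OpenUnit)) :=
  ((poissonMeasure (d / 2).toNNReal).prod (poissonMeasure (d / 2).toNNReal)).prod
    (Measure.infinitePi fun _ : ℕ => (π : Measure OpenUnit))

instance (d : ℝ) (π : ProbabilityMeasure OpenUnit) : IsProbabilityMeasure (bpInput d π) := by
  unfold bpInput; infer_instance

/-- The operator `BP_d` on the Borel probability measures on `(0,1)`. -/
def BP (d : ℝ) (π : ProbabilityMeasure OpenUnit) : ProbabilityMeasure OpenUnit :=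
  ⟨(bpInput d π).map bpMap, Measure.isProbabilityMeasure_map measurable_bpMap.aemeasurable⟩

/-- The atom `δ_{1/2}` on `(0,1)`. -/
def diracHalf : ProbabilityMeasure OpenUnit :=
  ⟨Measure.dirac ⟨1 / 2, by norm_num, by norm_num⟩, inferInstance⟩

/-- The inclusion of `(0,1)` in `[0,1]`. -/
def toUnitInterval (z : OpenUnit) : unitInterval := ⟨z, z.2.1.le, z.2.2.le⟩

end RandomTwoSat

end

/-!
The proof compares the marginals of the random formula with Belief Propagation messages, where a
message is a pair `(lower bound, upper bound)` in `[0,1]²`. Two boundary conditions matter: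
`trivialMsg = (0, 1)`, which yields rigorous bounds, and `halfMsg = (1/2, 1/2)`, which reproduces
the iterates of the operator `BP` (`msgLaw_halfMsg`).

**Independent clauses.** Since the number of clauses is Poisson, the multiplicities of the clauses
are independent Poisson variables (`poisson_bind_count`, `integral_formulaLaw`). The clauses at a
variable can therefore be resampled independently of the rest of the formula
(`integral_resample`).

**Local limit.** The messages of depth `ℓ` on the formula (`msg`) are computed along self-avoiding
paths. Their empirical law converges to the law `msgLaw` of the message at the root of a
Galton-Watson tree (`conv`). The induction on `ℓ` removes a variable `x`, so that the clauses at
`x` bring a Poisson number of samples from the empirical law of the messages on the other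
variables. On multiplicative test functions this is a statement on generating functions, and these
test functions suffice by the Stone-Weierstrass theorem (`tendsto_condErr_pull`). Messages at two
distinct variables are asymptotically independent, and a second moment computation concludes
(`conv_succ`).

**Contraction.** For `r = d / 2 < 1` the two bounds of the message with boundary condition
`trivialMsg` merge as `ℓ → ∞` (`tendsto_gap`). The gap in logarithmic odds of a combined message
is at most the sum of the gaps of the logarithms of the messages that enter it, of which there are
`2 r` in expectation. The law of the messages is invariant under negation of the variable, and the
gap of `log u` and that of `log (1 - u)` add up to the gap in logarithmic odds. Thus the expected
gap in odds shrinks by the factor `2 r / 2 = r`, up to a term from messages with a trivial bound,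
which becomes negligible because the tree is subcritical.

**Messages bound marginals.** If the neighbourhood of `x` is a tree, then the message with
boundary condition `trivialMsg` bounds the marginal of `x` (`brackets_msg`). Neighbourhoods are
trees with high probability (`measureReal_not_good`). Messages with the boundary condition
`halfMsg` lie within the same bounds, for every larger depth (`within_msg`).

**The limit.** The last fact and the contraction make the integrals of continuous functions
against the iterates of `BP` a Cauchy sequence. By compactness the iterates converge on `[0,1]`,
and they converge on `(0,1)` since the expected negative logarithm of a message remains bounded
(`lintegral_negLog_le`, `exists_bp_limit`).

**Satisfiability.** An unsatisfiable formula contains a bicycle, a path of implications between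
distinct variables with a further implication at either end that leads back to the path
(`exists_bicycle`). The expected number of bicycles vanishes for `r < 1` (`tendsto_unsat`), so the
measure `κ` plays no role in the limit. `tendsto_marginalIntegral` puts these facts together.
-/

noncomputable section

namespace RandomTwoSat

/-! ### Moments of the Poisson distribution -/

lemma poisson_integral_pow (r : ℝ≥0) (z : ℝ) :
    ∫ k, z ^ k ∂poissonMeasure r = Real.exp (r * (z - 1)) := by
  rw [integral_poissonMeasure]
  have h := (NormedSpace.expSeries_div_hasSum_exp (r * z : ℝ)).mul_left (Real.exp (-r))
  rw [← Real.exp_eq_exp_ℝ, ← Real.exp_add] at h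
  convert! h.tsum_eq using 2
  · ext k
    simp only [smul_eq_mul, mul_pow]
    ring
  · ring_nf

lemma poisson_lintegral (r : ℝ≥0) (f : ℕ → ℝ≥0∞) :
    ∫⁻ k, f k ∂poissonMeasure r
      = ∑' k, ENNReal.ofReal (Real.exp (-r) * r ^ k / k.factorial) * f k := by
  rw [poissonMeasure, lintegral_sum_measure]
  simp

lemma poisson_lintegral_mul (r : ℝ≥0) (f : ℕ → ℝ≥0∞) :
    ∫⁻ k, (k : ℝ≥0∞) * f k ∂poissonMeasure r = r * ∫⁻ k, f (k + 1) ∂poissonMeasure r := by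
  rw [poisson_lintegral, poisson_lintegral, tsum_eq_zero_add' ENNReal.summable,
    ← ENNReal.tsum_mul_left]
  simp only [CharP.cast_eq_zero, zero_mul, mul_zero, zero_add]
  refine tsum_congr fun k => ?_
  rw [← mul_assoc, ← mul_assoc]
  congr 1
  rw [← ENNReal.ofReal_natCast, ← ENNReal.ofReal_mul (by positivity),
    ← ENNReal.ofReal_coe_nnreal (p := r), ← ENNReal.ofReal_mul (by positivity)]
  congr 1
  rw [Nat.factorial_succ]
  push_cast
  field_simp
  ring

lemma poisson_lintegral_id (r : ℝ≥0) : ∫⁻ k, (k : ℝ≥0∞) ∂poissonMeasure r = r := by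
  simpa using poisson_lintegral_mul r (fun _ => 1)

lemma poisson_ne_zero_le (r : ℝ≥0) : poissonMeasure r {k | k ≠ 0} ≤ r := by
  rw [← poisson_lintegral_id r, ← lintegral_indicator_one (by measurability)]
  refine lintegral_mono fun k => ?_
  by_cases hk : k = 0
  · simp [hk]
  · simp only [Set.indicator, Set.mem_ofPred_eq, hk, not_false_eq_true, if_true, ne_eq,
      Pi.one_apply]
    exact_mod_cast Nat.one_le_iff_ne_zero.2 hk

lemma poisson_two_le_le (r : ℝ≥0) : poissonMeasure r {k | 2 ≤ k} ≤ r ^ 2 := by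
  have h : ∫⁻ k, (k : ℝ≥0∞) * ((k - 1 : ℕ) : ℝ≥0∞) ∂poissonMeasure r = r ^ 2 := by
    rw [poisson_lintegral_mul r fun k => ((k - 1 : ℕ) : ℝ≥0∞)]
    simp only [Nat.add_sub_cancel]
    rw [poisson_lintegral_id, sq]
  rw [← h, ← lintegral_indicator_one (by measurability)]
  refine lintegral_mono fun k => ?_
  by_cases hk : 2 ≤ k
  · simp only [Set.indicator, Set.mem_ofPred_eq, hk, if_true, Pi.one_apply]
    have : 1 ≤ k * (k - 1) := Nat.mul_pos (by omega) (by omega)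
    exact_mod_cast this
  · simp [hk]

/-! ### Poisson splitting -/

/-- The number of maps `Fin m → C` with prescribed fibre sizes is a multinomial coefficient. -/
lemma card_fiber_count {C : Type*} [Fintype C] [DecidableEq C] (m : ℕ) (k : C → ℕ)
    (hk : ∑ c, k c = m) :
    (Finset.univ.filter fun a : Fin m → C =>
      (fun c => (Finset.univ.filter fun j => a j = c).card) = k).card
      = Nat.multinomial Finset.univ k := by
  classical
  -- compare the coefficients of the monomial `k` in two expansions of `(∑ c, X c) ^ m`
  have key : (∑ c : C, (MvPolynomial.X c : MvPolynomial C ℕ)) ^ m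
      = ∑ a : Fin m → C, MvPolynomial.monomial
          (Finsupp.equivFunOnFinite.symm fun c =>
            (Finset.univ.filter fun j => a j = c).card) 1 := by
    rw [Fintype.sum_pow]
    refine Finset.sum_congr rfl fun a _ => ?_
    rw [MvPolynomial.monomial_eq, Finsupp.prod_fintype _ _ (by simp)]
    simp only [map_one, one_mul, Finsupp.equivFunOnFinite_symm_apply_apply]
    rw [← Finset.prod_fiberwise' (s := Finset.univ) (g := a)
      (f := fun c => (MvPolynomial.X c : MvPolynomial C ℕ))]
    simp
  have key2 := Finset.sum_pow_eq_sum_piAntidiag (Finset.univ : Finset C)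
    (fun c => (MvPolynomial.X c : MvPolynomial C ℕ)) m
  rw [key] at key2
  have := congrArg (MvPolynomial.coeff (Finsupp.equivFunOnFinite.symm k)) key2
  simp only [MvPolynomial.coeff_sum, MvPolynomial.coeff_monomial] at this
  rw [Finset.card_filter]
  have e1 : ∀ a : Fin m → C, ((Finsupp.equivFunOnFinite.symm
      fun c => (Finset.univ.filter fun j => a j = c).card) = Finsupp.equivFunOnFinite.symm k) ↔
      (fun c => (Finset.univ.filter fun j => a j = c).card) = k := fun a =>
    Finsupp.equivFunOnFinite.symm.injective.eq_iff
  simp only [e1] at this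
  rw [this]
  rw [Finset.sum_eq_single k]
  · have : ∏ i, (MvPolynomial.X i : MvPolynomial C ℕ) ^ k i
        = MvPolynomial.monomial (Finsupp.equivFunOnFinite.symm k) 1 := by
      rw [MvPolynomial.monomial_eq, Finsupp.prod_fintype _ _ (by simp)]
      simp
    rw [this, ← map_natCast (MvPolynomial.C : ℕ →+* MvPolynomial C ℕ), MvPolynomial.coeff_C_mul,
      MvPolynomial.coeff_monomial]
    simp
  · intro b _ hb
    have : ∏ i, (MvPolynomial.X i : MvPolynomial C ℕ) ^ b i
        = MvPolynomial.monomial (Finsupp.equivFunOnFinite.symm b) 1 := by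
      rw [MvPolynomial.monomial_eq, Finsupp.prod_fintype _ _ (by simp)]
      simp
    rw [this, ← map_natCast (MvPolynomial.C : ℕ →+* MvPolynomial C ℕ), MvPolynomial.coeff_C_mul,
      MvPolynomial.coeff_monomial]
    simp [hb]
  · intro h
    simp [hk] at h

/-- A Poisson number of independent uniform points of a finite set has independent Poisson
multiplicities. -/
lemma poisson_bind_count {C : Type*} [Fintype C] [DecidableEq C] [Nonempty C] [MeasurableSpace C]
    [MeasurableSingletonClass C] (r : ℝ≥0) :
    ((poissonMeasure r).bind fun m => (Measure.pi fun _ : Fin m => uniformOn (Set.univ : Set C)).map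
      fun (a : Fin m → C) c => (Finset.univ.filter fun j => a j = c).card)
      = Measure.pi fun _ : C => poissonMeasure (r / Fintype.card C) := by
  have : ∀ m : ℕ, IsProbabilityMeasure (uniformOn (Set.univ : Set C)) := fun m =>
    isProbabilityMeasure_uniformOn Set.finite_univ Set.univ_nonempty
  have hN : (0 : ℝ) < Fintype.card C := by exact_mod_cast Fintype.card_pos
  refine Measure.ext_of_singleton fun k => ?_
  rw [Measure.pi_singleton, Measure.bind_apply (measurableSet_singleton k)
    (measurable_of_countable _).aemeasurable, poisson_lintegral]
  have h1 : ∀ m : ℕ, ((Measure.pi fun _ : Fin m => uniformOn (Set.univ : Set C)).map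
      fun a c => (Finset.univ.filter fun j => a j = c).card) {k}
      = if ∑ c, k c = m then
        (Nat.multinomial Finset.univ k : ℝ≥0∞) * ((Fintype.card C : ℝ≥0∞)⁻¹) ^ m else 0 := by
    intro m
    rw [Measure.map_apply (measurable_of_countable _) (measurableSet_singleton k)]
    have h2 : (fun a : Fin m → C => fun c => (Finset.univ.filter fun j => a j = c).card) ⁻¹' {k}
      = ↑(Finset.univ.filter fun a : Fin m → C =>
      (fun c => (Finset.univ.filter fun j => a j = c).card) = k) := by
      ext a; simp
    rw [h2, ← sum_measure_singleton]
    have h3 : ∀ a : Fin m → C, (Measure.pi fun _ : Fin m => uniformOn (Set.univ : Set C)) {a}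
        = ((Fintype.card C : ℝ≥0∞)⁻¹) ^ m := by
      intro a
      rw [Measure.pi_singleton]
      simp [uniformOn_univ]
    simp only [h3, Finset.sum_const, nsmul_eq_mul]
    split_ifs with hk
    · rw [card_fiber_count m k hk]
    · rw [Finset.card_eq_zero.2, Nat.cast_zero, zero_mul]
      refine Finset.filter_eq_empty_iff.2 fun a _ ha => hk ?_
      rw [← ha, Finset.sum_card_fiberwise_eq_card_filter]
      simp
  simp_rw [h1]
  rw [tsum_eq_single (∑ c, k c) (by intro m hm; simp [hm.symm])]
  simp only [if_true, poissonMeasure_singleton]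
  rw [← ENNReal.ofReal_prod_of_nonneg (fun _ _ => by positivity), ← ENNReal.ofReal_natCast,
    ← ENNReal.ofReal_natCast (Fintype.card C), ← ENNReal.ofReal_inv_of_pos hN,
    ← ENNReal.ofReal_pow (by positivity), ← ENNReal.ofReal_mul (by positivity),
    ← ENNReal.ofReal_mul (by positivity)]
  congr 1
  have hs := Nat.multinomial_spec Finset.univ k
  have hs' : (∏ i, ((k i).factorial : ℝ)) * (Nat.multinomial Finset.univ k : ℝ)
      = ((∑ c, k c).factorial : ℝ) := by exact_mod_cast hs
  have hp : (∏ i, ((k i).factorial : ℝ)) ≠ 0 :=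
    Finset.prod_ne_zero_iff.2 fun i _ => by positivity
  simp only [Finset.prod_div_distrib, Finset.prod_mul_distrib, Finset.prod_pow_eq_pow_sum,
    ← Real.exp_sum]
  rw [← hs']
  have hm : (Nat.multinomial Finset.univ k : ℝ) ≠ 0 := by
    exact_mod_cast (Nat.multinomial_pos _ _).ne'
  have e1 : ∑ _x : C, (-((r / Fintype.card C : ℝ≥0) : ℝ)) = -r := by
    simp
    field_simp
  rw [e1]
  push_cast
  field_simp
  rw [← mul_pow, mul_one_div]

/-! ### Independence on product spaces -/

/-- Resampling a block `I` of coordinates of a product measure: if `H` sees its first argument only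
on `I` and its second argument only off `I`, then the two arguments may be taken independent. -/
lemma integral_resample {ι : Type*} [Fintype ι] (μ : ι → Measure ℕ)
    [∀ i, IsProbabilityMeasure (μ i)] (I : Set ι) (H : (ι → ℕ) → (ι → ℕ) → ℝ)
    (hH : ∀ ω₁ ω₂ ω₁' ω₂', (∀ i ∈ I, ω₁ i = ω₁' i) → (∀ i ∉ I, ω₂ i = ω₂' i) →
      H ω₁ ω₂ = H ω₁' ω₂') (C : ℝ) (hC : ∀ ω₁ ω₂, |H ω₁ ω₂| ≤ C) :
    ∫ ω, H ω ω ∂Measure.pi μ = ∫ ω, ∫ ω', H ω' ω ∂Measure.pi μ ∂Measure.pi μ := by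
  classical
  -- gluing two independent copies along `I` gives another copy
  have hglue : ((Measure.pi μ).prod (Measure.pi μ)).map
      (fun p : (ι → ℕ) × (ι → ℕ) => I.piecewise p.2 p.1) = Measure.pi μ := by
    refine (Measure.pi_eq fun s hs => ?_).symm
    rw [Measure.map_apply (measurable_of_countable _) (.univ_pi hs)]
    have : (fun p : (ι → ℕ) × (ι → ℕ) => I.piecewise p.2 p.1) ⁻¹' Set.univ.pi s
        = (Set.univ.pi fun i => if i ∈ I then Set.univ else s i) ×ˢ
          (Set.univ.pi fun i => if i ∈ I then s i else Set.univ) := by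
      ext p
      simp only [Set.mem_preimage, Set.mem_pi, Set.mem_univ, forall_true_left, Set.mem_prod,
        Set.piecewise]
      rw [← forall_and]
      refine forall_congr' fun i => ?_
      by_cases hi : i ∈ I <;> simp [hi]
    rw [this, Measure.prod_prod, Measure.pi_pi, Measure.pi_pi, ← Finset.prod_mul_distrib]
    refine Finset.prod_congr rfl fun i _ => ?_
    by_cases hi : i ∈ I <;> simp [hi]
  have hint : Integrable (fun p : (ι → ℕ) × (ι → ℕ) => H p.2 p.1)
      ((Measure.pi μ).prod (Measure.pi μ)) :=
    Integrable.of_bound (measurable_of_countable _).aestronglyMeasurable C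
      (ae_of_all _ fun p => hC _ _)
  rw [← integral_prod _ hint]
  nth_rw 1 [← hglue]
  rw [integral_map (measurable_of_countable _).aemeasurable
    (measurable_of_countable _).aestronglyMeasurable]
  refine integral_congr_ae (ae_of_all _ fun p => hH _ _ _ _ ?_ ?_)
  · intro i hi; simp [hi]
  · intro i hi; simp [hi]

/-- Events determined by disjoint blocks of coordinates are independent. -/
lemma measureReal_inter_eq_mul {ι : Type*} [Fintype ι] (μ : ι → Measure ℕ)
    [∀ i, IsProbabilityMeasure (μ i)] (I : Set ι) (E F : Set (ι → ℕ))
    (hE : ∀ ω ω' : ι → ℕ, (∀ i ∈ I, ω i = ω' i) → (ω ∈ E ↔ ω' ∈ E))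
    (hF : ∀ ω ω' : ι → ℕ, (∀ i ∉ I, ω i = ω' i) → (ω ∈ F ↔ ω' ∈ F)) :
    (Measure.pi μ).real (E ∩ F) = (Measure.pi μ).real E * (Measure.pi μ).real F := by
  have hm : ∀ s : Set (ι → ℕ), MeasurableSet s := fun s => s.to_countable.measurableSet
  have h := integral_resample μ I
    (fun ω₁ ω₂ => E.indicator (fun _ => (1 : ℝ)) ω₁ * F.indicator (fun _ => (1 : ℝ)) ω₂) ?_ 1 ?_
  · simp_rw [integral_mul_const] at h
    rw [integral_const_mul, integral_indicator_const _ (hm _),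
      integral_indicator_const _ (hm _)] at h
    simp only [smul_eq_mul, mul_one] at h
    rw [← h, ← mul_one ((Measure.pi μ).real (E ∩ F)), ← smul_eq_mul,
      ← integral_indicator_const _ (hm _)]
    congr 1
    ext ω
    by_cases h1 : ω ∈ E <;> by_cases h2 : ω ∈ F <;> simp [h1, h2]
  · intro ω₁ ω₂ ω₁' ω₂' h1 h2
    have e1 : (ω₁ ∈ E) = (ω₁' ∈ E) := propext (hE _ _ h1)
    have e2 : (ω₂ ∈ F) = (ω₂' ∈ F) := propext (hF _ _ h2)
    have e3 : E.indicator (fun _ => (1 : ℝ)) ω₁ = E.indicator (fun _ => (1 : ℝ)) ω₁' := by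
      by_cases h : ω₁ ∈ E
      · rw [Set.indicator_of_mem h, Set.indicator_of_mem (e1 ▸ h)]
      · rw [Set.indicator_of_notMem h, Set.indicator_of_notMem (e1 ▸ h)]
    have e4 : F.indicator (fun _ => (1 : ℝ)) ω₂ = F.indicator (fun _ => (1 : ℝ)) ω₂' := by
      by_cases h : ω₂ ∈ F
      · rw [Set.indicator_of_mem h, Set.indicator_of_mem (e2 ▸ h)]
      · rw [Set.indicator_of_notMem h, Set.indicator_of_notMem (e2 ▸ h)]
    rw [e3, e4]
  · intro ω₁ ω₂
    by_cases h1 : ω₁ ∈ E <;> by_cases h2 : ω₂ ∈ F <;> simp [h1, h2]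

/-- The joint generating function of a subfamily of independent Poisson variables. -/
lemma integral_prod_pow_poisson {ι T : Type*} [Fintype ι] [Fintype T] (r : ℝ≥0)
    (p : T → ι) (hp : Function.Injective p) (z : T → ℝ) :
    ∫ ω, ∏ i, z i ^ ω (p i) ∂Measure.pi (fun _ : ι => poissonMeasure r)
      = Real.exp (r * ∑ i, (z i - 1)) := by
  classical
  -- the coordinates outside the range of `p` get the base `1`
  let z' : ι → ℝ := fun j => if h : ∃ i, p i = j then z h.choose else 1
  have hz' : ∀ i, z' (p i) = z i := by
    intro i
    have h : ∃ i', p i' = p i := ⟨i, rfl⟩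
    simp only [z', h, dif_pos]
    rw [hp h.choose_spec]
  have hz1 : ∀ j, j ∉ Finset.univ.image p → z' j = 1 := by
    intro j hj
    simp only [z']
    rw [dif_neg]
    simpa using hj
  have h1 : ∀ ω : ι → ℕ, ∏ i, z i ^ ω (p i) = ∏ j, z' j ^ ω j := by
    intro ω
    rw [← Finset.prod_subset (Finset.subset_univ (Finset.univ.image p))
      (fun j _ hj => by rw [hz1 j hj, one_pow]), Finset.prod_image (fun a _ b _ h => hp h)]
    exact Finset.prod_congr rfl fun i _ => by rw [hz']
  simp_rw [h1]
  rw [integral_fintype_prod_eq_prod (f := fun j k => z' j ^ k)]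
  simp_rw [poisson_integral_pow]
  rw [← Real.exp_sum, ← Finset.mul_sum]
  congr 2
  rw [← Finset.sum_subset (Finset.subset_univ (Finset.univ.image p))
      (fun j _ hj => by rw [hz1 j hj, sub_self]), Finset.sum_image (fun a _ b _ h => hp h)]
  exact Finset.sum_congr rfl fun i _ => by rw [hz']

/-! ### Messages and compound Poisson laws -/

/-- A message: a pair of a lower and an upper bound on a marginal probability. Messages multiply
coordinatewise. -/
abbrev Msg : Type := unitInterval × unitInterval

/-- The ratio `A / (A + B)`, with the value `1 / 2` at `A = B = 0`, which keeps the identity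
`frac A B + frac B A = 1` true without exception. -/
def frac (A B : unitInterval) : unitInterval :=
  ⟨1 / 2 + ((A : ℝ) - B) / (2 * (A + B)), by
    have hA := A.2.1
    have hB := B.2.1
    rcases (add_nonneg hA hB).eq_or_lt with h | h
    · rw [← h]; norm_num
    · have : 1 / 2 + ((A : ℝ) - B) / (2 * (A + B)) = A / (A + B) := by field_simp; ring
      rw [this]
      exact ⟨by positivity, (div_le_one h).2 (by linarith)⟩⟩

lemma frac_eq {A B : unitInterval} (h : 0 < (A : ℝ) + B) : (frac A B : ℝ) = A / (A + B) := by
  simp only [frac]; field_simp; ring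

lemma frac_zero {A B : unitInterval} (h : (A : ℝ) + B = 0) : (frac A B : ℝ) = 1 / 2 := by
  simp [frac, h]

lemma symm_frac (A B : unitInterval) : unitInterval.symm (frac A B) = frac B A := by
  ext
  simp only [frac, unitInterval.coe_symm_eq, add_comm (B : ℝ) A]
  ring

lemma one_sub_frac (A B : unitInterval) : 1 - (frac A B : ℝ) = frac B A := by
  rw [← symm_frac A B, unitInterval.coe_symm_eq]

lemma add_eq_zero_unit {A B : unitInterval} (h : ¬ 0 < (A : ℝ) + B) : A = 0 ∧ B = 0 := by
  have hA := A.2.1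
  have hB := B.2.1
  exact ⟨Subtype.ext (by push_cast; linarith), Subtype.ext (by push_cast; linarith)⟩

lemma frac_mono {A A' B B' : unitInterval} (hA : A ≤ A') (hB : B' ≤ B) (h : 0 < A')
    (hB0 : 0 < B) : frac A B ≤ frac A' B' := by
  have hA' : (A : ℝ) ≤ A' := hA
  have hB' : (B' : ℝ) ≤ B := hB
  have h' : (0 : ℝ) < A' := h
  have h0' : (0 : ℝ) < B := hB0
  have := A.2.1
  have := B'.2.1
  rw [← Subtype.coe_le_coe, frac_eq (by linarith), frac_eq (by linarith),
    div_le_div_iff₀ (by linarith) (by linarith)]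
  nlinarith [mul_le_mul hA' hB' (by linarith) h'.le]

/-- The Belief Propagation rule for messages: the bounds on the probability of the value `true` at a
variable, when `A` collects the bounds from the clauses in which the variable appears negatively and
`B` those from the clauses in which it appears positively. -/
def combine (p : Msg × Msg) : Msg := (frac p.1.1 p.2.2, frac p.1.2 p.2.1)

lemma measurable_frac : Measurable fun p : unitInterval × unitInterval => frac p.1 p.2 := by
  unfold frac
  exact Measurable.subtype_mk (by fun_prop)

lemma measurable_combine : Measurable combine := by
  unfold combine
  have h1 : Measurable fun p : Msg × Msg => (p.1.1, p.2.2) := by fun_prop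
  have h2 : Measurable fun p : Msg × Msg => (p.1.2, p.2.1) := by fun_prop
  exact (measurable_frac.comp h1).prodMk (measurable_frac.comp h2)

/-- The message about the negated variable. -/
def flip (u : Msg) : Msg := (unitInterval.symm u.2, unitInterval.symm u.1)

lemma continuous_flip : Continuous flip := by unfold flip; fun_prop

lemma flip_combine (A B : Msg) : flip (combine (A, B)) = combine (B, A) := by
  simp [flip, combine, symm_frac]

/-- The law of the product of `k` independent messages with law `Q`. -/
def powerLaw (Q : Measure Msg) : ℕ → Measure Msg
  | 0 => Measure.dirac 1
  | k + 1 => powerLaw Q k ∗ₘ Q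

/-- The law of the product of a Poisson number of independent messages with law `Q`. -/
def compoundPoisson (r : ℝ≥0) (Q : Measure Msg) : Measure Msg :=
  (poissonMeasure r).bind (powerLaw Q)

instance (Q : Measure Msg) [IsProbabilityMeasure Q] (k : ℕ) :
    IsProbabilityMeasure (powerLaw Q k) := by
  induction k with
  | zero => unfold powerLaw; infer_instance
  | succ k ih => unfold powerLaw; infer_instance

instance (r : ℝ≥0) (Q : Measure Msg) [IsProbabilityMeasure Q] :
    IsProbabilityMeasure (compoundPoisson r Q) :=
  isProbabilityMeasure_bind (measurable_of_countable _).aemeasurable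
    (ae_of_all _ fun _ => inferInstance)

/-- The distributional form of the Belief Propagation rule. -/
def msgStep (r : ℝ≥0) (Q : Measure Msg) : Measure Msg :=
  ((compoundPoisson r Q).prod (compoundPoisson r Q)).map combine

instance (r : ℝ≥0) (Q : Measure Msg) [IsProbabilityMeasure Q] :
    IsProbabilityMeasure (msgStep r Q) :=
  Measure.isProbabilityMeasure_map measurable_combine.aemeasurable

/-- The law of the message at the root of a Galton-Watson tree of depth `ℓ` whose leaves send the
message `u`. -/
def msgLaw (r : ℝ≥0) (u : Msg) : ℕ → Measure Msg
  | 0 => Measure.dirac u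
  | ℓ + 1 => msgStep r (msgLaw r u ℓ)

instance (r : ℝ≥0) (u : Msg) (ℓ : ℕ) : IsProbabilityMeasure (msgLaw r u ℓ) := by
  induction ℓ with
  | zero => unfold msgLaw; infer_instance
  | succ k ih => unfold msgLaw; infer_instance

section compound
variable {r : ℝ≥0} {Q : Measure Msg}

lemma lintegral_compoundPoisson {f : Msg → ℝ≥0∞} (hf : Measurable f) :
    ∫⁻ u, f u ∂compoundPoisson r Q = ∫⁻ k, ∫⁻ u, f u ∂powerLaw Q k ∂poissonMeasure r :=
  Measure.lintegral_bind (measurable_of_countable _).aemeasurable hf.aemeasurable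

variable [IsProbabilityMeasure Q]

lemma lintegral_compoundPoisson_le {f : Msg → ℝ≥0∞} (hf : Measurable f) (h1 : f 1 = 0)
    (hmul : ∀ u v, f (u * v) ≤ f u + f v) :
    ∫⁻ u, f u ∂compoundPoisson r Q ≤ r * ∫⁻ u, f u ∂Q := by
  have hk : ∀ k, ∫⁻ u, f u ∂powerLaw Q k ≤ k * ∫⁻ u, f u ∂Q := by
    intro k
    induction k with
    | zero => simp [powerLaw, lintegral_dirac' _ hf, h1]
    | succ k ih =>
      rw [powerLaw, Measure.lintegral_mconv hf]
      calc ∫⁻ x, ∫⁻ y, f (x * y) ∂Q ∂powerLaw Q k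
          ≤ ∫⁻ x, ∫⁻ y, (f x + f y) ∂Q ∂powerLaw Q k :=
            lintegral_mono fun x => lintegral_mono fun y => hmul x y
        _ = ∫⁻ x, f x ∂powerLaw Q k + ∫⁻ y, f y ∂Q := by
            simp only [lintegral_add_right _ hf, lintegral_const, measure_univ, mul_one]
            rw [lintegral_add_right _ measurable_const]
            simp
        _ ≤ _ := by
            rw [Nat.cast_succ, add_mul, one_mul]
            gcongr
  rw [lintegral_compoundPoisson hf]
  refine (lintegral_mono hk).trans ?_
  rw [lintegral_mul_const _ (measurable_of_countable _), poisson_lintegral_id]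

lemma compoundPoisson_le {E : Set Msg} (hE : MeasurableSet E) (h1 : (1 : Msg) ∉ E)
    (hmul : ∀ u v, u * v ∈ E → u ∈ E ∨ v ∈ E) :
    compoundPoisson r Q E ≤ r * Q E := by
  have := lintegral_compoundPoisson_le (r := r) (Q := Q) (f := E.indicator 1)
    (measurable_one.indicator hE) (by simp [h1]) ?_
  · simpa [lintegral_indicator_one hE] using this
  · intro u v
    by_cases huv : u * v ∈ E
    · rcases hmul u v huv with h | h <;> simp [huv, h]
    · simp [huv]

/-- Multiplicative test functions turn compound Poisson laws into exponentials. -/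
lemma integral_compoundPoisson {χ : Msg → ℝ} (hχ : Measurable χ) (h0 : ∀ u, 0 ≤ χ u)
    (hle : ∀ u, χ u ≤ 1) (h1 : χ 1 = 1) (hmul : ∀ u v, χ (u * v) = χ u * χ v) :
    ∫ u, χ u ∂compoundPoisson r Q = Real.exp (r * (∫ u, χ u ∂Q - 1)) := by
  have hint : ∀ (ν : Measure Msg) [IsProbabilityMeasure ν], Integrable χ ν := fun ν _ =>
    Integrable.of_bound hχ.aestronglyMeasurable 1 (ae_of_all _ fun u => by
      rw [Real.norm_eq_abs, abs_of_nonneg (h0 u)]; exact hle u)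
  have hk : ∀ k, ∫ u, χ u ∂powerLaw Q k = (∫ u, χ u ∂Q) ^ k := by
    intro k
    induction k with
    | zero => simp [powerLaw, integral_dirac' _ _ hχ.stronglyMeasurable, h1]
    | succ k ih =>
      rw [powerLaw, integral_mconv (hint _)]
      simp_rw [hmul, integral_const_mul, integral_mul_const]
      rw [ih, pow_succ]
  have hQ0 : 0 ≤ ∫ u, χ u ∂Q := integral_nonneg h0
  have e : ∫⁻ u, ENNReal.ofReal (χ u) ∂compoundPoisson r Q
      = ∫⁻ k, ENNReal.ofReal ((∫ u, χ u ∂Q) ^ k) ∂poissonMeasure r := by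
    rw [lintegral_compoundPoisson (by fun_prop)]
    simp_rw [← ofReal_integral_eq_lintegral_ofReal (hint _) (ae_of_all _ h0), hk]
  rw [integral_eq_lintegral_of_nonneg_ae (ae_of_all _ h0) hχ.aestronglyMeasurable, e,
    ← poisson_integral_pow, integral_eq_lintegral_of_nonneg_ae
      (ae_of_all _ fun k => pow_nonneg hQ0 k) (measurable_of_countable _).aestronglyMeasurable]

end compound

lemma msgStep_map_flip (r : ℝ≥0) (Q : Measure Msg) [IsProbabilityMeasure Q] :
    (msgStep r Q).map flip = msgStep r Q := by
  unfold msgStep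
  rw [Measure.map_map continuous_flip.measurable measurable_combine]
  have : flip ∘ combine = combine ∘ Prod.swap := by
    ext1 p; exact flip_combine _ _
  rw [this, ← Measure.map_map measurable_combine measurable_swap, Measure.prod_swap]

/-- The message laws are invariant under exchanging the two truth values. -/
lemma msgLaw_map_flip (r : ℝ≥0) {u : Msg} (hu : flip u = u) (ℓ : ℕ) :
    (msgLaw r u ℓ).map flip = msgLaw r u ℓ := by
  cases ℓ with
  | zero => rw [msgLaw, Measure.map_dirac' continuous_flip.measurable, hu]
  | succ ℓ => exact msgStep_map_flip _ _

/-! ### Contraction of the gap between upper and lower bounds -/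

/-- Messages that are genuine bounds, with a positive upper bound. -/
def IsBound (u : Msg) : Prop := u.1 ≤ u.2 ∧ 0 < u.2

lemma measurableSet_isBound : MeasurableSet {u | IsBound u} :=
  (measurableSet_le measurable_fst measurable_snd).inter
    (measurableSet_lt measurable_const measurable_snd.subtype_val)

lemma IsBound.mul {u v : Msg} (hu : IsBound u) (hv : IsBound v) : IsBound (u * v) :=
  ⟨mul_le_mul' hu.1 hv.1, by
    have h := mul_pos (unitInterval.coe_pos.2 hu.2) (unitInterval.coe_pos.2 hv.2)
    exact h⟩

lemma IsBound.combine {A B : Msg} (hA : IsBound A) (hB : IsBound B) :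
    IsBound (combine (A, B)) := by
  refine ⟨frac_mono hA.1 hB.1 hA.2 hB.2, ?_⟩
  have h1 : (0 : ℝ) < A.2 := hA.2
  have h2 := B.1.2.1
  show (0 : ℝ) < (frac A.2 B.1 : ℝ)
  rw [frac_eq (by linarith)]
  positivity

lemma ae_isBound_compoundPoisson {r : ℝ≥0} {Q : Measure Msg} [IsProbabilityMeasure Q]
    (h : ∀ᵐ u ∂Q, IsBound u) : ∀ᵐ u ∂compoundPoisson r Q, IsBound u := by
  have h' : Q {u | IsBound u}ᶜ = 0 := h
  have := compoundPoisson_le (r := r) (Q := Q) measurableSet_isBound.compl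
    (by simp [IsBound]) (fun u v huv => by
      by_contra hc
      push Not at hc
      simp only [Set.mem_compl_iff, Set.mem_ofPred_eq, not_not] at hc huv
      exact huv (hc.1.mul hc.2))
  rw [h', mul_zero, nonpos_iff_eq_zero] at this
  exact this

lemma ae_prod {μ ν : Measure Msg} [IsProbabilityMeasure μ] [IsProbabilityMeasure ν]
    {p q : Msg → Prop} (hp : ∀ᵐ u ∂μ, p u) (hq : ∀ᵐ u ∂ν, q u) :
    ∀ᵐ w ∂μ.prod ν, p w.1 ∧ q w.2 :=
  (Measure.quasiMeasurePreserving_fst.ae hp).and (Measure.quasiMeasurePreserving_snd.ae hq)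

lemma ae_isBound_msgLaw {r : ℝ≥0} {u : Msg} (hu : IsBound u) (ℓ : ℕ) :
    ∀ᵐ v ∂msgLaw r u ℓ, IsBound v := by
  induction ℓ with
  | zero => exact (ae_dirac_iff measurableSet_isBound).2 hu
  | succ ℓ ih =>
    refine (ae_map_iff measurable_combine.aemeasurable measurableSet_isBound).2 ?_
    have h := ae_isBound_compoundPoisson (r := r) ih
    filter_upwards [ae_prod h h] with w hw
    exact hw.1.combine hw.2

/-- The negative logarithm of the lower bound, set to `0` where the lower bound vanishes. -/
def negLog (u : Msg) : ℝ≥0∞ := ENNReal.ofReal (-Real.log u.1)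

lemma measurable_negLog : Measurable negLog := by unfold negLog; fun_prop

lemma negLog_mul (u v : Msg) : negLog (u * v) ≤ negLog u + negLog v := by
  unfold negLog
  by_cases hu : (u.1 : ℝ) = 0
  · simp [hu]
  by_cases hv : (v.1 : ℝ) = 0
  · simp [hv]
  refine (ENNReal.ofReal_le_ofReal ?_).trans ENNReal.ofReal_add_le
  simp only [Prod.fst_mul, Set.Icc.coe_mul]
  rw [Real.log_mul hu hv]
  linarith

lemma negLog_combine (A B : Msg) :
    negLog (combine (A, B)) ≤ ENNReal.ofReal (Real.log 2) + negLog A := by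
  unfold negLog combine
  have hB := B.2.2.1
  have hB1 := B.2.2.2
  have hA1 := A.1.2.2
  rcases A.1.2.1.eq_or_lt with h | h
  · rcases hB.eq_or_lt with h' | h'
    · simp only
      rw [frac_zero (by rw [← h, ← h', add_zero]), one_div, Real.log_inv, neg_neg]
      exact le_self_add
    · simp only
      rw [frac_eq (by rw [← h]; linarith), ← h]
      simp
  · refine (ENNReal.ofReal_le_ofReal ?_).trans ENNReal.ofReal_add_le
    simp only
    rw [frac_eq (by linarith), Real.log_div h.ne' (by linarith)]
    have : Real.log (A.1 + B.2) ≤ Real.log 2 := Real.log_le_log (by linarith) (by linarith)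
    linarith

lemma lintegral_msgStep {r : ℝ≥0} {Q : Measure Msg} {f : Msg → ℝ≥0∞} (hf : Measurable f) :
    ∫⁻ u, f u ∂msgStep r Q
      = ∫⁻ w, f (combine w) ∂(compoundPoisson r Q).prod (compoundPoisson r Q) :=
  lintegral_map hf measurable_combine

section step
variable {r : ℝ≥0} {Q : Measure Msg} [IsProbabilityMeasure Q]

lemma lintegral_prod_fst {f : Msg → ℝ≥0∞} (hf : Measurable f) {μ ν : Measure Msg}
    [IsProbabilityMeasure μ] [IsProbabilityMeasure ν] :
    ∫⁻ w, f w.1 ∂μ.prod ν = ∫⁻ u, f u ∂μ := by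
  rw [lintegral_prod _ (by fun_prop)]; simp

lemma lintegral_prod_snd {f : Msg → ℝ≥0∞} (hf : Measurable f) {μ ν : Measure Msg}
    [IsProbabilityMeasure μ] [IsProbabilityMeasure ν] :
    ∫⁻ w, f w.2 ∂μ.prod ν = ∫⁻ u, f u ∂ν := by
  rw [lintegral_prod _ (by fun_prop)]; simp

lemma negLog_step : ∫⁻ u, negLog u ∂msgStep r Q
    ≤ ENNReal.ofReal (Real.log 2) + r * ∫⁻ u, negLog u ∂Q := by
  rw [lintegral_msgStep measurable_negLog]
  calc _ ≤ ∫⁻ w, (ENNReal.ofReal (Real.log 2) + negLog w.1)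
          ∂(compoundPoisson r Q).prod (compoundPoisson r Q) :=
        lintegral_mono fun w => negLog_combine w.1 w.2
    _ = ENNReal.ofReal (Real.log 2) + ∫⁻ u, negLog u ∂compoundPoisson r Q := by
        rw [lintegral_add_left measurable_const, lintegral_prod_fst measurable_negLog]
        simp
    _ ≤ _ := by
        gcongr
        exact lintegral_compoundPoisson_le measurable_negLog (by simp [negLog]) negLog_mul

lemma measurableSet_fst_zero : MeasurableSet {u : Msg | u.1 = 0} :=
  measurable_fst (measurableSet_singleton (0 : unitInterval))

lemma compoundPoisson_fst_zero : compoundPoisson r Q {u | u.1 = 0} ≤ r * Q {u | u.1 = 0} :=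
  compoundPoisson_le measurableSet_fst_zero (by simp) (by simp)

lemma frac_eq_zero {A B : unitInterval} (h : frac A B = 0) : A = 0 := by
  have h' : (frac A B : ℝ) = 0 := by rw [h]; rfl
  by_cases hp : 0 < (A : ℝ) + B
  · rw [frac_eq hp, div_eq_zero_iff] at h'
    rcases h' with h' | h'
    · exact Subtype.ext h'
    · linarith
  · exact (add_eq_zero_unit hp).1

lemma frac_eq_one {A B : unitInterval} (h : frac A B = 1) : B = 0 := by
  refine frac_eq_zero (B := A) (Subtype.ext ?_)
  rw [← one_sub_frac, h]; simp

lemma fst_zero_step : msgStep r Q {u | u.1 = 0} ≤ r * Q {u | u.1 = 0} := by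
  refine le_trans ?_ compoundPoisson_fst_zero
  rw [msgStep, Measure.map_apply measurable_combine measurableSet_fst_zero]
  calc _ ≤ ((compoundPoisson r Q).prod (compoundPoisson r Q)) (Prod.fst ⁻¹' {u | u.1 = 0}) :=
        measure_mono fun w hw => frac_eq_zero hw
    _ = _ := by
        rw [← Measure.map_apply measurable_fst measurableSet_fst_zero, Measure.map_fst_prod]
        simp

/-- `negLog` restricted to the messages with upper bound `1`. -/
def negLogTop (u : Msg) : ℝ≥0∞ := {v : Msg | v.2 = 1}.indicator negLog u

lemma measurable_negLogTop : Measurable negLogTop :=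
  measurable_negLog.indicator (measurable_snd (measurableSet_singleton (1 : unitInterval)))

/-- The two bounds of a combined message come from independent families of messages: the upper bound
is `1` because of the clauses in `B`, and the lower bound is small because of those in `A`. -/
lemma negLogTop_step : ∫⁻ u, negLogTop u ∂msgStep r Q
    ≤ (ENNReal.ofReal (Real.log 2) + r * ∫⁻ u, negLog u ∂Q) * (r * Q {u | u.1 = 0}) := by
  rw [lintegral_msgStep measurable_negLogTop]
  have hm : Measurable ({u : Msg | u.1 = 0}.indicator (1 : Msg → ℝ≥0∞)) :=
    measurable_one.indicator measurableSet_fst_zero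
  calc _ ≤ ∫⁻ w, (ENNReal.ofReal (Real.log 2) + negLog w.1) *
          {u : Msg | u.1 = 0}.indicator 1 w.2
          ∂(compoundPoisson r Q).prod (compoundPoisson r Q) := by
        refine lintegral_mono fun w => ?_
        by_cases h : (combine w).2 = 1
        · have h0 : w.2.1 = 0 := frac_eq_one h
          simpa [negLogTop, h, h0] using negLog_combine w.1 w.2
        · simp [negLogTop, h]
    _ = (ENNReal.ofReal (Real.log 2) + ∫⁻ u, negLog u ∂compoundPoisson r Q) *
          compoundPoisson r Q {u | u.1 = 0} := by
        rw [lintegral_prod_mul (f := fun u => ENNReal.ofReal (Real.log 2) + negLog u)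
          (measurable_const.add measurable_negLog).aemeasurable hm.aemeasurable,
        lintegral_indicator_one measurableSet_fst_zero,
          lintegral_add_left measurable_const]
        simp
    _ ≤ _ := by
        gcongr
        · exact lintegral_compoundPoisson_le measurable_negLog (by simp [negLog]) negLog_mul
        · exact compoundPoisson_fst_zero

/-- The length of the interval of logarithmic odds between the two bounds, set to `0` where this
interval is unbounded. -/
def oddsGap (u : Msg) : ℝ≥0∞ :=
  {v : Msg | 0 < v.1 ∧ v.2 < 1}.indicator (fun v => ENNReal.ofReal
    (Real.log v.2 - Real.log v.1 + (Real.log (1 - v.1) - Real.log (1 - v.2)))) u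

/-- The logarithm of the ratio of the two bounds, set to `0` where a bound vanishes. -/
def logGap (u : Msg) : ℝ≥0∞ :=
  {v : Msg | 0 < v.1 ∧ 0 < v.2}.indicator (fun v => ENNReal.ofReal
    (Real.log v.2 - Real.log v.1)) u

lemma measurable_oddsGap : Measurable oddsGap := by
  refine Measurable.indicator (by fun_prop) ?_
  exact (measurableSet_lt measurable_const measurable_fst.subtype_val).inter
    (measurableSet_lt measurable_snd.subtype_val measurable_const)

lemma measurable_logGap : Measurable logGap := by
  refine Measurable.indicator (by fun_prop) ?_
  exact (measurableSet_lt measurable_const measurable_fst.subtype_val).inter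
    (measurableSet_lt measurable_const measurable_snd.subtype_val)

lemma logGap_mul (u v : Msg) : logGap (u * v) ≤ logGap u + logGap v := by
  unfold logGap
  by_cases h : 0 < (u * v).1 ∧ 0 < (u * v).2
  · have h1 : 0 < u.1 := pos_of_mul_pos_left h.1 (zero_le)
    have h2 : 0 < v.1 := pos_of_mul_pos_right h.1 (zero_le)
    have h3 : 0 < u.2 := pos_of_mul_pos_left h.2 (zero_le)
    have h4 : 0 < v.2 := pos_of_mul_pos_right h.2 (zero_le)
    rw [Set.indicator_of_mem (show u * v ∈ {v : Msg | 0 < v.1 ∧ 0 < v.2} from h),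
      Set.indicator_of_mem (show u ∈ {v : Msg | 0 < v.1 ∧ 0 < v.2} from ⟨h1, h3⟩),
      Set.indicator_of_mem (show v ∈ {v : Msg | 0 < v.1 ∧ 0 < v.2} from ⟨h2, h4⟩)]
    refine (ENNReal.ofReal_le_ofReal ?_).trans ENNReal.ofReal_add_le
    have h1' : (u.1 : ℝ) ≠ 0 := (unitInterval.coe_pos.2 h1).ne'
    have h2' : (v.1 : ℝ) ≠ 0 := (unitInterval.coe_pos.2 h2).ne'
    have h3' : (u.2 : ℝ) ≠ 0 := (unitInterval.coe_pos.2 h3).ne'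
    have h4' : (v.2 : ℝ) ≠ 0 := (unitInterval.coe_pos.2 h4).ne'
    simp only [Prod.fst_mul, Prod.snd_mul, Set.Icc.coe_mul]
    rw [Real.log_mul h1' h2', Real.log_mul h3' h4']
    linarith
  · rw [Set.indicator_of_notMem (show u * v ∉ {v : Msg | 0 < v.1 ∧ 0 < v.2} from h)]
    exact zero_le

/-- The odds of `combine (A, B)` are `A / B`, so the gap in logarithmic odds splits into the gaps of
`log A` and of `log B`. -/
lemma oddsGap_combine {A B : Msg} (hA : 0 < A.2) (hB : 0 < B.2) :
    oddsGap (combine (A, B)) ≤ logGap A + logGap B := by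
  by_cases h : combine (A, B) ∈ {v : Msg | 0 < v.1 ∧ v.2 < 1}
  · have hA' : (0 : ℝ) < A.2 := hA
    have hB' : (0 : ℝ) < B.2 := hB
    have hA1 : 0 < A.1 := by
      refine pos_iff_ne_zero.2 fun h0 => h.1.ne' (Subtype.ext ?_)
      show (frac A.1 B.2 : ℝ) = 0
      rw [h0, frac_eq (by simpa using hB')]; simp
    have hB1 : 0 < B.1 := by
      refine pos_iff_ne_zero.2 fun h0 => h.2.ne (Subtype.ext ?_)
      show (frac A.2 B.1 : ℝ) = 1
      rw [h0, frac_eq (by simpa using hA')]; simp [hA'.ne']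
    have hA1' : (0 : ℝ) < A.1 := hA1
    have hB1' : (0 : ℝ) < B.1 := hB1
    unfold oddsGap logGap
    rw [Set.indicator_of_mem h,
      Set.indicator_of_mem (show A ∈ {v : Msg | 0 < v.1 ∧ 0 < v.2} from ⟨hA1, hA⟩),
      Set.indicator_of_mem (show B ∈ {v : Msg | 0 < v.1 ∧ 0 < v.2} from ⟨hB1, hB⟩)]
    refine (ENNReal.ofReal_le_ofReal (le_of_eq ?_)).trans ENNReal.ofReal_add_le
    simp only [combine, one_sub_frac]
    rw [frac_eq (by positivity), frac_eq (by positivity), frac_eq (by positivity),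
      frac_eq (by positivity), Real.log_div, Real.log_div, Real.log_div, Real.log_div,
      add_comm (B.1 : ℝ) A.2, add_comm (B.2 : ℝ) A.1]
    · ring
    all_goals positivity
  · unfold oddsGap
    rw [Set.indicator_of_notMem h]
    exact zero_le

lemma oddsGap_step_le (h : ∀ᵐ u ∂Q, IsBound u) :
    ∫⁻ u, oddsGap u ∂msgStep r Q ≤ 2 * (r * ∫⁻ u, logGap u ∂Q) := by
  have hC := ae_isBound_compoundPoisson (r := r) h
  have hl : ∫⁻ u, logGap u ∂compoundPoisson r Q ≤ r * ∫⁻ u, logGap u ∂Q :=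
    lintegral_compoundPoisson_le measurable_logGap (by simp [logGap]) logGap_mul
  rw [lintegral_msgStep measurable_oddsGap]
  calc _ ≤ ∫⁻ w, (logGap w.1 + logGap w.2)
          ∂(compoundPoisson r Q).prod (compoundPoisson r Q) := by
        refine lintegral_mono_ae ?_
        filter_upwards [ae_prod hC hC] with w hw
        exact oddsGap_combine hw.1.2 hw.2.2
    _ = ∫⁻ u, logGap u ∂compoundPoisson r Q + ∫⁻ u, logGap u ∂compoundPoisson r Q := by
        rw [lintegral_add_left (f := fun w : Msg × Msg => logGap w.1)
          (measurable_logGap.comp measurable_fst), lintegral_prod_fst measurable_logGap,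
          lintegral_prod_snd measurable_logGap]
    _ ≤ _ := by rw [two_mul]; gcongr

/-- The gaps of `log u` and of `log (1 - u)` add up to the gap of the logarithmic odds of `u`. If
exactly one of the two bounds is trivial, then `oddsGap` vanishes by convention, and the left-hand
side is the contribution of the other bound to `negLogTop`. -/
lemma logGap_add_logGap_flip {u : Msg} (hu : IsBound u) :
    logGap u + logGap (flip u) ≤ oddsGap u + (negLogTop u + negLogTop (flip u)) := by
  obtain ⟨h1, h2⟩ := hu
  have h1' : (u.1 : ℝ) ≤ u.2 := h1
  have h2' : (0 : ℝ) < u.2 := h2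
  have hu1 := u.1.2.1
  have hu2 := u.2.2.2
  have f1 : ((flip u).1 : ℝ) = 1 - u.2 := rfl
  have f2 : ((flip u).2 : ℝ) = 1 - u.1 := rfl
  have m1 : (0 < (flip u).1) ↔ (u.2 : ℝ) < 1 := by
    rw [← unitInterval.coe_pos, f1]; exact sub_pos
  have m2 : (0 < (flip u).2) ↔ (u.1 : ℝ) < 1 := by
    rw [← unitInterval.coe_pos, f2]; exact sub_pos
  have m3 : (0 < u.1) ↔ (0 : ℝ) < u.1 := unitInterval.coe_pos.symm
  have m4 : (u.2 < 1) ↔ (u.2 : ℝ) < 1 := Iff.rfl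
  have m5 : (u.2 = 1) ↔ (u.2 : ℝ) = 1 := ⟨fun h => by rw [h]; rfl, fun h => Subtype.ext h⟩
  have m6 : ((flip u).2 = 1) ↔ (u.1 : ℝ) = 0 :=
    ⟨fun h => by have : ((flip u).2 : ℝ) = 1 := by rw [h]; rfl
                 linarith, fun h => Subtype.ext (by rw [f2, h]; simp)⟩
  unfold logGap oddsGap negLogTop negLog
  simp only [Set.indicator, Set.mem_ofPred_eq, m1, m2, m3, m4, m5, m6, h2, and_true, f1, f2]
  rcases hu1.eq_or_lt with ha | ha <;> rcases hu2.eq_or_lt with hb | hb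
  · simp [← ha, hb]
  · simp [← ha, hb]
  · simp [ha, hb]
  · have hlt : (u.1 : ℝ) < 1 := by linarith
    simp only [ha, hb, hlt, ha.ne', hb.ne, and_self, if_true, if_false, add_zero]
    rw [← ENNReal.ofReal_add]
    · have := Real.log_le_log ha h1'; linarith
    · have := Real.log_le_log (sub_pos.2 hb) (by linarith : 1 - (u.2 : ℝ) ≤ 1 - u.1); linarith

/-- One step of the recursion contracts the expected gap by the factor `r`, up to an error which
accounts for messages with a trivial bound. It rests on the symmetry of `Q` under `flip`, which
turns the gap of `log u` into one half of the gap of the logarithmic odds. -/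
lemma oddsGap_step (h : ∀ᵐ u ∂Q, IsBound u) (hf : Q.map flip = Q) :
    ∫⁻ u, oddsGap u ∂msgStep r Q
      ≤ r * (∫⁻ u, oddsGap u ∂Q + 2 * ∫⁻ u, negLogTop u ∂Q) := by
  refine (oddsGap_step_le h).trans ?_
  have e1 : ∀ f : Msg → ℝ≥0∞, Measurable f → ∫⁻ u, f (flip u) ∂Q = ∫⁻ u, f u ∂Q := fun f hm => by
    conv_rhs => rw [← hf, lintegral_map hm continuous_flip.measurable]
  have e2 : 2 * ∫⁻ u, logGap u ∂Q ≤ ∫⁻ u, oddsGap u ∂Q + 2 * ∫⁻ u, negLogTop u ∂Q := by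
    calc 2 * ∫⁻ u, logGap u ∂Q = ∫⁻ u, (logGap u + logGap (flip u)) ∂Q := by
          rw [lintegral_add_left measurable_logGap, e1 _ measurable_logGap, two_mul]
      _ ≤ ∫⁻ u, (oddsGap u + (negLogTop u + negLogTop (flip u))) ∂Q := by
          refine lintegral_mono_ae ?_
          filter_upwards [h] with u hu using logGap_add_logGap_flip hu
      _ = _ := by
          rw [lintegral_add_left measurable_oddsGap, lintegral_add_left measurable_negLogTop,
            e1 _ measurable_negLogTop, two_mul]
  calc 2 * (r * ∫⁻ u, logGap u ∂Q) = r * (2 * ∫⁻ u, logGap u ∂Q) := by ring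
    _ ≤ _ := by gcongr

end step

/-- The message that carries no information. -/
def trivialMsg : Msg := (0, 1)

lemma flip_trivialMsg : flip trivialMsg = trivialMsg := by simp [flip, trivialMsg]

lemma isBound_trivialMsg : IsBound trivialMsg := ⟨zero_le, zero_lt_one⟩

/-- The difference of the two bounds is at most their gap in logarithmic odds, unless one of the
bounds is trivial. -/
lemma gap_le {u : Msg} (hu : IsBound u) :
    ENNReal.ofReal ((u.2 : ℝ) - u.1) ≤ oddsGap u + ({v : Msg | v.1 = 0}.indicator 1 u
      + {v : Msg | v.1 = 0}.indicator 1 (flip u)) := by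
  obtain ⟨h1, h2⟩ := hu
  have h1' : (u.1 : ℝ) ≤ u.2 := h1
  have h2' : (0 : ℝ) < u.2 := h2
  have hu1 := u.1.2.1
  have hu2 := u.2.2.2
  have hle : ENNReal.ofReal ((u.2 : ℝ) - u.1) ≤ 1 := ENNReal.ofReal_le_one.2 (by linarith)
  by_cases ha : u.1 = 0
  · rw [Set.indicator_of_mem (show u ∈ {v : Msg | v.1 = 0} from ha)]
    exact hle.trans (le_add_left le_self_add)
  by_cases hb : u.2 = 1
  · rw [Set.indicator_of_mem (show flip u ∈ {v : Msg | v.1 = 0} by simp [flip, hb])]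
    exact hle.trans (le_add_left le_add_self)
  refine le_trans ?_ le_self_add
  have ha' : 0 < u.1 := pos_iff_ne_zero.2 ha
  have hb' : u.2 < 1 := lt_of_le_of_ne u.2.2.2 hb
  have ha0 : (0 : ℝ) < u.1 := ha'
  have hb0 : (u.2 : ℝ) < 1 := hb'
  rw [oddsGap, Set.indicator_of_mem (show u ∈ {v : Msg | 0 < v.1 ∧ v.2 < 1} from ⟨ha', hb'⟩)]
  refine ENNReal.ofReal_le_ofReal ?_
  have l1 := Real.log_le_log (sub_pos.2 hb0) (by linarith : 1 - (u.2 : ℝ) ≤ 1 - u.1)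
  have l2 := Real.one_sub_inv_le_log_of_pos (div_pos h2' ha0)
  rw [Real.log_div h2'.ne' ha0.ne', inv_div] at l2
  have l3 : (u.1 : ℝ) / u.2 ≤ 1 - (u.2 - u.1) := by
    rw [div_le_iff₀ h2']
    nlinarith
  linarith

/-- The expected negative logarithm of the lower bound remains bounded along the recursion. -/
lemma lintegral_negLog_le {r K : ℝ≥0} (hK : ENNReal.ofReal (Real.log 2) + r * K ≤ K) {u : Msg}
    (hu : negLog u ≤ K) (ℓ : ℕ) : ∫⁻ v, negLog v ∂msgLaw r u ℓ ≤ K := by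
  induction ℓ with
  | zero => rwa [msgLaw, lintegral_dirac' _ measurable_negLog]
  | succ ℓ ih =>
    refine negLog_step.trans (le_trans ?_ hK)
    gcongr

/-- The fixed point `K = log 2 / (1 - r)` of the recursion for the negative logarithm. -/
lemma exists_negLog_bound {r : ℝ≥0} (hr : r < 1) :
    ∃ K : ℝ≥0, ENNReal.ofReal (Real.log 2) + r * K ≤ K ∧ ENNReal.ofReal (Real.log 2) ≤ K := by
  have h1 : (0 : ℝ) < 1 - r := sub_pos.2 (by exact_mod_cast hr)
  have hl : 0 ≤ Real.log 2 := Real.log_nonneg (by norm_num)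
  have h0 : 0 ≤ Real.log 2 / (1 - r) := by positivity
  have key : ENNReal.ofReal (Real.log 2) + r * ((Real.log 2 / (1 - r)).toNNReal : ℝ≥0)
      ≤ ((Real.log 2 / (1 - r)).toNNReal : ℝ≥0) := by
    change _ + _ * ENNReal.ofReal _ ≤ ENNReal.ofReal _
    rw [← ENNReal.ofReal_coe_nnreal (p := r), ← ENNReal.ofReal_mul (NNReal.coe_nonneg r),
      ← ENNReal.ofReal_add hl (by positivity)]
    refine ENNReal.ofReal_le_ofReal (le_of_eq ?_)
    field_simp
    ring
  exact ⟨_, key, le_self_add.trans key⟩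

/-- **Contraction.** Under the Belief Propagation recursion with `r < 1`, the gap between the upper
and the lower bound vanishes in the limit of large depth. -/
lemma tendsto_gap {r : ℝ≥0} (hr : r < 1) :
    Tendsto (fun ℓ => ∫⁻ u, ENNReal.ofReal ((u.2 : ℝ) - u.1) ∂msgLaw r trivialMsg ℓ)
      atTop (𝓝 0) := by
  obtain ⟨K, hK, hK2⟩ := exists_negLog_bound hr
  have hB := ae_isBound_msgLaw (r := r) isBound_trivialMsg
  have hF := msgLaw_map_flip r flip_trivialMsg
  -- a lower bound vanishes only if that of one of the messages in the first product does, of which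
  -- there are `r` in expectation
  have hp : ∀ ℓ, msgLaw r trivialMsg ℓ {u | u.1 = 0} ≤ (r : ℝ≥0∞) ^ ℓ := by
    intro ℓ
    induction ℓ with
    | zero => simpa using prob_le_one
    | succ ℓ ih =>
      refine fst_zero_step.trans ?_
      rw [pow_succ']
      gcongr
  have hL : ∀ ℓ, ∫⁻ v, negLog v ∂msgLaw r trivialMsg ℓ ≤ K := fun ℓ =>
    lintegral_negLog_le hK (by simp [negLog, trivialMsg]) ℓ
  have hR : ∀ ℓ, ∫⁻ v, negLogTop v ∂msgLaw r trivialMsg ℓ ≤ K * (r : ℝ≥0∞) ^ ℓ := by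
    intro ℓ
    cases ℓ with
    | zero =>
      rw [msgLaw, lintegral_dirac' _ measurable_negLogTop]
      simp [negLogTop, negLog, trivialMsg]
    | succ ℓ =>
      refine negLogTop_step.trans ?_
      rw [pow_succ']
      have := hp ℓ
      have := hL ℓ
      gcongr
      refine le_trans ?_ hK
      gcongr
  -- the recursion `G (ℓ + 1) ≤ r * G ℓ + 2 * K * r ^ (ℓ + 1)` has the solution `2 * K * ℓ * r ^ ℓ`
  have hG : ∀ ℓ : ℕ, ∫⁻ v, oddsGap v ∂msgLaw r trivialMsg ℓ ≤ 2 * K * (ℓ * (r : ℝ≥0∞) ^ ℓ) := by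
    intro ℓ
    induction ℓ with
    | zero =>
      rw [msgLaw, lintegral_dirac' _ measurable_oddsGap]
      simp [oddsGap, trivialMsg]
    | succ ℓ ih =>
      refine (oddsGap_step (hB ℓ) (hF ℓ)).trans ?_
      have := hR ℓ
      calc _ ≤ (r : ℝ≥0∞) * (2 * K * (ℓ * (r : ℝ≥0∞) ^ ℓ) + 2 * (K * (r : ℝ≥0∞) ^ ℓ)) := by gcongr
        _ = _ := by push_cast; ring
  have hmain : ∀ ℓ : ℕ, ∫⁻ u, ENNReal.ofReal ((u.2 : ℝ) - u.1) ∂msgLaw r trivialMsg ℓ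
      ≤ 2 * K * (ℓ * (r : ℝ≥0∞) ^ ℓ) + 2 * (r : ℝ≥0∞) ^ ℓ := by
    intro ℓ
    have hm : Measurable ({u : Msg | u.1 = 0}.indicator (1 : Msg → ℝ≥0∞)) :=
      measurable_one.indicator measurableSet_fst_zero
    calc _ ≤ ∫⁻ u, (oddsGap u + ({v : Msg | v.1 = 0}.indicator 1 u
      + {v : Msg | v.1 = 0}.indicator 1 (flip u))) ∂msgLaw r trivialMsg ℓ := by
          refine lintegral_mono_ae ?_
          filter_upwards [hB ℓ] with u hu using gap_le hu
      _ = ∫⁻ u, oddsGap u ∂msgLaw r trivialMsg ℓ + 2 * msgLaw r trivialMsg ℓ {u | u.1 = 0} := by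
          rw [lintegral_add_left measurable_oddsGap, lintegral_add_left hm,
            ← lintegral_map hm continuous_flip.measurable, hF, two_mul,
            lintegral_indicator_one measurableSet_fst_zero]
      _ ≤ _ := by
          have := hp ℓ
          have := hG ℓ
          gcongr
  refine tendsto_of_tendsto_of_tendsto_of_le_of_le tendsto_const_nhds ?_ (fun _ => zero_le) hmain
  have hr' : (r : ℝ) < 1 := by exact_mod_cast hr
  have t1 := tendsto_self_mul_const_pow_of_lt_one r.2 hr'
  have t2 := tendsto_pow_atTop_nhds_zero_of_lt_one r.2 hr'
  have t3 := ENNReal.tendsto_ofReal (((t1.const_mul (2 * (K : ℝ))).add (t2.const_mul 2)))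
  simp only [mul_zero, add_zero, ENNReal.ofReal_zero] at t3
  refine t3.congr fun ℓ => ?_
  have hr0 := r.2
  have hK0 := K.2
  change ENNReal.ofReal (2 * (K : ℝ) * (ℓ * (r : ℝ) ^ ℓ) + 2 * (r : ℝ) ^ ℓ) = _
  rw [ENNReal.ofReal_add (by positivity) (by positivity), ENNReal.ofReal_mul (by positivity),
    ENNReal.ofReal_mul (by positivity), ENNReal.ofReal_mul (by positivity),
    ENNReal.ofReal_mul (by positivity), ENNReal.ofReal_pow (NNReal.coe_nonneg r)]
  simp

/-! ### Messages on the random formula -/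

/-- The multiplicities of all ordered pairs of literals, as clauses of a formula. Pairs over a
single variable are carried along but never used. -/
abbrev Config (n : ℕ) : Type := Literal n × Literal n → ℕ

/-- Independent Poisson multiplicities with mean `lam`. -/
abbrev configLaw (n : ℕ) (lam : ℝ≥0) : Measure (Config n) :=
  Measure.pi fun _ => poissonMeasure lam

/-- The multiplicity of the unordered clause `{a, b}`. -/
def mult {n : ℕ} (ω : Config n) (a b : Literal n) : ℕ := ω (a, b) + ω (b, a)

/-- The message about a literal, given the message about its variable. -/
def lit (u : Msg) (t : Bool) : Msg := if t then u else flip u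

/-- The product of the messages about the literals over variables in `S` that share a clause with
the literal `(x, s)`. -/
def collect {n : ℕ} (ω : Config n) (S : Finset (Fin n)) (x : Fin n) (s : Bool)
    (u : Fin n → Msg) : Msg :=
  ∏ y ∈ S, ∏ t : Bool, lit (u y) t ^ mult ω (x, s) (y, t)

/-- The message of depth `ℓ` about the variable `x` in the subformula on the variables `S`. It
combines the messages of depth `ℓ - 1` about the neighbours of `x` after the removal of `x`;
messages of depth `0` are equal to `u`. -/
def msg {n : ℕ} (u : Msg) (ω : Config n) : ℕ → Finset (Fin n) → Fin n → Msg
  | 0, _, _ => u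
  | ℓ + 1, S, x =>
    combine (collect ω (S.erase x) x false (msg u ω ℓ (S.erase x)),
      collect ω (S.erase x) x true (msg u ω ℓ (S.erase x)))

/-- Two variables are adjacent if they share a clause. -/
def Adj {n : ℕ} (ω : Config n) (x y : Fin n) : Prop := ∃ s t, mult ω (x, s) (y, t) ≠ 0

/-- `v` can be reached from `x` by a self-avoiding path in `S` with fewer than `ℓ` edges. -/
def InBall {n : ℕ} (ω : Config n) : ℕ → Finset (Fin n) → Fin n → Fin n → Prop
  | 0, _, _, _ => False
  | ℓ + 1, S, x, v =>
    v = x ∨ ∃ y ∈ S.erase x, Adj ω x y ∧ InBall ω ℓ (S.erase x) y v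

section locality
variable {n : ℕ} {ω ω' : Config n}

lemma mult_comm (ω : Config n) (a b : Literal n) : mult ω a b = mult ω b a := add_comm _ _

lemma Adj.symm {x y : Fin n} (h : Adj ω x y) : Adj ω y x := by
  obtain ⟨s, t, h⟩ := h
  exact ⟨t, s, by rwa [mult_comm]⟩

/-- Two configurations agree on the clauses within `S`. -/
def AgreeOn (S : Finset (Fin n)) (ω ω' : Config n) : Prop :=
  ∀ p : Literal n × Literal n, p.1.1 ∈ S → p.2.1 ∈ S → ω p = ω' p

lemma AgreeOn.mono {S T : Finset (Fin n)} (h : AgreeOn S ω ω') (hT : T ⊆ S) : AgreeOn T ω ω' :=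
  fun p h1 h2 => h p (hT h1) (hT h2)

lemma AgreeOn.mult_eq {S : Finset (Fin n)} (h : AgreeOn S ω ω') {x y : Fin n} (hx : x ∈ S)
    (hy : y ∈ S) (s t : Bool) : mult ω (x, s) (y, t) = mult ω' (x, s) (y, t) := by
  unfold mult
  rw [h _ hx hy, h _ hy hx]

lemma AgreeOn.adj_iff {S : Finset (Fin n)} (h : AgreeOn S ω ω') {x y : Fin n} (hx : x ∈ S)
    (hy : y ∈ S) : Adj ω x y ↔ Adj ω' x y := by
  unfold Adj
  simp only [h.mult_eq hx hy]

lemma msg_congr (u : Msg) (ℓ : ℕ) : ∀ {S : Finset (Fin n)} {x : Fin n}, AgreeOn S ω ω' → x ∈ S →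
    msg u ω ℓ S x = msg u ω' ℓ S x := by
  induction ℓ with
  | zero => intros; rfl
  | succ ℓ ih =>
    intro S x h hx
    have hc : ∀ s, collect ω (S.erase x) x s (msg u ω ℓ (S.erase x))
        = collect ω' (S.erase x) x s (msg u ω' ℓ (S.erase x)) := by
      intro s
      refine Finset.prod_congr rfl fun y hy => Finset.prod_congr rfl fun t _ => ?_
      rw [ih (h.mono (Finset.erase_subset _ _)) hy, h.mult_eq hx (Finset.mem_of_mem_erase hy)]
    rw [msg, msg, hc, hc]

lemma inBall_congr (ℓ : ℕ) : ∀ {S : Finset (Fin n)} {x : Fin n} (v : Fin n), AgreeOn S ω ω' →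
    x ∈ S → (InBall ω ℓ S x v ↔ InBall ω' ℓ S x v) := by
  induction ℓ with
  | zero => intros; rfl
  | succ ℓ ih =>
    intro S x v h hx
    refine or_congr Iff.rfl (exists_congr fun y => and_congr_right fun hy => ?_)
    rw [h.adj_iff hx (Finset.mem_of_mem_erase hy), ih v (h.mono (Finset.erase_subset _ _)) hy]

/-- The removal of a variable outside the ball of radius `ℓ` does not affect the message of depth
`ℓ`. -/
lemma msg_erase (u : Msg) (ℓ : ℕ) : ∀ {S : Finset (Fin n)} {x v : Fin n},
    ¬ InBall ω (ℓ + 1) S x v → msg u ω ℓ S x = msg u ω ℓ (S.erase v) x := by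
  induction ℓ with
  | zero => intros; rfl
  | succ ℓ ih =>
    intro S x v h
    rw [InBall, not_or] at h
    obtain ⟨hvx, h⟩ := h
    push Not at h
    have hc : ∀ s, collect ω (S.erase x) x s (msg u ω ℓ (S.erase x))
        = collect ω ((S.erase v).erase x) x s (msg u ω ℓ ((S.erase v).erase x)) := by
      intro s
      have hsub : (S.erase v).erase x ⊆ S.erase x :=
        Finset.erase_subset_erase _ (Finset.erase_subset _ _)
      unfold collect
      rw [← Finset.prod_subset hsub]
      · refine Finset.prod_congr rfl fun y hy => Finset.prod_congr rfl fun t _ => ?_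
        by_cases hm : mult ω (x, s) (y, t) = 0
        · rw [hm, pow_zero, pow_zero]
        · rw [ih (h y (hsub hy) ⟨s, t, hm⟩), Finset.erase_right_comm]
      · intro y hy hy'
        have hyv : y = v := by
          by_contra hne
          exact hy' (Finset.mem_erase.2 ⟨Finset.ne_of_mem_erase hy,
            Finset.mem_erase.2 ⟨hne, Finset.mem_of_mem_erase hy⟩⟩)
        refine Finset.prod_eq_one fun t _ => ?_
        by_cases hm : mult ω (x, s) (y, t) = 0
        · rw [hm, pow_zero]
        · exact absurd (Or.inl hyv.symm) (h y hy ⟨s, t, hm⟩)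
    rw [msg, msg, hc, hc]

end locality

/-! ### Probabilities of adjacency and of short paths -/

section probability
variable {n : ℕ} {lam : ℝ≥0}

lemma measurableSet_config (E : Set (Config n)) : MeasurableSet E := E.to_countable.measurableSet

/-- The clauses that involve the variable `x`. -/
def star (x : Fin n) : Set (Literal n × Literal n) := {p | p.1.1 = x ∨ p.2.1 = x}

lemma agreeOn_of_off_star {x : Fin n} {S : Finset (Fin n)} (hx : x ∉ S) {ω ω' : Config n}
    (h : ∀ p ∉ star x, ω p = ω' p) : AgreeOn S ω ω' := by
  intro p h1 h2
  refine h p ?_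
  rintro (h' | h')
  · exact hx (h' ▸ h1)
  · exact hx (h' ▸ h2)

lemma mult_eq_of_star {x : Fin n} {ω ω' : Config n} (h : ∀ p ∈ star x, ω p = ω' p) (s : Bool)
    (b : Literal n) : mult ω (x, s) b = mult ω' (x, s) b := by
  unfold mult
  rw [h _ (Or.inl rfl), h _ (Or.inr rfl)]

lemma adj_iff_of_star {x : Fin n} {ω ω' : Config n} (h : ∀ p ∈ star x, ω p = ω' p) (y : Fin n) :
    Adj ω x y ↔ Adj ω' x y := by
  unfold Adj
  simp only [mult_eq_of_star h]

lemma measureReal_coord (p : Literal n × Literal n) (A : Set ℕ) :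
    (configLaw n lam).real {ω | ω p ∈ A} = (poissonMeasure lam).real A := by
  have := (measurePreserving_eval (fun _ : Literal n × Literal n => poissonMeasure lam) p).map_eq
  rw [← this, map_measureReal_apply (measurable_pi_apply p) A.to_countable.measurableSet]
  rfl

lemma measureReal_coord_ne_zero (p : Literal n × Literal n) :
    (configLaw n lam).real {ω | ω p ≠ 0} ≤ lam := by
  refine (measureReal_coord p {k | k ≠ 0}).le.trans ?_
  exact ENNReal.toReal_le_coe_of_le_coe (poisson_ne_zero_le lam)

lemma measureReal_adj (x y : Fin n) : (configLaw n lam).real {ω | Adj ω x y} ≤ 8 * lam := by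
  have hsub : {ω : Config n | Adj ω x y} ⊆ ⋃ q ∈ (Finset.univ : Finset (Bool × Bool)),
      ({ω | ω ((x, q.1), (y, q.2)) ≠ 0} ∪ {ω | ω ((y, q.2), (x, q.1)) ≠ 0}) := by
    rintro ω ⟨s, t, h⟩
    simp only [Set.mem_iUnion]
    refine ⟨(s, t), Finset.mem_univ _, ?_⟩
    by_contra hc
    simp only [Set.mem_union, Set.mem_ofPred_eq, not_or, not_not] at hc
    exact h (by unfold mult; omega)
  calc _ ≤ _ := measureReal_mono hsub (measure_ne_top _ _)
    _ ≤ ∑ q : Bool × Bool, (configLaw n lam).real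
          ({ω | ω ((x, q.1), (y, q.2)) ≠ 0} ∪ {ω | ω ((y, q.2), (x, q.1)) ≠ 0}) :=
        measureReal_biUnion_finset_le _ _
    _ ≤ ∑ q : Bool × Bool, (2 * lam : ℝ) := by
        refine Finset.sum_le_sum fun q _ => (measureReal_union_le _ _).trans ?_
        linarith [measureReal_coord_ne_zero (lam := lam) ((x, q.1), (y, q.2)),
          measureReal_coord_ne_zero (lam := lam) ((y, q.2), (x, q.1))]
    _ = _ := by simp; ring

/-- Adjacency to `x` is independent of what happens on variables other than `x`. -/
lemma measureReal_adj_inter {x y : Fin n} {S : Finset (Fin n)} (hx : x ∉ S) (E : Set (Config n))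
    (hE : ∀ ω ω', AgreeOn S ω ω' → (ω ∈ E ↔ ω' ∈ E)) :
    (configLaw n lam).real ({ω | Adj ω x y} ∩ E) ≤ 8 * lam * (configLaw n lam).real E := by
  rw [measureReal_inter_eq_mul _ (star x) {ω | Adj ω x y} E (fun ω ω' h => adj_iff_of_star h y)
    (fun ω ω' h => hE _ _ (agreeOn_of_off_star hx h))]
  exact mul_le_mul_of_nonneg_right (measureReal_adj x y) measureReal_nonneg

/-- A bound on the probability that two given variables among `N` are joined by a path with fewer
than `ℓ` edges. -/
def pathBound (lam : ℝ) (N : ℝ) : ℕ → ℝ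
  | 0 => 0
  | ℓ + 1 => 8 * lam + 8 * lam * N * pathBound lam N ℓ

lemma pathBound_nonneg {lam N : ℝ} (h : 0 ≤ lam) (hN : 0 ≤ N) (ℓ : ℕ) :
    0 ≤ pathBound lam N ℓ := by
  induction ℓ with
  | zero => exact le_rfl
  | succ ℓ ih => unfold pathBound; positivity

lemma measureReal_inBall {N : ℕ} (ℓ : ℕ) : ∀ {S : Finset (Fin n)} {x v : Fin n}, S.card ≤ N →
    x ≠ v → (configLaw n lam).real {ω | InBall ω ℓ S x v} ≤ pathBound lam N ℓ := by
  induction ℓ with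
  | zero => intro S x v _ _; simp [InBall, pathBound]
  | succ ℓ ih =>
    intro S x v hS hxv
    have hp := pathBound_nonneg (NNReal.coe_nonneg lam) (Nat.cast_nonneg N) ℓ
    have hlam : (0 : ℝ) ≤ lam := lam.2
    have hsub : {ω : Config n | InBall ω (ℓ + 1) S x v} ⊆ {ω | Adj ω x v} ∪
        ⋃ y ∈ (S.erase x).erase v, ({ω | Adj ω x y} ∩ {ω | InBall ω ℓ (S.erase x) y v}) := by
      rintro ω (h | ⟨y, hy, h1, h2⟩)
      · exact absurd h.symm hxv
      · by_cases hyv : y = v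
        · exact Or.inl (hyv ▸ h1)
        · refine Or.inr ?_
          simp only [Set.mem_iUnion]
          exact ⟨y, Finset.mem_erase.2 ⟨hyv, hy⟩, h1, h2⟩
    have hcard : (S.erase x).card ≤ N := (Finset.card_le_card (Finset.erase_subset _ _)).trans hS
    calc _ ≤ _ := measureReal_mono hsub
      _ ≤ _ := measureReal_union_le _ _
      _ ≤ 8 * lam + ∑ y ∈ (S.erase x).erase v, 8 * (lam : ℝ) * pathBound lam N ℓ := by
          refine add_le_add (measureReal_adj x v) ((measureReal_biUnion_finset_le _ _).trans
            (Finset.sum_le_sum fun y hy => ?_))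
          have hy' := Finset.mem_of_mem_erase hy
          refine (measureReal_adj_inter (S := S.erase x) (Finset.notMem_erase x S) _
            (fun ω ω' h => inBall_congr ℓ v h hy')).trans ?_
          exact mul_le_mul_of_nonneg_left (ih hcard (Finset.ne_of_mem_erase hy)) (by positivity)
      _ ≤ _ := by
          rw [Finset.sum_const, nsmul_eq_mul, pathBound]
          have : (((S.erase x).erase v).card : ℝ) ≤ N := by
            exact_mod_cast (Finset.card_le_card (Finset.erase_subset _ _)).trans hcard
          nlinarith [mul_le_mul_of_nonneg_right this (mul_nonneg hlam hp)]

end probability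

/-- A family of variable sets and clause rates along which the number of variables grows and the
mean number of clauses at a literal converges to `r`. -/
def Grow (r : ℝ) {κ : Type} (l : Filter κ) (n : κ → ℕ) (lam : κ → ℝ≥0)
    (S : ∀ k, Finset (Fin (n k))) : Prop :=
  Tendsto (fun k => ((S k).card : ℝ)) l atTop ∧
    Tendsto (fun k => 4 * (S k).card * (lam k : ℝ)) l (𝓝 r)

section grow
variable {r : ℝ} {κ : Type} {l : Filter κ} {n : κ → ℕ} {lam : κ → ℝ≥0}
  {S : ∀ k, Finset (Fin (n k))}

lemma Grow.tendsto_lam (h : Grow r l n lam S) : Tendsto (fun k => (lam k : ℝ)) l (𝓝 0) := by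
  have h1 := h.2.div_atTop h.1
  have h2 := h1.div_const 4
  rw [zero_div] at h2
  refine h2.congr' ?_
  filter_upwards [h.1.eventually_gt_atTop 0] with k hk
  field_simp

lemma Grow.tendsto_pathBound (h : Grow r l n lam S) (ℓ : ℕ) :
    Tendsto (fun k => pathBound (lam k) (S k).card ℓ) l (𝓝 0) := by
  induction ℓ with
  | zero => exact tendsto_const_nhds
  | succ ℓ ih =>
    have h1 := (h.tendsto_lam.const_mul 8).add ((h.2.const_mul 2).mul ih)
    simp only [mul_zero, add_zero] at h1
    refine h1.congr fun k => ?_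
    rw [pathBound]; ring

lemma Grow.erase (h : Grow r l n lam S) (x : ∀ k, Fin (n k)) :
    Grow r l n lam fun k => (S k).erase (x k) := by
  have hle : ∀ k, ((S k).card : ℝ) - 1 ≤ ((S k).erase (x k)).card := by
    intro k
    have := Finset.pred_card_le_card_erase (s := S k) (a := x k)
    have h2 : (S k).card ≤ ((S k).erase (x k)).card + 1 := by omega
    have : ((S k).card : ℝ) ≤ ((S k).erase (x k)).card + 1 := by exact_mod_cast h2
    linarith
  have hge : ∀ k, (((S k).erase (x k)).card : ℝ) ≤ (S k).card := fun k => by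
    exact_mod_cast Finset.card_le_card (Finset.erase_subset _ _)
  refine ⟨tendsto_atTop_mono hle (tendsto_atTop_add_const_right _ _ h.1), ?_⟩
  refine tendsto_of_tendsto_of_tendsto_of_le_of_le
    (g := fun k => 4 * (S k).card * (lam k : ℝ) - 4 * lam k) ?_ h.2 ?_ ?_
  · simpa using h.2.sub (h.tendsto_lam.const_mul 4)
  · intro k
    have := mul_le_mul_of_nonneg_right (hle k) (NNReal.coe_nonneg (lam k))
    show 4 * ((S k).card : ℝ) * lam k - 4 * lam k ≤ 4 * ((S k).erase (x k)).card * lam k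
    nlinarith
  · intro k
    have := mul_le_mul_of_nonneg_right (hge k) (NNReal.coe_nonneg (lam k))
    show 4 * (((S k).erase (x k)).card : ℝ) * lam k ≤ 4 * ((S k).card : ℝ) * lam k
    nlinarith

end grow

/-! ### Weak convergence of resampled messages -/

/-- Bounded measurable functions. -/
def BddMeas {X : Type*} [MeasurableSpace X] (φ : X → ℝ) : Prop :=
  Measurable φ ∧ ∃ C, ∀ w, |φ w| ≤ C

section bddMeas
variable {X : Type*} [MeasurableSpace X] {φ ψ : X → ℝ}

lemma BddMeas.integrable (h : BddMeas φ) (μ : Measure X) [IsFiniteMeasure μ] : Integrable φ μ := by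
  obtain ⟨h1, C, h2⟩ := h
  exact Integrable.of_bound h1.aestronglyMeasurable C (ae_of_all _ h2)

lemma BddMeas.add (h : BddMeas φ) (h' : BddMeas ψ) : BddMeas fun w => φ w + ψ w := by
  obtain ⟨h1, C, h2⟩ := h
  obtain ⟨h1', C', h2'⟩ := h'
  exact ⟨h1.add h1', C + C', fun w => (abs_add_le _ _).trans (add_le_add (h2 w) (h2' w))⟩

lemma BddMeas.const_mul (h : BddMeas φ) (c : ℝ) : BddMeas fun w => c * φ w := by
  obtain ⟨h1, C, h2⟩ := h
  exact ⟨h1.const_mul c, |c| * C, fun w => by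
    rw [abs_mul]; exact mul_le_mul_of_nonneg_left (h2 w) (abs_nonneg c)⟩

lemma bddMeas_const (c : ℝ) : BddMeas fun _ : X => c := ⟨measurable_const, |c|, fun _ => le_rfl⟩

lemma bddMeas_of_continuous [TopologicalSpace X] [CompactSpace X] [OpensMeasurableSpace X]
    (φ : C(X, ℝ)) : BddMeas φ :=
  ⟨φ.continuous.measurable, ‖φ‖, fun w => φ.norm_coe_le_norm w⟩

lemma BddMeas.comp {Z : Type*} [MeasurableSpace Z] (h : BddMeas φ) {g : Z → X}
    (hg : Measurable g) : BddMeas fun z => φ (g z) :=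
  ⟨h.1.comp hg, h.2.imp fun _ hC _ => hC _⟩

end bddMeas

section resampled

/-- The mean error in the approximation of the conditional law of `Y ω' ω` given `ω` by `ν`, tested
against `φ`. -/
def condErr {n : ℕ} (lam : ℝ≥0) (Y : Config n → Config n → Msg × Msg) (ν : Measure (Msg × Msg))
    (φ : Msg × Msg → ℝ) : ℝ :=
  ∫ ω, |∫ ω', φ (Y ω' ω) ∂configLaw n lam - ∫ w, φ w ∂ν| ∂configLaw n lam

variable {n : ℕ} {lam : ℝ≥0} {Y : Config n → Config n → Msg × Msg}
  {ν : Measure (Msg × Msg)} {φ ψ η : Msg × Msg → ℝ}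

lemma abs_integral_le_of_bound {X : Type*} [MeasurableSpace X] {μ : Measure X}
    [IsProbabilityMeasure μ] {f : X → ℝ} {C : ℝ} (h : ∀ x, |f x| ≤ C) : |∫ x, f x ∂μ| ≤ C := by
  have := norm_integral_le_of_norm_le_const (μ := μ) (f := f) (ae_of_all _ h)
  simpa using this

lemma condErr_nonneg : 0 ≤ condErr lam Y ν φ := integral_nonneg fun _ => abs_nonneg _

lemma condErr_const_mul (c : ℝ) :
    condErr lam Y ν (fun w => c * φ w) = |c| * condErr lam Y ν φ := by
  unfold condErr
  simp_rw [integral_const_mul, ← mul_sub, abs_mul, integral_const_mul]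

variable [IsProbabilityMeasure ν]

lemma BddMeas.condErr_integrand (h : BddMeas φ) :
    BddMeas fun ω => |∫ ω', φ (Y ω' ω) ∂configLaw n lam - ∫ w, φ w ∂ν| := by
  obtain ⟨h1, C, h2⟩ := h
  refine ⟨measurable_of_countable _, C + C, fun ω => ?_⟩
  rw [abs_abs]
  exact (abs_sub _ _).trans (add_le_add (abs_integral_le_of_bound fun _ => h2 _)
    (abs_integral_le_of_bound h2))

lemma integrable_config_comp (h : BddMeas φ) (ω : Config n) :
    Integrable (fun ω' => φ (Y ω' ω)) (configLaw n lam) :=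
  (h.comp (g := fun ω' => Y ω' ω) (measurable_of_countable _)).integrable _

lemma condErr_add (h : BddMeas φ) (h' : BddMeas ψ) :
    condErr lam Y ν (fun w => φ w + ψ w) ≤ condErr lam Y ν φ + condErr lam Y ν ψ := by
  unfold condErr
  rw [← integral_add (h.condErr_integrand.integrable _) (h'.condErr_integrand.integrable _)]
  refine integral_mono ((h.add h').condErr_integrand.integrable _)
    ((h.condErr_integrand.integrable _).add (h'.condErr_integrand.integrable _)) fun ω => ?_
  simp only
  rw [integral_add (h.integrable _) (h'.integrable _), integral_add (integrable_config_comp h ω)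
    (integrable_config_comp h' ω), add_sub_add_comm]
  exact abs_add_le _ _

lemma condErr_const (c : ℝ) : condErr lam Y ν (fun _ => c) = 0 := by
  simp [condErr]

/-- If `η` dominates `|φ - ψ|`, then the errors of `φ` and `ψ` differ by at most the integrals of
`η` against both laws, one of which is replaced by the other at the price of the error of `η`. -/
lemma condErr_le (h : BddMeas φ) (h' : BddMeas ψ) (hη : BddMeas η)
    (hle : ∀ w, |φ w - ψ w| ≤ η w) :
    condErr lam Y ν φ ≤ condErr lam Y ν ψ + (condErr lam Y ν η + 2 * ∫ w, η w ∂ν) := by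
  have hc : condErr lam Y ν η + 2 * ∫ w, η w ∂ν
      = ∫ ω, (|∫ ω', η (Y ω' ω) ∂configLaw n lam - ∫ w, η w ∂ν| + 2 * ∫ w, η w ∂ν)
        ∂configLaw n lam := by
    rw [integral_add (hη.condErr_integrand.integrable _) (integrable_const _)]
    simp [condErr]
  rw [hc]
  unfold condErr
  have hη' : Integrable (fun ω => |∫ ω', η (Y ω' ω) ∂configLaw n lam - ∫ w, η w ∂ν|
      + 2 * ∫ w, η w ∂ν) (configLaw n lam) :=
    (hη.condErr_integrand.integrable _).add (integrable_const _)
  rw [← integral_add (h'.condErr_integrand.integrable _) hη']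
  refine integral_mono (h.condErr_integrand.integrable _)
    ((h'.condErr_integrand.integrable _).add hη') fun ω => ?_
  have key : ∀ {X : Type} [MeasurableSpace X] (μ : Measure X) [IsProbabilityMeasure μ]
      (g : X → Msg × Msg), Measurable g →
      |∫ x, φ (g x) ∂μ - ∫ x, ψ (g x) ∂μ| ≤ ∫ x, η (g x) ∂μ := by
    intro X _ μ _ g hg
    rw [← integral_sub ((h.comp hg).integrable _) ((h'.comp hg).integrable _)]
    exact (abs_integral_le_integral_abs).trans (integral_mono
      (((h.comp hg).integrable _).sub ((h'.comp hg).integrable _)).abs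
      ((hη.comp hg).integrable _) fun x => hle _)
  have k1 := key (configLaw n lam) (fun ω' => Y ω' ω) (measurable_of_countable _)
  have k2 := key ν id measurable_id
  simp only [id] at k2
  have k3 := le_abs_self (∫ ω', η (Y ω' ω) ∂configLaw n lam - ∫ w, η w ∂ν)
  simp only
  rw [abs_le] at k1 k2 ⊢
  have k4 := neg_abs_le (∫ ω', ψ (Y ω' ω) ∂configLaw n lam - ∫ w, ψ w ∂ν)
  have k5 := le_abs_self (∫ ω', ψ (Y ω' ω) ∂configLaw n lam - ∫ w, ψ w ∂ν)
  constructor <;> linarith [k1.1, k1.2, k2.1, k2.2]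

/-- A multiplicative test function on messages. -/
structure IsChar (χ : Msg → ℝ) : Prop where
  cont : Continuous χ
  nonneg : ∀ u, 0 ≤ χ u
  le_one : ∀ u, χ u ≤ 1
  map_one : χ 1 = 1
  map_mul : ∀ u v, χ (u * v) = χ u * χ v

lemma isChar_one : IsChar fun _ => 1 :=
  ⟨continuous_const, fun _ => zero_le_one, fun _ => le_rfl, rfl, fun _ _ => by simp⟩

lemma isChar_fst : IsChar fun u => u.1 :=
  ⟨by fun_prop, fun u => u.1.2.1, fun u => u.1.2.2, rfl, fun _ _ => rfl⟩

lemma isChar_snd : IsChar fun u => u.2 :=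
  ⟨by fun_prop, fun u => u.2.2.1, fun u => u.2.2.2, rfl, fun _ _ => rfl⟩

lemma IsChar.mul {χ χ' : Msg → ℝ} (h : IsChar χ) (h' : IsChar χ') :
    IsChar fun u => χ u * χ' u :=
  ⟨h.cont.mul h'.cont, fun u => mul_nonneg (h.nonneg u) (h'.nonneg u),
    fun u => mul_le_one₀ (h.le_one u) (h'.nonneg u) (h'.le_one u), by simp [h.map_one, h'.map_one],
    fun u v => by rw [h.map_mul, h'.map_mul]; ring⟩

/-- The multiplicative test functions on pairs of messages. -/
def charSubmonoid : Submonoid C(Msg × Msg, ℝ) where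
  carrier := {φ | ∃ χ₁ χ₂, IsChar χ₁ ∧ IsChar χ₂ ∧ ∀ w, φ w = χ₁ w.1 * χ₂ w.2}
  one_mem' := ⟨_, _, isChar_one, isChar_one, fun _ => by simp⟩
  mul_mem' := by
    rintro φ ψ ⟨χ₁, χ₂, h1, h2, h⟩ ⟨χ₁', χ₂', h1', h2', h'⟩
    refine ⟨_, _, h1.mul h1', h2.mul h2', fun w => ?_⟩
    rw [ContinuousMap.mul_apply, h, h']; ring

lemma adjoin_char_dense :
    (Algebra.adjoin ℝ (charSubmonoid : Set C(Msg × Msg, ℝ))).topologicalClosure = ⊤ := by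
  refine ContinuousMap.subalgebra_topologicalClosure_eq_top_of_separatesPoints _ ?_
  intro w w' hw
  by_contra hc
  have hc' : ∀ χ₁ χ₂, IsChar χ₁ → IsChar χ₂ → χ₁ w.1 * χ₂ w.2 = χ₁ w'.1 * χ₂ w'.2 := by
    intro χ₁ χ₂ h1 h2
    by_contra hne
    refine hc ⟨_, ⟨⟨fun w => χ₁ w.1 * χ₂ w.2, (h1.cont.comp continuous_fst).mul
      (h2.cont.comp continuous_snd)⟩, Algebra.subset_adjoin ⟨χ₁, χ₂, h1, h2,
      fun _ => rfl⟩, rfl⟩, ?_⟩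
    exact hne
  refine hw ?_
  have e1 := hc' _ _ isChar_fst isChar_one
  have e2 := hc' _ _ isChar_snd isChar_one
  have e3 := hc' _ _ isChar_one isChar_fst
  have e4 := hc' _ _ isChar_one isChar_snd
  simp only [mul_one, one_mul] at e1 e2 e3 e4
  exact Prod.ext (Prod.ext (Subtype.ext e1) (Subtype.ext e2))
    (Prod.ext (Subtype.ext e3) (Subtype.ext e4))

end resampled

section limits
variable {κ : Type} {l : Filter κ} {n : κ → ℕ} {lam : κ → ℝ≥0}
  {Y : ∀ k, Config (n k) → Config (n k) → Msg × Msg}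
  {ν : Measure (Msg × Msg)} [IsProbabilityMeasure ν]

/-- Convergence on multiplicative test functions implies convergence on all continuous ones, by the
Stone-Weierstrass theorem. -/
lemma tendsto_condErr_of_char
    (h : ∀ χ₁ χ₂, IsChar χ₁ → IsChar χ₂ →
      Tendsto (fun k => condErr (lam k) (Y k) ν fun w => χ₁ w.1 * χ₂ w.2) l (𝓝 0))
    (φ : C(Msg × Msg, ℝ)) : Tendsto (fun k => condErr (lam k) (Y k) ν φ) l (𝓝 0) := by
  have hspan : ∀ ψ ∈ Algebra.adjoin ℝ (charSubmonoid : Set C(Msg × Msg, ℝ)),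
      Tendsto (fun k => condErr (lam k) (Y k) ν ψ) l (𝓝 0) := by
    intro ψ hψ
    rw [← Subalgebra.mem_toSubmodule, Algebra.adjoin_eq_span, Submonoid.closure_eq] at hψ
    induction hψ using Submodule.span_induction with
    | mem ψ hψ =>
      obtain ⟨χ₁, χ₂, h1, h2, h'⟩ := hψ
      have : (ψ : Msg × Msg → ℝ) = fun w => χ₁ w.1 * χ₂ w.2 := funext h'
      rw [this]
      exact h _ _ h1 h2
    | zero =>
      have : ((0 : C(Msg × Msg, ℝ)) : Msg × Msg → ℝ) = fun _ => 0 := rfl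
      simp_rw [this, condErr_const]
      exact tendsto_const_nhds
    | add φ ψ _ _ h1 h2 =>
      have h3 := h1.add h2
      rw [add_zero] at h3
      exact squeeze_zero (fun _ => condErr_nonneg)
        (fun k => condErr_add (bddMeas_of_continuous φ) (bddMeas_of_continuous ψ)) h3
    | smul c φ _ h1 =>
      have h2 := h1.const_mul |c|
      rw [mul_zero] at h2
      exact h2.congr fun k => (condErr_const_mul (φ := φ) c).symm
  rw [Metric.tendsto_nhds]
  intro ε hε
  have hφ : φ ∈ (Algebra.adjoin ℝ (charSubmonoid : Set C(Msg × Msg, ℝ))).topologicalClosure := by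
    rw [adjoin_char_dense]; trivial
  have hφ' : φ ∈ closure (Algebra.adjoin ℝ (charSubmonoid : Set C(Msg × Msg, ℝ)) :
      Set C(Msg × Msg, ℝ)) := by
    rwa [← Subalgebra.topologicalClosure_coe]
  obtain ⟨ψ, hψ, hd⟩ := Metric.mem_closure_iff.1 hφ' (ε / 4) (by positivity)
  filter_upwards [(Metric.tendsto_nhds.1 (hspan ψ hψ)) (ε / 4) (by positivity)] with k hk
  rw [Real.dist_0_eq_abs, abs_of_nonneg condErr_nonneg] at hk ⊢
  have := condErr_le (lam := lam k) (Y := Y k) (ν := ν) (bddMeas_of_continuous φ)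
    (bddMeas_of_continuous ψ) (bddMeas_const (ε / 4))
    (fun w => (ContinuousMap.dist_apply_le_dist (f := φ) (g := ψ) w).trans hd.le)
  rw [condErr_const] at this
  simp only [integral_const, probReal_univ, smul_eq_mul, one_mul] at this
  linarith

/-- `frac` with the denominator bounded away from zero, which makes it continuous. -/
def fracCut (δ : ℝ) (A B : unitInterval) : ℝ := 1 / 2 + ((A : ℝ) - B) / (2 * max ((A : ℝ) + B) δ)

lemma fracCut_mem {δ : ℝ} (hδ : 0 < δ) (A B : unitInterval) :
    fracCut δ A B ∈ Set.Icc (0 : ℝ) 1 := by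
  have hm : 0 < max ((A : ℝ) + B) δ := lt_max_of_lt_right hδ
  have hle := le_max_left ((A : ℝ) + B) δ
  have hA := A.2.1
  have hB := B.2.1
  have h1 : |((A : ℝ) - B) / (2 * max ((A : ℝ) + B) δ)| ≤ 1 / 2 := by
    rw [abs_div, abs_of_pos (by positivity : 0 < 2 * max ((A : ℝ) + B) δ),
      div_le_iff₀ (by positivity)]
    rw [abs_le]
    constructor <;> linarith
  rw [abs_le] at h1
  unfold fracCut
  constructor <;> linarith [h1.1, h1.2]

/-- A continuous version of `combine`, which agrees with it where the denominators are at least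
`δ`. -/
def combineCut {δ : ℝ} (hδ : 0 < δ) : C(Msg × Msg, Msg) where
  toFun p := (⟨fracCut δ p.1.1 p.2.2, fracCut_mem hδ _ _⟩,
    ⟨fracCut δ p.1.2 p.2.1, fracCut_mem hδ _ _⟩)
  continuous_toFun := by
    unfold fracCut
    refine Continuous.prodMk (Continuous.subtype_mk ?_ _) (Continuous.subtype_mk ?_ _)
    · refine continuous_const.add (Continuous.div (by fun_prop) (by fun_prop) fun p => ?_)
      have : 0 < max ((p.1.1 : ℝ) + p.2.2) δ := lt_max_of_lt_right hδ
      positivity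
    · refine continuous_const.add (Continuous.div (by fun_prop) (by fun_prop) fun p => ?_)
      have : 0 < max ((p.1.2 : ℝ) + p.2.1) δ := lt_max_of_lt_right hδ
      positivity

/-- A continuous upper bound on the indicator of small denominators in `combine`. -/
def smallDenom (δ : ℝ) : C(Msg × Msg, ℝ) where
  toFun p := max 0 (2 - ((p.1.1 : ℝ) + p.2.2) / δ) + max 0 (2 - ((p.1.2 : ℝ) + p.2.1) / δ)
  continuous_toFun := by fun_prop

lemma smallDenom_nonneg (δ : ℝ) (p : Msg × Msg) : 0 ≤ smallDenom δ p :=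
  add_nonneg (le_max_left _ _) (le_max_left _ _)

lemma smallDenom_le {δ : ℝ} (hδ : 0 < δ) (p : Msg × Msg) : smallDenom δ p ≤ 4 := by
  have h1 : 0 ≤ ((p.1.1 : ℝ) + p.2.2) / δ := div_nonneg (add_nonneg p.1.1.2.1 p.2.2.2.1) hδ.le
  have h2 : 0 ≤ ((p.1.2 : ℝ) + p.2.1) / δ := div_nonneg (add_nonneg p.1.2.2.1 p.2.1.2.1) hδ.le
  have h3 : max 0 (2 - ((p.1.1 : ℝ) + p.2.2) / δ) ≤ 2 := max_le (by norm_num) (by linarith)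
  have h4 : max 0 (2 - ((p.1.2 : ℝ) + p.2.1) / δ) ≤ 2 := max_le (by norm_num) (by linarith)
  show max 0 (2 - ((p.1.1 : ℝ) + p.2.2) / δ) + max 0 (2 - ((p.1.2 : ℝ) + p.2.1) / δ) ≤ 4
  linarith

lemma abs_combine_sub_le {δ : ℝ} (hδ : 0 < δ) (F : C(Msg, ℝ)) (p : Msg × Msg) :
    |F (combine p) - F (combineCut hδ p)| ≤ 2 * ‖F‖ * smallDenom δ p := by
  have hF := norm_nonneg F
  by_cases h : δ ≤ (p.1.1 : ℝ) + p.2.2 ∧ δ ≤ (p.1.2 : ℝ) + p.2.1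
  · have : combine p = combineCut hδ p := by
      refine Prod.ext (Subtype.ext ?_) (Subtype.ext ?_)
      · show (frac p.1.1 p.2.2 : ℝ) = fracCut δ p.1.1 p.2.2
        simp [frac, fracCut, max_eq_left h.1]
      · show (frac p.1.2 p.2.1 : ℝ) = fracCut δ p.1.2 p.2.1
        simp [frac, fracCut, max_eq_left h.2]
    rw [this, sub_self, abs_zero]
    exact mul_nonneg (by positivity) (smallDenom_nonneg _ _)
  · have h1 : 1 ≤ smallDenom δ p := by
      show 1 ≤ max 0 (2 - ((p.1.1 : ℝ) + p.2.2) / δ) + max 0 (2 - ((p.1.2 : ℝ) + p.2.1) / δ)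
      rw [not_and_or, not_le, not_le] at h
      rcases h with h | h
      · have : ((p.1.1 : ℝ) + p.2.2) / δ ≤ 1 := (div_le_one hδ).2 h.le
        linarith [le_max_right 0 (2 - ((p.1.1 : ℝ) + p.2.2) / δ),
          le_max_left 0 (2 - ((p.1.2 : ℝ) + p.2.1) / δ)]
      · have : ((p.1.2 : ℝ) + p.2.1) / δ ≤ 1 := (div_le_one hδ).2 h.le
        linarith [le_max_left 0 (2 - ((p.1.1 : ℝ) + p.2.2) / δ),
          le_max_right 0 (2 - ((p.1.2 : ℝ) + p.2.1) / δ)]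
    have h2 : |F (combine p) - F (combineCut hδ p)| ≤ 2 * ‖F‖ := by
      refine (abs_sub _ _).trans ?_
      linarith [F.norm_coe_le_norm (combine p), F.norm_coe_le_norm (combineCut hδ p),
        Real.norm_eq_abs (F (combine p)), Real.norm_eq_abs (F (combineCut hδ p))]
    nlinarith

/-- Weak convergence passes through `combine`, although it is discontinuous, since its denominators
do not vanish in the limit. -/
lemma tendsto_condErr_combine
    (h : ∀ φ : C(Msg × Msg, ℝ), Tendsto (fun k => condErr (lam k) (Y k) ν φ) l (𝓝 0))
    (hν : ∀ᵐ w ∂ν, 0 < w.1.2 ∧ 0 < w.2.2) (F : C(Msg, ℝ)) :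
    Tendsto (fun k => condErr (lam k) (Y k) ν fun w => F (combine w)) l (𝓝 0) := by
  have hsmall : Tendsto (fun m : ℕ => ∫ w, smallDenom (1 / ((m : ℝ) + 1)) w ∂ν) atTop (𝓝 0) := by
    have := tendsto_integral_of_dominated_convergence (μ := ν)
      (F := fun (m : ℕ) w => smallDenom (1 / ((m : ℝ) + 1)) w) (f := fun _ => (0 : ℝ)) (fun _ => 4)
      (fun m => (smallDenom _).continuous.aestronglyMeasurable) (integrable_const _)
      (fun m => ae_of_all _ fun w => by
        rw [Real.norm_eq_abs, abs_of_nonneg (smallDenom_nonneg _ _)]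
        exact smallDenom_le (by positivity) w) ?_
    · simpa using this
    · filter_upwards [hν] with w hw
      have h1 : (0 : ℝ) < (w.1.1 : ℝ) + w.2.2 := add_pos_of_nonneg_of_pos w.1.1.2.1 hw.2
      have h2 : (0 : ℝ) < (w.1.2 : ℝ) + w.2.1 := add_pos_of_pos_of_nonneg hw.1 w.2.1.2.1
      refine tendsto_const_nhds.congr' ?_
      have t1 := (tendsto_natCast_atTop_atTop (R := ℝ)).atTop_mul_const h1
      have t2 := (tendsto_natCast_atTop_atTop (R := ℝ)).atTop_mul_const h2
      filter_upwards [t1.eventually_ge_atTop 2, t2.eventually_ge_atTop 2] with m hm1 hm2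
      show 0 = max 0 (2 - ((w.1.1 : ℝ) + w.2.2) / (1 / ((m : ℝ) + 1)))
        + max 0 (2 - ((w.1.2 : ℝ) + w.2.1) / (1 / ((m : ℝ) + 1)))
      rw [max_eq_left, max_eq_left, add_zero]
      · rw [div_div_eq_mul_div, div_one]; nlinarith
      · rw [div_div_eq_mul_div, div_one]; nlinarith
  rw [Metric.tendsto_nhds]
  intro ε hε
  have hF := norm_nonneg F
  have hsm : ∀ᶠ m : ℕ in atTop, 2 * (2 * ‖F‖ * ∫ w, smallDenom (1 / ((m : ℝ) + 1)) w ∂ν)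
      < ε / 3 := by
    have := (hsmall.const_mul (2 * ‖F‖)).const_mul 2
    simp only [mul_zero] at this
    exact this.eventually_lt_const (by positivity)
  obtain ⟨m, hm⟩ := hsm.exists
  have hδ : (0 : ℝ) < 1 / ((m : ℝ) + 1) := by positivity
  have t1 := h (F.comp (combineCut hδ))
  have t2 := (h (smallDenom (1 / ((m : ℝ) + 1)))).const_mul (2 * ‖F‖)
  rw [mul_zero] at t2
  filter_upwards [t1.eventually_lt_const (show (0 : ℝ) < ε / 3 by positivity),
    t2.eventually_lt_const (show (0 : ℝ) < ε / 3 by positivity)] with k hk1 hk2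
  rw [Real.dist_0_eq_abs, abs_of_nonneg condErr_nonneg]
  have := condErr_le (lam := lam k) (Y := Y k) (ν := ν)
    ((bddMeas_of_continuous F).comp measurable_combine)
    (bddMeas_of_continuous (F.comp (combineCut hδ)))
    ((bddMeas_of_continuous (smallDenom (1 / ((m : ℝ) + 1)))).const_mul (2 * ‖F‖))
    (abs_combine_sub_le hδ F)
  rw [condErr_const_mul, integral_const_mul, abs_of_nonneg (by positivity)] at this
  linarith

end limits

/-! ### Convergence of the empirical law of the messages -/

/-- The two products of messages that enter `combine` at the variable `x`. -/
def pull {n : ℕ} (ω : Config n) (S : Finset (Fin n)) (x : Fin n) (m : Fin n → Msg) : Msg × Msg :=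
  (collect ω S x false m, collect ω S x true m)

lemma IsChar.collect_eq {χ : Msg → ℝ} (h : IsChar χ) {n : ℕ} (ω : Config n) (S : Finset (Fin n))
    (x : Fin n) (s : Bool) (m : Fin n → Msg) :
    χ (collect ω S x s m) = ∏ y ∈ S, ∏ t : Bool, χ (lit (m y) t) ^ mult ω (x, s) (y, t) := by
  let f : Msg →* ℝ := ⟨⟨χ, h.map_one⟩, h.map_mul⟩
  show f (collect ω S x s m) = ∏ y ∈ S, ∏ t : Bool, f (lit (m y) t) ^ mult ω (x, s) (y, t)
  simp only [collect, map_prod, map_pow]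

/-- The total defect from `1` of two multiplicative test functions at a message and at its flip. -/
def charSum (χ₁ χ₂ : Msg → ℝ) (u : Msg) : ℝ :=
  (χ₁ u - 1) + (χ₁ (flip u) - 1) + ((χ₂ u - 1) + (χ₂ (flip u) - 1))

/-- Given the messages `m`, the value of a multiplicative test function at the incoming products is
a product of powers whose exponents are the independent Poisson multiplicities of the clauses
between `x` and `S`. Every unordered clause has mean multiplicity `2 * lam`. -/
lemma integral_char_pull {χ₁ χ₂ : Msg → ℝ} (h₁ : IsChar χ₁) (h₂ : IsChar χ₂) {n : ℕ} (lam : ℝ≥0)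
    {S : Finset (Fin n)} {x : Fin n} (hx : x ∉ S) (m : Fin n → Msg) :
    ∫ ω, χ₁ (pull ω S x m).1 * χ₂ (pull ω S x m).2 ∂configLaw n lam
      = Real.exp (2 * lam * ∑ y ∈ S, charSum χ₁ χ₂ (m y)) := by
  let p : S × Bool × Bool × Bool → Literal n × Literal n := fun i =>
    if i.2.2.2 then ((x, i.2.2.1), (i.1.1, i.2.1)) else ((i.1.1, i.2.1), (x, i.2.2.1))
  let z : S × Bool × Bool × Bool → ℝ := fun i =>
    if i.2.2.1 then χ₂ (lit (m i.1.1) i.2.1) else χ₁ (lit (m i.1.1) i.2.1)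
  have hne : ∀ y : S, x ≠ y.1 := fun y h => hx (h ▸ y.2)
  have hp : Function.Injective p := by
    rintro ⟨y, t, s, o⟩ ⟨y', t', s', o'⟩ h
    cases o <;> cases o' <;> simp [p, hne, (hne _).symm] at h
    · obtain ⟨⟨h1, h2⟩, h3⟩ := h
      simp [h1, h2, h3]
    · obtain ⟨h3, h1, h2⟩ := h
      simp [h1, h2, h3]
  have key := integral_prod_pow_poisson lam p hp z
  have e1 : ∀ ω : Config n, χ₁ (pull ω S x m).1 * χ₂ (pull ω S x m).2
      = ∏ i, z i ^ ω (p i) := by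
    intro ω
    simp only [pull]
    rw [h₁.collect_eq, h₂.collect_eq, ← Finset.prod_mul_distrib, ← Finset.prod_coe_sort,
      Fintype.prod_prod_type]
    refine Finset.prod_congr rfl fun y _ => ?_
    simp only [Fintype.prod_prod_type, Fintype.prod_bool, z, p, mult, pow_add, if_true,
      Bool.false_eq_true, if_false]
    ring
  simp_rw [e1]
  rw [key]
  congr 1
  rw [mul_comm 2 (lam : ℝ), mul_assoc, Fintype.sum_prod_type, Finset.mul_sum (a := (2 : ℝ)),
    ← Finset.sum_coe_sort S]
  congr 1
  refine Finset.sum_congr rfl fun y _ => ?_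
  simp only [Fintype.sum_prod_type, Fintype.sum_bool, z, charSum, lit, if_true,
    Bool.false_eq_true, if_false]
  ring

lemma abs_exp_sub_exp_le {a b : ℝ} (ha : a ≤ 0) (hb : b ≤ 0) :
    |Real.exp a - Real.exp b| ≤ |a - b| := by
  wlog h : b ≤ a generalizing a b
  · rw [abs_sub_comm, abs_sub_comm a]; exact this hb ha (le_of_not_ge h)
  rw [abs_of_nonneg (sub_nonneg.2 (Real.exp_le_exp.2 h)), abs_of_nonneg (sub_nonneg.2 h)]
  have h1 := Real.add_one_le_exp (b - a)
  have h2 : Real.exp b = Real.exp a * Real.exp (b - a) := by rw [← Real.exp_add]; ring_nf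
  have h3 : Real.exp a ≤ 1 := Real.exp_le_one_iff.2 ha
  have h4 := Real.exp_pos a
  rw [h2]
  nlinarith

section main
variable {r : ℝ≥0} {u : Msg}

/-- The empirical law of the messages of depth `ℓ` converges to `msgLaw r u ℓ`, weakly in
probability, along every growing family of random formulas. -/
def Conv (r : ℝ≥0) (u : Msg) (ℓ : ℕ) : Prop :=
  ∀ (κ : Type) (l : Filter κ) (n : κ → ℕ) (lam : κ → ℝ≥0) (S : ∀ k, Finset (Fin (n k))),
    Grow r l n lam S → ∀ F : C(Msg, ℝ),
      Tendsto (fun k => ∫ ω, |(∑ x ∈ S k, F (msg u ω ℓ (S k) x)) / (S k).card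
        - ∫ v, F v ∂msgLaw r u ℓ| ∂configLaw (n k) (lam k)) l (𝓝 0)

variable {κ : Type} {l : Filter κ} {n : κ → ℕ} {lam : κ → ℝ≥0} {S : ∀ k, Finset (Fin (n k))}

lemma integral_charSum {Q : Measure Msg} [IsProbabilityMeasure Q] (hQ : Q.map flip = Q)
    {χ₁ χ₂ : Msg → ℝ} (h₁ : IsChar χ₁) (h₂ : IsChar χ₂) :
    ∫ v, charSum χ₁ χ₂ v ∂Q = 2 * ((∫ v, χ₁ v ∂Q - 1) + (∫ v, χ₂ v ∂Q - 1)) := by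
  have hf : ∀ {χ : Msg → ℝ}, IsChar χ → ∫ v, χ (flip v) ∂Q = ∫ v, χ v ∂Q := fun h => by
    conv_rhs => rw [← hQ, integral_map continuous_flip.measurable.aemeasurable
      h.cont.aestronglyMeasurable]
  have hi : ∀ {χ : Msg → ℝ}, IsChar χ → Integrable χ Q := fun {χ} h =>
    (bddMeas_of_continuous ⟨χ, h.cont⟩).integrable Q
  have hi' : ∀ {χ : Msg → ℝ}, IsChar χ → Integrable (fun v => χ (flip v)) Q := fun {χ} h =>
    (bddMeas_of_continuous ⟨fun v => χ (flip v), h.cont.comp continuous_flip⟩).integrable Q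
  have hj : ∀ {χ : Msg → ℝ}, IsChar χ → Integrable (fun v => χ v - 1) Q := fun {χ} h =>
    (hi h).sub (integrable_const _)
  have hj' : ∀ {χ : Msg → ℝ}, IsChar χ → Integrable (fun v => χ (flip v) - 1) Q := fun {χ} h =>
    (hi' h).sub (integrable_const _)
  have hk : ∀ {χ : Msg → ℝ}, IsChar χ →
      Integrable (fun v => (χ v - 1) + (χ (flip v) - 1)) Q := fun {χ} h => (hj h).add (hj' h)
  have hs : ∀ {χ : Msg → ℝ}, IsChar χ →
      ∫ v, ((χ v - 1) + (χ (flip v) - 1)) ∂Q = 2 * (∫ v, χ v ∂Q - 1) := fun {χ} h => by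
    rw [integral_add (hj h) (hj' h), integral_sub (hi h) (integrable_const _),
      integral_sub (hi' h) (integrable_const _), hf h]
    simp
    ring
  unfold charSum
  rw [integral_add (hk h₁) (hk h₂), hs h₁, hs h₂]
  ring

/-- Given the formula on `S`, the clauses between `x` and `S` bring a Poisson number of messages
sampled from the empirical law on `S`. -/
lemma tendsto_condErr_pull (hu : flip u = u) {ℓ : ℕ} (hconv : Conv r u ℓ)
    (hg : Grow r l n lam S) (x : ∀ k, Fin (n k)) (hx : ∀ k, x k ∉ S k) (φ : C(Msg × Msg, ℝ)) :
    Tendsto (fun k => condErr (lam k) (fun ω' ω => pull ω' (S k) (x k) (msg u ω ℓ (S k)))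
      ((compoundPoisson r (msgLaw r u ℓ)).prod (compoundPoisson r (msgLaw r u ℓ))) φ)
      l (𝓝 0) := by
  -- on multiplicative test functions both sides are exponentials of mean values of `charSum`
  refine tendsto_condErr_of_char (fun χ₁ χ₂ h₁ h₂ => ?_) φ
  set Q := msgLaw r u ℓ
  have hQ : Q.map flip = Q := msgLaw_map_flip r hu ℓ
  have hcs : Continuous (charSum χ₁ χ₂) := by
    have := h₁.cont
    have := h₂.cont
    have := continuous_flip
    unfold charSum
    fun_prop
  have hcs0 : ∀ v, charSum χ₁ χ₂ v ≤ 0 := fun v => by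
    unfold charSum
    linarith [h₁.le_one v, h₁.le_one (flip v), h₂.le_one v, h₂.le_one (flip v)]
  have hν : ∫ w, χ₁ w.1 * χ₂ w.2 ∂(compoundPoisson r Q).prod (compoundPoisson r Q)
      = Real.exp (r / 2 * ∫ v, charSum χ₁ χ₂ v ∂Q) := by
    rw [integral_prod_mul, integral_compoundPoisson h₁.cont.measurable h₁.nonneg h₁.le_one
      h₁.map_one h₁.map_mul, integral_compoundPoisson h₂.cont.measurable h₂.nonneg h₂.le_one
      h₂.map_one h₂.map_mul, ← Real.exp_add, integral_charSum hQ h₁ h₂]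
    ring_nf
  set q := ∫ v, charSum χ₁ χ₂ v ∂Q
  have hq : q ≤ 0 := integral_nonpos hcs0
  have h0 := hconv κ l n lam S hg ⟨charSum χ₁ χ₂, hcs⟩
  simp only [ContinuousMap.coe_mk] at h0
  have hlim : Tendsto (fun k => 2 * (S k).card * (lam k : ℝ) *
      (∫ ω, |(∑ x ∈ S k, charSum χ₁ χ₂ (msg u ω ℓ (S k) x)) / (S k).card - q|
        ∂configLaw (n k) (lam k)) + |2 * (S k).card * (lam k : ℝ) - r / 2| * |q|) l (𝓝 0) := by
    have t1 : Tendsto (fun k => 2 * (S k).card * (lam k : ℝ)) l (𝓝 (r / 2)) := by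
      refine (hg.2.div_const 2).congr fun k => ?_
      ring
    have t2 := (t1.mul h0).add (((t1.sub_const ((r : ℝ) / 2)).abs).mul_const |q|)
    simpa using t2
  refine squeeze_zero (fun _ => condErr_nonneg) (fun k => ?_) hlim
  have hlam : (0 : ℝ) ≤ lam k := NNReal.coe_nonneg _
  have hr : (0 : ℝ) ≤ r := NNReal.coe_nonneg _
  have hbd : BddMeas fun ω : Config (n k) =>
      (∑ x ∈ S k, charSum χ₁ χ₂ (msg u ω ℓ (S k) x)) / (S k).card - q := by
    refine ⟨measurable_of_countable _, (∑ _x ∈ S k, ‖(⟨charSum χ₁ χ₂, hcs⟩ : C(Msg, ℝ))‖)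
      / (S k).card + |q|, fun ω => (abs_sub _ _).trans ?_⟩
    rw [abs_div, Nat.abs_cast]
    gcongr
    refine (Finset.abs_sum_le_sum_abs _ _).trans (Finset.sum_le_sum fun x _ => ?_)
    exact (⟨charSum χ₁ χ₂, hcs⟩ : C(Msg, ℝ)).norm_coe_le_norm _
  unfold condErr
  rw [hν]
  simp_rw [integral_char_pull h₁ h₂ (lam k) (hx k)]
  have hint := (hbd.integrable (configLaw (n k) (lam k))).abs
  have hint' : Integrable (fun ω : Config (n k) => 2 * (S k).card * (lam k : ℝ) *
      |(∑ x ∈ S k, charSum χ₁ χ₂ (msg u ω ℓ (S k) x)) / (S k).card - q|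
        + |2 * (S k).card * (lam k : ℝ) - r / 2| * |q|) (configLaw (n k) (lam k)) :=
    (hint.const_mul _).add (integrable_const _)
  have hle : ∀ ω : Config (n k),
      |Real.exp (2 * lam k * ∑ y ∈ S k, charSum χ₁ χ₂ (msg u ω ℓ (S k) y)) - Real.exp (r / 2 * q)|
      ≤ 2 * (S k).card * (lam k : ℝ) *
      |(∑ x ∈ S k, charSum χ₁ χ₂ (msg u ω ℓ (S k) x)) / (S k).card - q|
        + |2 * (S k).card * (lam k : ℝ) - r / 2| * |q| := by
    intro ω
    have hs0 : ∑ y ∈ S k, charSum χ₁ χ₂ (msg u ω ℓ (S k) y) ≤ 0 :=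
      Finset.sum_nonpos fun y _ => hcs0 _
    refine (abs_exp_sub_exp_le (mul_nonpos_of_nonneg_of_nonpos (by positivity) hs0)
      (mul_nonpos_of_nonneg_of_nonpos (by positivity) hq)).trans ?_
    set X := ∑ y ∈ S k, charSum χ₁ χ₂ (msg u ω ℓ (S k) y) with hX
    have hXc : X = (S k).card * (X / (S k).card) := by
      rcases Nat.eq_zero_or_pos (S k).card with h | h
      · have : X = 0 := by rw [hX, Finset.card_eq_zero.1 h, Finset.sum_empty]
        rw [this]; simp
      · field_simp
    calc |2 * (lam k : ℝ) * X - r / 2 * q|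
        = |2 * (S k).card * (lam k : ℝ) * (X / (S k).card - q)
            + (2 * (S k).card * (lam k : ℝ) - r / 2) * q| := by
          congr 1
          conv_lhs => rw [hXc]
          ring
      _ ≤ _ := by
          refine (abs_add_le _ _).trans (le_of_eq ?_)
          rw [abs_mul, abs_mul (_ - _) q,
            abs_of_nonneg (mul_nonneg (mul_nonneg zero_le_two (Nat.cast_nonneg _)) hlam)]
  refine (integral_mono_of_nonneg (ae_of_all _ fun _ => abs_nonneg _) hint'
    (ae_of_all _ hle)).trans (le_of_eq ?_)
  rw [integral_add (hint.const_mul _) (integrable_const _), integral_const_mul]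
  simp

/-- Messages at two distinct variables are asymptotically independent. -/
lemma tendsto_pair (hu : flip u = u) (hub : IsBound u) {ℓ : ℕ} (hconv : Conv r u ℓ)
    (hg : Grow r l n lam S) (x x' : ∀ k, Fin (n k)) (hx' : ∀ k, x' k ∈ S k)
    (hne : ∀ k, x k ≠ x' k) (G : C(Msg, ℝ))
    (hG : ∫ v, G v ∂msgLaw r u (ℓ + 1) = 0) :
    Tendsto (fun k => ∫ ω, G (msg u ω (ℓ + 1) (S k) (x k)) * G (msg u ω (ℓ + 1) (S k) (x' k))
      ∂configLaw (n k) (lam k)) l (𝓝 0) := by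
  set S' : ∀ k, Finset (Fin (n k)) := fun k => ((S k).erase (x' k)).erase (x k) with hS'
  have hg' : Grow r l n lam S' := (hg.erase x').erase x
  set Q := msgLaw r u ℓ with hQ
  set ν := (compoundPoisson r Q).prod (compoundPoisson r Q) with hνdef
  have hν : ∀ᵐ w ∂ν, 0 < w.1.2 ∧ 0 < w.2.2 := by
    have h := ae_isBound_compoundPoisson (r := r) (ae_isBound_msgLaw (r := r) hub ℓ)
    filter_upwards [ae_prod h h] with w hw using ⟨hw.1.2, hw.2.2⟩
  have hGν : ∫ w, G (combine w) ∂ν = 0 := by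
    rw [← hG]
    exact (integral_map measurable_combine.aemeasurable
      G.continuous.aestronglyMeasurable).symm
  have t1 := tendsto_condErr_combine (tendsto_condErr_pull hu hconv hg' x
    fun k => Finset.notMem_erase _ _) hν G
  have t2 := hg.tendsto_pathBound (ℓ + 2)
  have hlim := (t1.const_mul ‖G‖).add (t2.const_mul (4 * ‖G‖ ^ 2))
  simp only [mul_zero, add_zero] at hlim
  refine squeeze_zero_norm (fun k => ?_) hlim
  rw [Real.norm_eq_abs]
  have hGn : ∀ v, |G v| ≤ ‖G‖ := fun v => G.norm_coe_le_norm v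
  have hGG : ∀ v w, |G v * G w| ≤ ‖G‖ ^ 2 := fun v w => by
    rw [abs_mul, sq]; exact mul_le_mul (hGn v) (hGn w) (abs_nonneg _) (norm_nonneg _)
  set P := configLaw (n k) (lam k)
  set f : Config (n k) → ℝ := fun ω =>
    G (msg u ω (ℓ + 1) (S k) (x k)) * G (msg u ω (ℓ + 1) (S k) (x' k)) with hf
  set g : Config (n k) → ℝ := fun ω => G (msg u ω (ℓ + 1) ((S k).erase (x' k)) (x k)) *
    G (msg u ω (ℓ + 1) ((S k).erase (x k)) (x' k)) with hg_def
  have hfi : Integrable f P := Integrable.of_bound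
    (measurable_of_countable _).aestronglyMeasurable _ (ae_of_all _ fun ω => hGG _ _)
  have hgi : Integrable g P := Integrable.of_bound
    (measurable_of_countable _).aestronglyMeasurable _ (ae_of_all _ fun ω => hGG _ _)
  set E : Set (Config (n k)) := {ω | InBall ω (ℓ + 2) (S k) (x k) (x' k)} ∪
    {ω | InBall ω (ℓ + 2) (S k) (x' k) (x k)} with hE
  have hPE : P.real E ≤ 2 * pathBound (lam k) (S k).card (ℓ + 2) := by
    refine (measureReal_union_le _ _).trans ?_
    have := measureReal_inBall (lam := lam k) (ℓ + 2) (le_refl (S k).card) (hne k)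
    have := measureReal_inBall (lam := lam k) (ℓ + 2) (le_refl (S k).card) (hne k).symm
    linarith
  -- the removal of one of the two variables changes the other message with small probability only
  have hfg : |∫ ω, f ω ∂P - ∫ ω, g ω ∂P| ≤ 2 * ‖G‖ ^ 2 * P.real E := by
    rw [← integral_sub hfi hgi]
    have h1 : ∀ ω, |f ω - g ω| ≤ E.indicator (fun _ => 2 * ‖G‖ ^ 2) ω := by
      intro ω
      by_cases hω : ω ∈ E
      · rw [Set.indicator_of_mem hω]
        have := (abs_sub (f ω) (g ω)).trans (add_le_add (hGG _ _) (hGG _ _))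
        linarith
      · rw [Set.indicator_of_notMem hω]
        have h1 : ¬ InBall ω (ℓ + 1 + 1) (S k) (x k) (x' k) := fun h => hω (Or.inl h)
        have h2 : ¬ InBall ω (ℓ + 1 + 1) (S k) (x' k) (x k) := fun h => hω (Or.inr h)
        simp only [hf, hg_def]
        rw [msg_erase u (ℓ + 1) h1, msg_erase u (ℓ + 1) h2, sub_self, abs_zero]
    refine abs_integral_le_integral_abs.trans ((integral_mono (hfi.sub hgi).abs
      ((integrable_const _).indicator (measurableSet_config E)) h1).trans (le_of_eq ?_))
    rw [integral_indicator_const _ (measurableSet_config E), smul_eq_mul, mul_comm]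
  -- the clauses at `x` are resampled
  set H : Config (n k) → Config (n k) → ℝ := fun ω₁ ω₂ =>
    G (combine (pull ω₁ (S' k) (x k) (msg u ω₂ ℓ (S' k)))) *
      G (msg u ω₂ (ℓ + 1) ((S k).erase (x k)) (x' k)) with hH
  have hres : ∫ ω, g ω ∂P = ∫ ω, ∫ ω', H ω' ω ∂P ∂P := by
    refine integral_resample (fun _ => poissonMeasure (lam k)) (star (x k)) H ?_ (‖G‖ ^ 2)
      (fun _ _ => hGG _ _)
    intro ω₁ ω₂ ω₁' ω₂' h1 h2
    have hc : ∀ s, collect ω₁ (S' k) (x k) s (msg u ω₂ ℓ (S' k))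
        = collect ω₁' (S' k) (x k) s (msg u ω₂' ℓ (S' k)) := by
      intro s
      refine Finset.prod_congr rfl fun y hy => Finset.prod_congr rfl fun t _ => ?_
      rw [mult_eq_of_star h1, msg_congr u ℓ (agreeOn_of_off_star (S := S' k)
        (Finset.notMem_erase _ _) h2) hy]
    simp only [hH, pull]
    rw [hc, hc, msg_congr u (ℓ + 1) (agreeOn_of_off_star (S := (S k).erase (x k))
      (Finset.notMem_erase _ _) h2) (Finset.mem_erase.2 ⟨(hne k).symm, hx' k⟩)]
  have hgb : |∫ ω, g ω ∂P| ≤ ‖G‖ * condErr (lam k) (fun ω' ω => pull ω' (S' k) (x k)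
      (msg u ω ℓ (S' k))) ν fun w => G (combine w) := by
    rw [hres, condErr, hGν, ← integral_const_mul]
    refine abs_integral_le_integral_abs.trans (integral_mono_of_nonneg
      (ae_of_all _ fun _ => abs_nonneg _) ?_ (ae_of_all _ fun ω => ?_))
    · refine Integrable.const_mul ?_ _
      simp only [sub_zero]
      exact Integrable.of_bound (measurable_of_countable _).aestronglyMeasurable ‖G‖
        (ae_of_all _ fun ω => by
          rw [Real.norm_eq_abs, abs_abs]; exact abs_integral_le_of_bound fun _ => hGn _)
    · simp only [hH, sub_zero]
      rw [integral_mul_const, abs_mul, mul_comm]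
      exact mul_le_mul_of_nonneg_right (hGn _) (abs_nonneg _)
  have h1 : |∫ ω, f ω ∂P| ≤ |∫ ω, f ω ∂P - ∫ ω, g ω ∂P| + |∫ ω, g ω ∂P| := by
    have := abs_add_le (∫ ω, f ω ∂P - ∫ ω, g ω ∂P) (∫ ω, g ω ∂P)
    simpa using this
  have h2 : 2 * ‖G‖ ^ 2 * P.real E ≤ 2 * ‖G‖ ^ 2 * (2 * pathBound (lam k) (S k).card (ℓ + 2)) :=
    mul_le_mul_of_nonneg_left hPE (by positivity)
  linarith

lemma integral_abs_le_sqrt {X : Type*} [MeasurableSpace X] {μ : Measure X}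
    [IsProbabilityMeasure μ] {f : X → ℝ} (hf : BddMeas f) :
    ∫ x, |f x| ∂μ ≤ √(∫ x, f x ^ 2 ∂μ) := by
  obtain ⟨h1, C, h2⟩ := hf
  have hi : Integrable (fun x => |f x|) μ := (BddMeas.integrable ⟨h1, C, h2⟩ μ).abs
  have hi2 : Integrable (fun x => f x ^ 2) μ := Integrable.of_bound
    (h1.pow_const 2).aestronglyMeasurable (C ^ 2) (ae_of_all _ fun x => by
      rw [Real.norm_eq_abs, abs_pow]; exact pow_le_pow_left₀ (abs_nonneg _) (h2 x) 2)
  refine Real.le_sqrt_of_sq_le ?_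
  set m := ∫ x, |f x| ∂μ
  have h3 : 0 ≤ ∫ x, (f x ^ 2 - (2 * m * |f x| - m ^ 2)) ∂μ := by
    refine integral_nonneg fun x => ?_
    show 0 ≤ f x ^ 2 - (2 * m * |f x| - m ^ 2)
    rw [← sq_abs (f x)]
    nlinarith [sq_nonneg (|f x| - m)]
  have hi3 : Integrable (fun x => 2 * m * |f x| - m ^ 2) μ :=
    (hi.const_mul _).sub (integrable_const _)
  rw [integral_sub hi2 hi3, integral_sub (hi.const_mul _) (integrable_const _),
    integral_const_mul] at h3
  simp only [integral_const, probReal_univ, smul_eq_mul, one_mul] at h3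
  change 0 ≤ _ - (2 * m * m - m ^ 2) at h3
  nlinarith

/-- The second moment of a centred empirical average is an average of pair correlations, which
vanish off the diagonal, while the diagonal has weight `1 / |S|`. -/
lemma conv_succ (hu : flip u = u) (hub : IsBound u) {ℓ : ℕ} (hconv : Conv r u ℓ) :
    Conv r u (ℓ + 1) := by
  intro κ l n lam S hg F
  set q := ∫ v, F v ∂msgLaw r u (ℓ + 1) with hq
  set G : C(Msg, ℝ) := F - ContinuousMap.const Msg q with hGdef
  have hGv : ∀ v, G v = F v - q := fun v => rfl
  have hG : ∫ v, G v ∂msgLaw r u (ℓ + 1) = 0 := by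
    simp_rw [hGv]
    rw [integral_sub ((bddMeas_of_continuous F).integrable _) (integrable_const _)]
    simp [hq]
  have hGn : ∀ v, |G v| ≤ ‖G‖ := fun v => G.norm_coe_le_norm v
  -- uniformity over pairs of variables: the pair is made part of the index
  let κ' : Type := Σ k, {p : Fin (n k) × Fin (n k) // p.1 ∈ S k ∧ p.2 ∈ S k ∧ p.1 ≠ p.2}
  have hg' : Grow r (comap (Sigma.fst : κ' → κ) l) (fun k => n k.1) (fun k => lam k.1)
      (fun k => S k.1) := ⟨hg.1.comp tendsto_comap, hg.2.comp tendsto_comap⟩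
  have hpair := tendsto_pair hu hub hconv hg' (fun k => k.2.1.1) (fun k => k.2.1.2)
    (fun k => k.2.2.2.1) (fun k => k.2.2.2.2) G hG
  have hsq : Tendsto (fun k => ∫ ω, ((∑ x ∈ S k, G (msg u ω (ℓ + 1) (S k) x)) / (S k).card) ^ 2
      ∂configLaw (n k) (lam k)) l (𝓝 0) := by
    rw [Metric.tendsto_nhds]
    intro ε hε
    have h1 := Metric.tendsto_nhds.1 hpair (ε / 2) (by positivity)
    rw [eventually_comap] at h1
    have h2 : Tendsto (fun k => ‖G‖ ^ 2 / ((S k).card : ℝ)) l (𝓝 0) := hg.1.const_div_atTop _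
    filter_upwards [h1, h2.eventually_lt_const (show (0 : ℝ) < ε / 2 by positivity),
      hg.1.eventually_gt_atTop 0] with k hk1 hk2 hk3
    have hi : ∀ x x', Integrable (fun ω => G (msg u ω (ℓ + 1) (S k) x) *
        G (msg u ω (ℓ + 1) (S k) x')) (configLaw (n k) (lam k)) := fun x x' =>
      Integrable.of_bound (measurable_of_countable _).aestronglyMeasurable (‖G‖ * ‖G‖)
        (ae_of_all _ fun ω => by
          rw [Real.norm_eq_abs, abs_mul]
          exact mul_le_mul (hGn _) (hGn _) (abs_nonneg _) (norm_nonneg _))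
    have e1 : ∫ ω, ((∑ x ∈ S k, G (msg u ω (ℓ + 1) (S k) x)) / (S k).card) ^ 2
        ∂configLaw (n k) (lam k) = (∑ x ∈ S k, ∑ x' ∈ S k, ∫ ω, G (msg u ω (ℓ + 1) (S k) x) *
        G (msg u ω (ℓ + 1) (S k) x') ∂configLaw (n k) (lam k)) / ((S k).card : ℝ) ^ 2 := by
      simp_rw [div_pow, sq (∑ x ∈ S k, _), Finset.sum_mul_sum]
      rw [integral_div, integral_finsetSum _ fun x _ => integrable_finsetSum _ fun x' _ => hi x x']
      congr 1
      refine Finset.sum_congr rfl fun x _ => ?_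
      rw [integral_finsetSum _ fun x' _ => hi x x']
    have e2 : ∑ x ∈ S k, ∑ x' ∈ S k, ∫ ω, G (msg u ω (ℓ + 1) (S k) x) *
        G (msg u ω (ℓ + 1) (S k) x') ∂configLaw (n k) (lam k)
        ≤ ∑ x ∈ S k, ∑ x' ∈ S k, (ε / 2 + if x = x' then ‖G‖ ^ 2 else 0) := by
      refine Finset.sum_le_sum fun x hx => Finset.sum_le_sum fun x' hx' => ?_
      by_cases hxx : x = x'
      · subst hxx
        rw [if_pos rfl]
        have := (le_abs_self _).trans (abs_integral_le_of_bound (μ := configLaw (n k) (lam k))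
          (f := fun ω => G (msg u ω (ℓ + 1) (S k) x) * G (msg u ω (ℓ + 1) (S k) x))
          (C := ‖G‖ ^ 2) fun ω => by
            rw [abs_mul, sq]
            exact mul_le_mul (hGn _) (hGn _) (abs_nonneg _) (norm_nonneg _))
        linarith
      · rw [if_neg hxx, add_zero]
        have := hk1 ⟨k, ⟨(x, x'), hx, hx', hxx⟩⟩ rfl
        rw [Real.dist_0_eq_abs] at this
        exact (le_abs_self _).trans this.le
    have e3 : ∑ x ∈ S k, ∑ x' ∈ S k, (ε / 2 + if x = x' then ‖G‖ ^ 2 else 0)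
        = ((S k).card : ℝ) ^ 2 * (ε / 2) + (S k).card * ‖G‖ ^ 2 := by
      simp only [Finset.sum_add_distrib, Finset.sum_const, nsmul_eq_mul, Finset.sum_ite_eq]
      rw [Finset.sum_congr rfl fun x hx => if_pos hx, Finset.sum_const, nsmul_eq_mul]
      ring
    rw [Real.dist_0_eq_abs, abs_of_nonneg (integral_nonneg fun ω => sq_nonneg _), e1]
    calc _ ≤ (((S k).card : ℝ) ^ 2 * (ε / 2) + (S k).card * ‖G‖ ^ 2) / ((S k).card : ℝ) ^ 2 := by
          rw [← e3]; gcongr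
      _ = ε / 2 + ‖G‖ ^ 2 / (S k).card := by field_simp
      _ < ε := by linarith
  have hsqrt := (Real.continuous_sqrt.tendsto 0).comp hsq
  rw [Real.sqrt_zero] at hsqrt
  refine squeeze_zero' (Eventually.of_forall fun k => integral_nonneg fun ω => abs_nonneg _)
    ?_ hsqrt
  filter_upwards [hg.1.eventually_gt_atTop 0] with k hk
  have e : ∀ ω : Config (n k), (∑ x ∈ S k, F (msg u ω (ℓ + 1) (S k) x)) / (S k).card - q
      = (∑ x ∈ S k, G (msg u ω (ℓ + 1) (S k) x)) / (S k).card := by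
    intro ω
    simp only [hGv, Finset.sum_sub_distrib, Finset.sum_const, nsmul_eq_mul]
    field_simp
  simp_rw [e]
  refine integral_abs_le_sqrt ⟨measurable_of_countable _, ‖G‖, fun ω => ?_⟩
  rw [abs_div, Nat.abs_cast, div_le_iff₀ hk]
  refine (Finset.abs_sum_le_sum_abs _ _).trans ((Finset.sum_le_sum fun x _ => hGn _).trans ?_)
  rw [Finset.sum_const, nsmul_eq_mul, mul_comm]

/-- The empirical law of the messages converges to the law on the Galton-Watson tree. -/
lemma conv (hu : flip u = u) (hub : IsBound u) (ℓ : ℕ) : Conv r u ℓ := by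
  induction ℓ with
  | zero =>
    intro κ l n lam S hg F
    refine tendsto_const_nhds.congr' ?_
    filter_upwards [hg.1.eventually_gt_atTop 0] with k hk
    simp [msg, msgLaw, integral_dirac' _ _ F.continuous.stronglyMeasurable, hk.ne']
  | succ ℓ ih => exact conv_succ hu hub ih

end main

/-! ### The Belief Propagation operator on the open interval -/

/-- Probability measures on pairs of messages are determined by the multiplicative test
functions. -/
lemma measure_ext_of_char {μ ν : Measure (Msg × Msg)} [IsProbabilityMeasure μ]
    [IsProbabilityMeasure ν] (h : ∀ χ₁ χ₂, IsChar χ₁ → IsChar χ₂ →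
      ∫ w, χ₁ w.1 * χ₂ w.2 ∂μ = ∫ w, χ₁ w.1 * χ₂ w.2 ∂ν) : μ = ν := by
  have hi : ∀ (φ : C(Msg × Msg, ℝ)) (m : Measure (Msg × Msg)) [IsProbabilityMeasure m],
      Integrable φ m := fun φ m _ => (bddMeas_of_continuous φ).integrable m
  have hspan : ∀ ψ ∈ Algebra.adjoin ℝ (charSubmonoid : Set C(Msg × Msg, ℝ)),
      ∫ w, ψ w ∂μ = ∫ w, ψ w ∂ν := by
    intro ψ hψ
    rw [← Subalgebra.mem_toSubmodule, Algebra.adjoin_eq_span, Submonoid.closure_eq] at hψ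
    induction hψ using Submodule.span_induction with
    | mem ψ hψ =>
      obtain ⟨χ₁, χ₂, h1, h2, h'⟩ := hψ
      simp_rw [h']
      exact h _ _ h1 h2
    | zero => simp
    | add φ ψ _ _ h1 h2 =>
      simp only [ContinuousMap.add_apply]
      rw [integral_add (hi φ μ) (hi ψ μ), integral_add (hi φ ν) (hi ψ ν), h1, h2]
    | smul c φ _ h1 =>
      simp only [ContinuousMap.smul_apply, smul_eq_mul, integral_const_mul, h1]
  refine ext_of_forall_integral_eq_of_IsFiniteMeasure fun f => ?_
  set φ : C(Msg × Msg, ℝ) := f.toContinuousMap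
  show ∫ w, φ w ∂μ = ∫ w, φ w ∂ν
  have hφ' : φ ∈ closure (Algebra.adjoin ℝ (charSubmonoid : Set C(Msg × Msg, ℝ)) :
      Set C(Msg × Msg, ℝ)) := by
    rw [← Subalgebra.topologicalClosure_coe, adjoin_char_dense]; trivial
  refine eq_of_abs_sub_le_all fun ε hε => ?_
  obtain ⟨ψ, hψ, hd⟩ := Metric.mem_closure_iff.1 hφ' (ε / 2) (by positivity)
  have hb : ∀ (m : Measure (Msg × Msg)) [IsProbabilityMeasure m],
      |∫ w, φ w ∂m - ∫ w, ψ w ∂m| ≤ ε / 2 := fun m _ => by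
    rw [← integral_sub (hi φ m) (hi ψ m)]
    exact abs_integral_le_of_bound fun w =>
      (ContinuousMap.dist_apply_le_dist (f := φ) (g := ψ) w).trans hd.le
  have h1 := hb μ
  have h2 := hb ν
  rw [hspan ψ hψ] at h1
  rw [abs_le] at h1 h2 ⊢
  constructor <;> linarith [h1.1, h1.2, h2.1, h2.2]

lemma integral_prod_infinitePi {X : Type*} [MeasurableSpace X] (π : Measure X)
    [IsProbabilityMeasure π] (s : Finset ℕ) (g : ℕ → X → ℝ) (hg : ∀ i, BddMeas (g i)) :
    ∫ μ, ∏ i ∈ s, g i (μ i) ∂Measure.infinitePi (fun _ : ℕ => π) = ∏ i ∈ s, ∫ x, g i x ∂π := by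
  have h := integral_restrict_infinitePi (μ := fun _ : ℕ => π) (s := s)
    (f := fun y : s → X => ∏ i : s, g i.1 (y i)) ?_
  · rw [integral_fintype_prod_eq_prod (f := fun (i : s) x => g i x)] at h
    rw [← Finset.prod_coe_sort s (fun i => ∫ x, g i x ∂π), ← h]
    refine integral_congr_ae (ae_of_all _ fun μ => ?_)
    exact (Finset.prod_coe_sort s (fun i => g i (μ i))).symm
  · exact (Finset.measurable_prod Finset.univ fun (i : s) _ =>
      (hg i.1).1.comp (measurable_pi_apply i)).aestronglyMeasurable

/-- A message whose two bounds coincide. -/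
def sharp (z : OpenUnit) : Msg := (toUnitInterval z, toUnitInterval z)

lemma continuous_toUnitInterval : Continuous toUnitInterval := by
  unfold toUnitInterval; fun_prop

lemma continuous_sharp : Continuous sharp :=
  continuous_toUnitInterval.prodMk continuous_toUnitInterval

/-- The two products that enter `bpMap`, as messages. -/
def bpProducts (x : (ℕ × ℕ) × (ℕ → OpenUnit)) : Msg × Msg :=
  (∏ i ∈ Finset.range x.1.2, sharp (x.2 i), ∏ i ∈ Finset.range x.1.1, sharp (x.2 (i + x.1.2)))

lemma measurable_bpProducts : Measurable bpProducts := by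
  refine measurable_from_prod_countable_right fun p => ?_
  have hs := continuous_sharp.measurable
  exact (Finset.measurable_prod (Finset.range p.2) fun i _ =>
    hs.comp (measurable_pi_apply i)).prodMk (Finset.measurable_prod (Finset.range p.1) fun i _ =>
      hs.comp (measurable_pi_apply (i + p.2)))

lemma sharp_bpMap (x : (ℕ × ℕ) × (ℕ → OpenUnit)) : sharp (bpMap x) = combine (bpProducts x) := by
  have hc : ∀ (s : Finset ℕ) (f : ℕ → OpenUnit),
      ((∏ i ∈ s, toUnitInterval (f i) : unitInterval) : ℝ) = ∏ i ∈ s, (f i : ℝ) := by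
    intro s f
    induction s using Finset.induction_on with
    | empty => simp
    | insert a s ha ih => rw [Finset.prod_insert ha, Finset.prod_insert ha, ← ih]; rfl
  have h1 : ∀ (s : Finset ℕ) (f : ℕ → OpenUnit),
      (∏ i ∈ s, sharp (f i)) = (∏ i ∈ s, toUnitInterval (f i), ∏ i ∈ s, toUnitInterval (f i)) :=
    fun s f => Prod.ext (by rw [Prod.fst_prod]; rfl) (by rw [Prod.snd_prod]; rfl)
  have hA : 0 < ∏ i ∈ Finset.range x.1.2, (x.2 i : ℝ) := Finset.prod_pos fun i _ => (x.2 i).2.1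
  have hB : 0 < ∏ i ∈ Finset.range x.1.1, (x.2 (i + x.1.2) : ℝ) :=
    Finset.prod_pos fun i _ => (x.2 (i + x.1.2)).2.1
  have e : toUnitInterval (bpMap x) = frac (∏ i ∈ Finset.range x.1.2, toUnitInterval (x.2 i))
      (∏ i ∈ Finset.range x.1.1, toUnitInterval (x.2 (i + x.1.2))) := by
    refine Subtype.ext ?_
    have e1 := hc (Finset.range x.1.2) x.2
    have e2 := hc (Finset.range x.1.1) fun i => x.2 (i + x.1.2)
    rw [frac_eq (by rw [e1, e2]; linarith), e1, e2]
    rfl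
  rw [bpProducts, h1, h1, combine, sharp, e]

/-- The two products in `bpMap` are independent compound Poisson variables, as is seen from
multiplicative test functions. -/
lemma bpInput_map_bpProducts (d : ℝ) (π : ProbabilityMeasure OpenUnit) :
    (bpInput d π).map bpProducts
      = (compoundPoisson (d / 2).toNNReal ((π : Measure OpenUnit).map sharp)).prod
          (compoundPoisson (d / 2).toNNReal ((π : Measure OpenUnit).map sharp)) := by
  have hs := continuous_sharp.measurable
  have : IsProbabilityMeasure ((π : Measure OpenUnit).map sharp) :=
    Measure.isProbabilityMeasure_map hs.aemeasurable
  have : IsProbabilityMeasure ((bpInput d π).map bpProducts) :=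
    Measure.isProbabilityMeasure_map measurable_bpProducts.aemeasurable
  refine measure_ext_of_char fun χ₁ χ₂ h₁ h₂ => ?_
  have hb : ∀ {χ : Msg → ℝ}, IsChar χ → BddMeas χ := fun {χ} h =>
    bddMeas_of_continuous ⟨χ, h.cont⟩
  have hprod : ∀ {χ : Msg → ℝ}, IsChar χ → ∀ (s : Finset ℕ) (f : ℕ → Msg),
      χ (∏ i ∈ s, f i) = ∏ i ∈ s, χ (f i) := by
    intro χ h s f
    let g : Msg →* ℝ := ⟨⟨χ, h.map_one⟩, h.map_mul⟩
    exact map_prod g f s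
  have hbw : BddMeas fun w : Msg × Msg => χ₁ w.1 * χ₂ w.2 :=
    bddMeas_of_continuous (⟨fun w => χ₁ w.1 * χ₂ w.2, (h₁.cont.comp continuous_fst).mul
      (h₂.cont.comp continuous_snd)⟩ : C(Msg × Msg, ℝ))
  have hm : ∀ {χ : Msg → ℝ}, IsChar χ →
      ∫ u, χ u ∂((π : Measure OpenUnit).map sharp) = ∫ z, χ (sharp z) ∂(π : Measure OpenUnit) :=
    fun h => integral_map hs.aemeasurable h.cont.aestronglyMeasurable
  rw [integral_prod_mul, integral_compoundPoisson h₁.cont.measurable h₁.nonneg h₁.le_one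
      h₁.map_one h₁.map_mul, integral_compoundPoisson h₂.cont.measurable h₂.nonneg h₂.le_one
      h₂.map_one h₂.map_mul, integral_map measurable_bpProducts.aemeasurable
      hbw.1.aestronglyMeasurable, hm h₁, hm h₂]
  have hint : Integrable (fun x => χ₁ (bpProducts x).1 * χ₂ (bpProducts x).2) (bpInput d π) :=
    (hbw.comp measurable_bpProducts).integrable _
  set c₁ := ∫ z, χ₁ (sharp z) ∂(π : Measure OpenUnit)
  set c₂ := ∫ z, χ₂ (sharp z) ∂(π : Measure OpenUnit)
  have hinner : ∀ p : ℕ × ℕ, ∫ y, χ₁ (bpProducts (p, y)).1 * χ₂ (bpProducts (p, y)).2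
      ∂Measure.infinitePi (fun _ : ℕ => (π : Measure OpenUnit)) = c₂ ^ p.1 * c₁ ^ p.2 := by
    intro p
    have h := integral_prod_infinitePi (π : Measure OpenUnit) (Finset.range (p.2 + p.1))
      (fun i z => if i < p.2 then χ₁ (sharp z) else χ₂ (sharp z)) (fun i => by
        by_cases hi : i < p.2
        · simpa [hi] using (hb h₁).comp hs
        · simpa [hi] using (hb h₂).comp hs)
    simp_rw [Finset.prod_range_add] at h
    have e1 : ∀ y : ℕ → OpenUnit, χ₁ (bpProducts (p, y)).1 * χ₂ (bpProducts (p, y)).2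
        = (∏ i ∈ Finset.range p.2, if i < p.2 then χ₁ (sharp (y i)) else χ₂ (sharp (y i))) *
          ∏ i ∈ Finset.range p.1, if p.2 + i < p.2 then χ₁ (sharp (y (p.2 + i)))
            else χ₂ (sharp (y (p.2 + i))) := by
      intro y
      simp only [bpProducts]
      rw [hprod h₁, hprod h₂]
      congr 1
      · exact Finset.prod_congr rfl fun i hi => by rw [if_pos (Finset.mem_range.1 hi)]
      · exact Finset.prod_congr rfl fun i _ => by rw [if_neg (by omega), add_comm]
    simp_rw [e1]
    rw [h, mul_comm]
    congr 1
    · rw [Finset.prod_congr rfl (g := fun _ => c₂) fun i _ => by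
        simp only [show ¬ p.2 + i < p.2 by omega, if_false]; rfl, Finset.prod_const,
        Finset.card_range]
    · rw [Finset.prod_congr rfl (g := fun _ => c₁) fun i hi => by
        simp only [Finset.mem_range.1 hi, if_true]; rfl, Finset.prod_const, Finset.card_range]
  unfold bpInput at hint ⊢
  rw [integral_prod _ hint]
  simp_rw [hinner]
  rw [integral_prod_mul (f := fun k : ℕ => c₂ ^ k) (g := fun k : ℕ => c₁ ^ k),
    poisson_integral_pow, poisson_integral_pow, mul_comm]

/-- On messages with coinciding bounds, `msgStep` is the operator `BP`. -/
lemma msgStep_map_sharp (d : ℝ) (π : ProbabilityMeasure OpenUnit) :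
    msgStep (d / 2).toNNReal ((π : Measure OpenUnit).map sharp)
      = ((BP d π : ProbabilityMeasure OpenUnit) : Measure OpenUnit).map sharp := by
  show _ = ((bpInput d π).map bpMap).map sharp
  rw [msgStep, ← bpInput_map_bpProducts, Measure.map_map measurable_combine measurable_bpProducts,
    Measure.map_map continuous_sharp.measurable measurable_bpMap]
  congr 1
  ext1 x
  exact (sharp_bpMap x).symm

/-- The message whose two bounds are `1 / 2`. -/
def halfMsg : Msg := sharp ⟨1 / 2, by norm_num, by norm_num⟩

/-- The iterates of the Belief Propagation operator are the message laws started from the message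
`1 / 2`. -/
lemma msgLaw_halfMsg (d : ℝ) (ℓ : ℕ) :
    msgLaw (d / 2).toNNReal halfMsg ℓ
      = (((BP d)^[ℓ] diracHalf : ProbabilityMeasure OpenUnit) : Measure OpenUnit).map sharp := by
  induction ℓ with
  | zero => exact (Measure.map_dirac' continuous_sharp.measurable _).symm
  | succ ℓ ih =>
    rw [msgLaw, ih, msgStep_map_sharp, Function.iterate_succ_apply']

lemma flip_halfMsg : flip halfMsg = halfMsg := by
  refine Prod.ext (Subtype.ext ?_) (Subtype.ext ?_) <;>
    simp [flip, halfMsg, sharp, toUnitInterval] <;> norm_num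

lemma isBound_halfMsg : IsBound halfMsg :=
  ⟨le_rfl, by show (0 : ℝ) < 1 / 2; norm_num⟩

/-! ### Comparison of messages with different boundary conditions -/

/-- Messages with a single value in the open interval `(0,1)`. -/
def IsSharp (m : Msg) : Prop := m.1 = m.2 ∧ 0 < m.1 ∧ m.1 < 1

/-- The bounds in `M` are weaker than those in `m`. -/
def Within (m M : Msg) : Prop := M.1 ≤ m.1 ∧ m.2 ≤ M.2

lemma IsSharp.lit {m : Msg} (h : IsSharp m) (t : Bool) : IsSharp (lit m t) := by
  cases t
  · refine ⟨by simp [RandomTwoSat.lit, flip, h.1], ?_, ?_⟩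
    · show (0 : ℝ) < 1 - m.2
      have : (m.1 : ℝ) < 1 := h.2.2
      rw [← h.1]; linarith
    · show 1 - (m.2 : ℝ) < 1
      have : (0 : ℝ) < m.1 := h.2.1
      rw [← h.1]; linarith
  · exact h

lemma Within.lit {m M : Msg} (h : Within m M) (t : Bool) : Within (lit m t) (lit M t) := by
  cases t
  · exact ⟨unitInterval.symm_le_symm.2 h.2, unitInterval.symm_le_symm.2 h.1⟩
  · exact h

lemma isSharp_halfMsg : IsSharp halfMsg :=
  ⟨rfl, by show (0 : ℝ) < 1 / 2; norm_num, by show (1 / 2 : ℝ) < 1; norm_num⟩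

lemma within_trivialMsg (m : Msg) : Within m trivialMsg := ⟨m.1.2.1, m.2.2.2⟩

section
variable {n : ℕ} (ω : Config n) (S : Finset (Fin n)) (x : Fin n) (s : Bool) {m M : Fin n → Msg}

lemma collect_isSharp (h : ∀ y ∈ S, IsSharp (m y)) :
    (collect ω S x s m).1 = (collect ω S x s m).2 ∧ 0 < (collect ω S x s m).1 := by
  unfold collect
  refine Finset.prod_induction (p := fun m : Msg => m.1 = m.2 ∧ 0 < m.1) _
    (fun a b ha hb => ⟨by rw [Prod.fst_mul, Prod.snd_mul, ha.1, hb.1], ?_⟩) ⟨rfl, zero_lt_one⟩ ?_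
  · exact mul_pos (unitInterval.coe_pos.2 ha.2) (unitInterval.coe_pos.2 hb.2)
  · intro y hy
    refine Finset.prod_induction (p := fun m : Msg => m.1 = m.2 ∧ 0 < m.1) _
      (fun a b ha hb => ⟨by rw [Prod.fst_mul, Prod.snd_mul, ha.1, hb.1], ?_⟩) ⟨rfl, zero_lt_one⟩ ?_
    · exact mul_pos (unitInterval.coe_pos.2 ha.2) (unitInterval.coe_pos.2 hb.2)
    · intro t _
      have := (h y hy).lit t
      refine ⟨by rw [Prod.pow_fst, Prod.pow_snd, this.1], ?_⟩
      rw [Prod.pow_fst]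
      exact pow_pos (unitInterval.coe_pos.2 this.2.1) _

lemma collect_within (h : ∀ y ∈ S, Within (m y) (M y)) :
    Within (collect ω S x s m) (collect ω S x s M) := by
  unfold collect
  constructor
  · rw [Prod.fst_prod, Prod.fst_prod]
    refine Finset.prod_le_prod' fun y hy => ?_
    rw [Prod.fst_prod, Prod.fst_prod]
    refine Finset.prod_le_prod' fun t _ => ?_
    rw [Prod.pow_fst, Prod.pow_fst]
    exact pow_le_pow_left' ((h y hy).lit t).1 _
  · rw [Prod.snd_prod, Prod.snd_prod]
    refine Finset.prod_le_prod' fun y hy => ?_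
    rw [Prod.snd_prod, Prod.snd_prod]
    refine Finset.prod_le_prod' fun t _ => ?_
    rw [Prod.pow_snd, Prod.pow_snd]
    exact pow_le_pow_left' ((h y hy).lit t).2 _

end

lemma isSharp_msg {n : ℕ} (ω : Config n) (ℓ : ℕ) : ∀ (S : Finset (Fin n)) (x : Fin n),
    IsSharp (msg halfMsg ω ℓ S x) := by
  induction ℓ with
  | zero => intro S x; exact isSharp_halfMsg
  | succ ℓ ih =>
    intro S x
    have hA := collect_isSharp ω (S.erase x) x false fun y _ => ih (S.erase x) y
    have hB := collect_isSharp ω (S.erase x) x true fun y _ => ih (S.erase x) y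
    have hA' := unitInterval.coe_pos.2 hA.2
    have hB' := unitInterval.coe_pos.2 hB.2
    rw [msg]
    refine ⟨?_, ?_, ?_⟩
    · simp only [combine]
      rw [hA.1, hB.1]
    · show (0 : ℝ) < (frac _ _ : ℝ)
      rw [← hB.1, frac_eq (by positivity)]
      positivity
    · show (frac _ _ : ℝ) < 1
      rw [← hB.1, frac_eq (by positivity), div_lt_one (by positivity)]
      linarith

/-- Messages computed to a larger depth lie within the bounds obtained at depth `ℓ`. -/
lemma within_msg {n : ℕ} (ω : Config n) (ℓ k : ℕ) : ∀ (S : Finset (Fin n)) (x : Fin n),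
    Within (msg halfMsg ω (ℓ + k) S x) (msg trivialMsg ω ℓ S x) := by
  induction ℓ with
  | zero => intro S x; exact within_trivialMsg _
  | succ ℓ ih =>
    intro S x
    rw [Nat.succ_add, msg, msg]
    have hA := collect_isSharp ω (S.erase x) x false fun y _ => isSharp_msg ω (ℓ + k) (S.erase x) y
    have hB := collect_isSharp ω (S.erase x) x true fun y _ => isSharp_msg ω (ℓ + k) (S.erase x) y
    have wA := collect_within ω (S.erase x) x false fun y _ => ih (S.erase x) y
    have wB := collect_within ω (S.erase x) x true fun y _ => ih (S.erase x) y
    exact ⟨frac_mono wA.1 wB.2 hA.2 ((hB.1 ▸ hB.2).trans_le wB.2),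
      frac_mono wA.2 wB.1 ((hA.1 ▸ hA.2).trans_le wA.2) hB.2⟩

/-! ### Messages bound the marginals -/

section bracket
variable {n : ℕ} (ω : Config n)

/-- `σ` satisfies all clauses within the variable set `S`. -/
def SatOn (S : Finset (Fin n)) (σ : Assignment n) : Prop :=
  ∀ a b : Literal n, a.1 ∈ S → b.1 ∈ S → a.1 ≠ b.1 → mult ω a b ≠ 0 → σ a.1 = a.2 ∨ σ b.1 = b.2

open Classical in
/-- The number of assignments with the property `C` that satisfy all clauses within `S`. -/
def satCount (S : Finset (Fin n)) (C : Assignment n → Prop) : ℕ :=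
  (Finset.univ.filter fun σ => SatOn ω S σ ∧ C σ).card

/-- The number of clauses on the variables `x` and `y`. -/
def totalMult (x y : Fin n) : ℕ := ∑ s : Bool, ∑ t : Bool, mult ω (x, s) (y, t)

/-- The part of the formula on `S` that the message of depth `ℓ` about `x` sees is a tree. -/
def Good : ℕ → Finset (Fin n) → Fin n → Prop
  | 0, _, _ => True
  | ℓ + 1, S, x =>
    (∀ y ∈ S.erase x, totalMult ω x y ≤ 1) ∧
    (∀ y ∈ S.erase x, ∀ y' ∈ S.erase x, y ≠ y' → Adj ω x y → Adj ω x y' →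
      ¬ InBall ω ℓ (S.erase x) y y') ∧
    ∀ y ∈ S.erase x, Adj ω x y → Good ℓ (S.erase x) y

/-- The property `C` does not depend on the variables in the ball of radius `ℓ` around `x`. -/
def Free (ℓ : ℕ) (S : Finset (Fin n)) (x : Fin n) (C : Assignment n → Prop) : Prop :=
  ∀ σ v b, InBall ω ℓ S x v → (C (Function.update σ v b) ↔ C σ)

variable {ω}

lemma satCount_add (S : Finset (Fin n)) (C : Assignment n → Prop) (x : Fin n) :
    satCount ω S (fun σ => C σ ∧ σ x = true) + satCount ω S (fun σ => C σ ∧ σ x = false)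
      = satCount ω S C := by
  classical
  unfold satCount
  rw [← Finset.card_union_of_disjoint]
  · congr 1
    ext σ
    simp only [Finset.mem_union, Finset.mem_filter, Finset.mem_univ, true_and]
    cases σ x <;> simp
  · rw [Finset.disjoint_left]
    intro σ h1 h2
    simp only [Finset.mem_filter, Finset.mem_univ, true_and] at h1 h2
    rw [h1.2.2] at h2
    simp at h2

lemma satCount_congr {S T : Finset (Fin n)} {C D : Assignment n → Prop}
    (h : ∀ σ, (SatOn ω S σ ∧ C σ) ↔ (SatOn ω T σ ∧ D σ)) :
    satCount ω S C = satCount ω T D := by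
  classical
  unfold satCount
  congr 1
  ext σ
  simp [h σ]

lemma satOn_update {S : Finset (Fin n)} {x : Fin n} (hx : x ∉ S) (σ : Assignment n) (b : Bool) :
    SatOn ω S (Function.update σ x b) ↔ SatOn ω S σ := by
  unfold SatOn
  refine forall_congr' fun a => forall_congr' fun c => imp_congr_right fun ha =>
    imp_congr_right fun hc => ?_
  rw [Function.update_of_ne (fun h => hx (by rwa [h] at ha)),
    Function.update_of_ne (fun h => hx (by rwa [h] at hc))]

/-- An unconstrained variable takes both values equally often. -/
lemma satCount_half {S : Finset (Fin n)} {x : Fin n} (hx : x ∉ S) {C : Assignment n → Prop}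
    (hC : ∀ σ b, C (Function.update σ x b) ↔ C σ) (b : Bool) :
    2 * satCount ω S (fun σ => C σ ∧ σ x = b) = satCount ω S C := by
  classical
  have h : satCount ω S (fun σ => C σ ∧ σ x = true)
      = satCount ω S (fun σ => C σ ∧ σ x = false) := by
    unfold satCount
    refine Finset.card_bij' (fun σ _ => Function.update σ x false)
      (fun σ _ => Function.update σ x true) ?_ ?_ ?_ ?_
    · intro σ hσ
      simp only [Finset.mem_filter, Finset.mem_univ, true_and] at hσ ⊢
      exact ⟨(satOn_update hx _ _).2 hσ.1, (hC _ _).2 hσ.2.1, Function.update_self ..⟩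
    · intro σ hσ
      simp only [Finset.mem_filter, Finset.mem_univ, true_and] at hσ ⊢
      exact ⟨(satOn_update hx _ _).2 hσ.1, (hC _ _).2 hσ.2.1, Function.update_self ..⟩
    · intro σ hσ
      simp only [Finset.mem_filter, Finset.mem_univ, true_and] at hσ
      rw [Function.update_idem, ← hσ.2.2, Function.update_eq_self]
    · intro σ hσ
      simp only [Finset.mem_filter, Finset.mem_univ, true_and] at hσ
      rw [Function.update_idem, ← hσ.2.2, Function.update_eq_self]
  have h2 := satCount_add (ω := ω) S C x
  cases b <;> omega

/-- Two-sided bounds by a message on the fraction of assignments with a given property. -/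
def Brackets (m : Msg) (N N' : ℕ) : Prop := (m.1 : ℝ) * N ≤ N' ∧ (N' : ℝ) ≤ m.2 * N

lemma Brackets.mul {m m' : Msg} {N N' N'' : ℕ} (h : Brackets m N N') (h' : Brackets m' N' N'') :
    Brackets (m * m') N N'' := by
  have h1 := m'.1.2.1
  have h2 := m'.2.2.1
  constructor
  · calc ((m * m').1 : ℝ) * N = m'.1 * (m.1 * N) := by
          rw [Prod.fst_mul, Set.Icc.coe_mul]; ring
      _ ≤ m'.1 * N' := mul_le_mul_of_nonneg_left h.1 h1
      _ ≤ N'' := h'.1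
  · calc (N'' : ℝ) ≤ m'.2 * N' := h'.2
      _ ≤ m'.2 * (m.2 * N) := mul_le_mul_of_nonneg_left h.2 h2
      _ = _ := by rw [Prod.snd_mul, Set.Icc.coe_mul]; ring

lemma Brackets.lit {m : Msg} {S : Finset (Fin n)} {C : Assignment n → Prop} {y : Fin n}
    (h : Brackets m (satCount ω S C) (satCount ω S fun σ => C σ ∧ σ y = true)) (t : Bool) :
    Brackets (lit m t) (satCount ω S C) (satCount ω S fun σ => C σ ∧ σ y = t) := by
  cases t
  · have h2 : (satCount ω S (fun σ => C σ ∧ σ y = true) : ℝ)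
        + satCount ω S (fun σ => C σ ∧ σ y = false) = satCount ω S C := by
      exact_mod_cast satCount_add (ω := ω) S C y
    have h3 := h.1
    have h4 := h.2
    constructor
    · show (1 - (m.2 : ℝ)) * _ ≤ _
      linarith
    · show _ ≤ (1 - (m.1 : ℝ)) * _
      linarith
  · exact h

/-- All literals over variables in `T` that share a clause with the literal `(x, s)` are true, which
is required if that literal is false. -/
def Requires (ω : Config n) (T : Finset (Fin n)) (x : Fin n) (s : Bool) (σ : Assignment n) : Prop :=
  ∀ y ∈ T, ∀ t, mult ω (x, s) (y, t) ≠ 0 → σ y = t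

lemma satOn_iff_requires {S : Finset (Fin n)} {x : Fin n} (hx : x ∈ S) (s : Bool)
    {σ : Assignment n} (hσ : σ x = !s) :
    SatOn ω S σ ↔ SatOn ω (S.erase x) σ ∧ Requires ω (S.erase x) x s σ := by
  have hne : σ x ≠ s := by rw [hσ]; simp
  constructor
  · intro h
    refine ⟨fun a b ha hb => h a b (Finset.mem_of_mem_erase ha) (Finset.mem_of_mem_erase hb), ?_⟩
    intro y hy t hm
    rcases h (x, s) (y, t) hx (Finset.mem_of_mem_erase hy) (Finset.ne_of_mem_erase hy).symm hm
      with h' | h'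
    · exact absurd h' hne
    · exact h'
  · rintro ⟨h1, h2⟩ ⟨a, s₁⟩ ⟨b, s₂⟩ ha hb hab hm
    simp only at ha hb hab ⊢
    by_cases hax : a = x
    · subst hax
      by_cases hs : s₁ = s
      · subst hs
        exact Or.inr (h2 b (Finset.mem_erase.2 ⟨hab.symm, hb⟩) _ hm)
      · left
        rw [hσ]
        cases s <;> cases s₁ <;> simp_all
    · by_cases hbx : b = x
      · subst hbx
        by_cases hs : s₂ = s
        · subst hs
          rw [mult_comm] at hm
          exact Or.inl (h2 a (Finset.mem_erase.2 ⟨hab, ha⟩) _ hm)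
        · right
          rw [hσ]
          cases s <;> cases s₂ <;> simp_all
      · exact h1 (a, s₁) (b, s₂) (Finset.mem_erase.2 ⟨hax, ha⟩) (Finset.mem_erase.2 ⟨hbx, hb⟩)
          hab hm

lemma brackets_combine {A B : Msg} {N N₁ N₀ : ℕ} (h₁ : Brackets A N (2 * N₁))
    (h₀ : Brackets B N (2 * N₀)) : Brackets (combine (A, B)) (N₁ + N₀) N₁ := by
  have a1 := A.1.2.1
  have a2 := A.2.2.1
  have b1 := B.1.2.1
  have b2 := B.2.2.1
  obtain ⟨h1, h2⟩ := h₁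
  obtain ⟨h3, h4⟩ := h₀
  have n1 : (0 : ℝ) ≤ N₁ := Nat.cast_nonneg _
  have n0 : (0 : ℝ) ≤ N₀ := Nat.cast_nonneg _
  have nn : (0 : ℝ) ≤ N := Nat.cast_nonneg _
  push_cast at h1 h2 h3 h4
  constructor
  · show (frac A.1 B.2 : ℝ) * ((N₁ + N₀ : ℕ) : ℝ) ≤ N₁
    push_cast
    by_cases h : 0 < (A.1 : ℝ) + B.2
    · rw [frac_eq h, div_mul_eq_mul_div, div_le_iff₀ h]
      nlinarith [mul_le_mul_of_nonneg_left h4 a1, mul_le_mul_of_nonneg_left h1 b2]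
    · obtain ⟨e1, e2⟩ := add_eq_zero_unit h
      rw [frac_zero (by rw [e1, e2]; simp)]
      rw [e2] at h4
      simp only [Set.Icc.coe_zero, zero_mul] at h4
      linarith
  · show (N₁ : ℝ) ≤ (frac A.2 B.1 : ℝ) * ((N₁ + N₀ : ℕ) : ℝ)
    push_cast
    by_cases h : 0 < (A.2 : ℝ) + B.1
    · rw [frac_eq h, div_mul_eq_mul_div, le_div_iff₀ h]
      nlinarith [mul_le_mul_of_nonneg_left h2 b1, mul_le_mul_of_nonneg_left h3 a2]
    · obtain ⟨e1, e2⟩ := add_eq_zero_unit h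
      rw [frac_zero (by rw [e1, e2]; simp)]
      rw [e1] at h2
      simp only [Set.Icc.coe_zero, zero_mul] at h2
      linarith

/-- **Messages bound marginals.** If the neighbourhood of `x` is a tree, then the bounds in the
message about `x` hold under any conditioning on the variables outside this neighbourhood. -/
lemma brackets_msg (ℓ : ℕ) : ∀ {S : Finset (Fin n)} {x : Fin n} {C : Assignment n → Prop}, x ∈ S →
    Good ω ℓ S x → Free ω ℓ S x C → Brackets (msg trivialMsg ω ℓ S x) (satCount ω S C)
      (satCount ω S fun σ => C σ ∧ σ x = true) := by
  induction ℓ with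
  | zero =>
    intro S x C _ _ _
    have h2 : (satCount ω S (fun σ => C σ ∧ σ x = true) : ℝ)
        + satCount ω S (fun σ => C σ ∧ σ x = false) = satCount ω S C := by
      exact_mod_cast satCount_add (ω := ω) S C x
    have h3 : (0 : ℝ) ≤ satCount ω S (fun σ => C σ ∧ σ x = false) := Nat.cast_nonneg _
    constructor
    · simp [msg, trivialMsg]
    · simp only [msg, trivialMsg, Set.Icc.coe_one, one_mul]
      linarith
  | succ ℓ ih =>
    intro S x C hx hgood hfree
    obtain ⟨hg1, hg2, hg3⟩ := hgood
    set S' := S.erase x with hS'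
    have hxS' : x ∉ S' := Finset.notMem_erase _ _
    set m := msg trivialMsg ω ℓ S' with hm
    -- The neighbours are revealed one by one. The subtree of each of them is disjoint from what was
    -- revealed before, so that its bounds hold under the conditioning on the previous requirements.
    have hseq : ∀ s (T : Finset (Fin n)), T ⊆ S' → Brackets (collect ω T x s m) (satCount ω S' C)
        (satCount ω S' fun σ => C σ ∧ Requires ω T x s σ) := by
      intro s T
      induction T using Finset.induction_on with
      | empty =>
        intro _
        have : satCount ω S' (fun σ => C σ ∧ Requires ω ∅ x s σ) = satCount ω S' C :=
          satCount_congr fun σ => by simp [Requires]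
        rw [this]
        simp [collect, Brackets]
      | insert y T hy ihT =>
        intro hT
        have hyS : y ∈ S' := hT (Finset.mem_insert_self _ _)
        have hTS : T ⊆ S' := (Finset.subset_insert _ _).trans hT
        have ih' := ihT hTS
        rw [collect, Finset.prod_insert hy, mul_comm]
        refine ih'.mul ?_
        have hreq : ∀ σ, Requires ω (insert y T) x s σ ↔
            Requires ω T x s σ ∧ ∀ t, mult ω (x, s) (y, t) ≠ 0 → σ y = t := by
          intro σ
          simp [Requires, and_comm]
        by_cases h0 : ∀ t, mult ω (x, s) (y, t) = 0
        · have e1 : (∏ t : Bool, lit (m y) t ^ mult ω (x, s) (y, t)) = 1 :=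
            Finset.prod_eq_one fun t _ => by rw [h0 t, pow_zero]
          have e2 : satCount ω S' (fun σ => C σ ∧ Requires ω (insert y T) x s σ)
              = satCount ω S' fun σ => C σ ∧ Requires ω T x s σ :=
            satCount_congr fun σ => by rw [hreq]; simp [h0]
          rw [e1, e2]
          simp [Brackets]
        · push Not at h0
          obtain ⟨t, ht⟩ := h0
          have htot := hg1 y hyS
          have hle : mult ω (x, s) (y, t) + mult ω (x, s) (y, !t) ≤ totalMult ω x y := by
            unfold totalMult
            simp only [Fintype.sum_bool]
            cases s <;> cases t <;> simp only [Bool.not_true, Bool.not_false] <;> omega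
          have ht1 : mult ω (x, s) (y, t) = 1 := by omega
          have ht0 : mult ω (x, s) (y, !t) = 0 := by omega
          have e1 : (∏ t : Bool, lit (m y) t ^ mult ω (x, s) (y, t)) = lit (m y) t := by
            rw [Fintype.prod_bool]
            cases t
            · rw [show mult ω (x, s) (y, true) = 0 from ht0, ht1]; simp
            · rw [show mult ω (x, s) (y, false) = 0 from ht0, ht1]; simp
          have e2 : satCount ω S' (fun σ => C σ ∧ Requires ω (insert y T) x s σ)
              = satCount ω S' fun σ => (C σ ∧ Requires ω T x s σ) ∧ σ y = t := by
            refine satCount_congr fun σ => ?_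
            rw [hreq]
            have : (∀ t', mult ω (x, s) (y, t') ≠ 0 → σ y = t') ↔ σ y = t := by
              refine ⟨fun h => h t ht, fun h t' ht' => ?_⟩
              by_cases htt : t' = t
              · rw [htt, h]
              · have : t' = !t := by cases t <;> cases t' <;> simp_all
                rw [this] at ht'
                exact absurd ht0 ht'
            rw [this]
            tauto
          rw [e1, e2]
          have hadj : Adj ω x y := ⟨s, t, ht⟩
          refine (ih hyS (hg3 y hyS hadj) ?_).lit t
          intro σ v b hv
          refine and_congr (hfree σ v b (Or.inr ⟨y, hyS, hadj, hv⟩)) ?_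
          refine forall_congr' fun y' => imp_congr_right fun hy' => forall_congr' fun t' =>
            imp_congr_right fun hm' => ?_
          rw [Function.update_of_ne]
          rintro rfl
          exact hg2 y hyS y' (hTS hy') (fun h => hy (h ▸ hy')) hadj ⟨s, t', hm'⟩ hv
    have hCx : ∀ σ b, C (Function.update σ x b) ↔ C σ := fun σ b => hfree σ x b (Or.inl rfl)
    -- an assignment in which `x` has the value `!s` satisfies the formula on `S` if it satisfies
    -- that on `S'` and the requirements; in the latter formula `x` is free, whence the factor `2`
    have hhalf : ∀ s, satCount ω S' (fun σ => C σ ∧ Requires ω S' x s σ)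
        = 2 * satCount ω S fun σ => C σ ∧ σ x = !s := by
      intro s
      rw [← satCount_half (ω := ω) hxS' (C := fun σ => C σ ∧ Requires ω S' x s σ) ?_ (!s)]
      · congr 1
        refine satCount_congr fun σ => ?_
        constructor
        · rintro ⟨h1, ⟨h2, h3⟩, h4⟩
          exact ⟨(satOn_iff_requires hx s h4).2 ⟨h1, h3⟩, h2, h4⟩
        · rintro ⟨h1, h2, h4⟩
          obtain ⟨h5, h6⟩ := (satOn_iff_requires hx s h4).1 h1
          exact ⟨h5, ⟨h2, h6⟩, h4⟩
      · intro σ b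
        refine and_congr (hCx σ b) ?_
        refine forall_congr' fun y' => imp_congr_right fun hy' => forall_congr' fun t' =>
            imp_congr_right fun _ => ?_
        rw [Function.update_of_ne (fun h : y' = x => hxS' (by rw [← h]; exact hy'))]
    have h1 := hseq false S' subset_rfl
    have h0 := hseq true S' subset_rfl
    rw [hhalf] at h1 h0
    simp only [Bool.not_false, Bool.not_true] at h1 h0
    have := brackets_combine h1 h0
    rw [satCount_add] at this
    exact this

end bracket

/-! ### Neighbourhoods are trees with high probability -/

section tree
variable {n : ℕ} {lam : ℝ≥0}

lemma AgreeOn.totalMult_eq {S : Finset (Fin n)} {ω ω' : Config n} (h : AgreeOn S ω ω')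
    {x y : Fin n} (hx : x ∈ S) (hy : y ∈ S) : totalMult ω x y = totalMult ω' x y := by
  unfold totalMult
  simp only [h.mult_eq hx hy]

lemma good_congr {ω ω' : Config n} (ℓ : ℕ) : ∀ {S : Finset (Fin n)} {x : Fin n}, AgreeOn S ω ω' →
    x ∈ S → (Good ω ℓ S x ↔ Good ω' ℓ S x) := by
  induction ℓ with
  | zero => intros; rfl
  | succ ℓ ih =>
    intro S x h hx
    have h' := h.mono (Finset.erase_subset x S)
    refine and_congr ?_ (and_congr ?_ ?_)
    · refine forall_congr' fun y => imp_congr_right fun hy => ?_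
      rw [h.totalMult_eq hx (Finset.mem_of_mem_erase hy)]
    · refine forall_congr' fun y => imp_congr_right fun hy => forall_congr' fun y' =>
        imp_congr_right fun hy' => ?_
      rw [h.adj_iff hx (Finset.mem_of_mem_erase hy), h.adj_iff hx (Finset.mem_of_mem_erase hy'),
        inBall_congr ℓ y' h' hy]
    · refine forall_congr' fun y => imp_congr_right fun hy => ?_
      rw [h.adj_iff hx (Finset.mem_of_mem_erase hy), ih h' hy]

lemma measureReal_coord_two_le (p : Literal n × Literal n) :
    (configLaw n lam).real {ω | 2 ≤ ω p} ≤ (lam : ℝ) ^ 2 := by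
  refine (measureReal_coord p {k | 2 ≤ k}).le.trans ?_
  exact ENNReal.toReal_le_coe_of_le_coe (by exact_mod_cast poisson_two_le_le lam)

lemma measureReal_coord_pair {p p' : Literal n × Literal n} (h : p ≠ p') :
    (configLaw n lam).real ({ω | ω p ≠ 0} ∩ {ω | ω p' ≠ 0}) ≤ (lam : ℝ) ^ 2 := by
  rw [measureReal_inter_eq_mul _ {p} {ω | ω p ≠ 0} {ω | ω p' ≠ 0}
    (fun ω ω' h' => by rw [Set.mem_ofPred_eq, h' p rfl]; rfl)
    (fun ω ω' h' => by rw [Set.mem_ofPred_eq, h' p' (by simpa using h.symm)]; rfl), sq]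
  exact mul_le_mul (measureReal_coord_ne_zero p) (measureReal_coord_ne_zero p') measureReal_nonneg
    (NNReal.coe_nonneg _)

lemma measureReal_totalMult {x y : Fin n} (hxy : x ≠ y) :
    (configLaw n lam).real {ω | ¬ totalMult ω x y ≤ 1} ≤ 64 * (lam : ℝ) ^ 2 := by
  let p : Bool × Bool × Bool → Literal n × Literal n := fun q =>
    if q.2.2 then ((x, q.1), (y, q.2.1)) else ((y, q.2.1), (x, q.1))
  have hp : Function.Injective p := by
    rintro ⟨s, t, o⟩ ⟨s', t', o'⟩ h
    cases o <;> cases o' <;> simp [p, hxy, hxy.symm] at h <;> simp [h]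
  have htot : ∀ ω : Config n, totalMult ω x y = ∑ q, ω (p q) := by
    intro ω
    simp only [totalMult, mult, Fintype.sum_prod_type, Fintype.sum_bool, p, if_true,
      Bool.false_eq_true, if_false]
  let E : (Bool × Bool × Bool) × (Bool × Bool × Bool) → Set (Config n) := fun q =>
    if q.1 = q.2 then {ω | 2 ≤ ω (p q.1)} else {ω | ω (p q.1) ≠ 0} ∩ {ω | ω (p q.2) ≠ 0}
  have hsub : {ω : Config n | ¬ totalMult ω x y ≤ 1} ⊆
      ⋃ q ∈ (Finset.univ : Finset ((Bool × Bool × Bool) × (Bool × Bool × Bool))), E q := by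
    intro ω hω
    by_contra hc
    simp only [Set.mem_iUnion, not_exists] at hc
    refine hω ?_
    rw [htot]
    by_cases h : ∀ q, ω (p q) = 0
    · rw [Finset.sum_eq_zero fun q _ => h q]; exact zero_le_one
    · push Not at h
      obtain ⟨q, hq⟩ := h
      rw [Finset.sum_eq_single q]
      · have := hc (q, q) (Finset.mem_univ _)
        simp only [E, if_true] at this
        have h2 : ¬ 2 ≤ ω (p q) := this
        omega
      · intro q' _ hne
        by_contra h0
        have := hc (q, q') (Finset.mem_univ _)
        simp only [E, hne.symm, if_false] at this
        exact this ⟨hq, h0⟩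
      · simp
  calc _ ≤ _ := measureReal_mono hsub (measure_ne_top _ _)
    _ ≤ ∑ q, (configLaw n lam).real (E q) := measureReal_biUnion_finset_le _ _
    _ ≤ ∑ _q : (Bool × Bool × Bool) × (Bool × Bool × Bool), (lam : ℝ) ^ 2 := by
        refine Finset.sum_le_sum fun q _ => ?_
        by_cases h : q.1 = q.2
        · simp only [E, h, if_true]; exact measureReal_coord_two_le _
        · simp only [E, h, if_false]; exact measureReal_coord_pair (fun h' => h (hp h'))
    _ = _ := by simp

/-- A bound on the probability that the neighbourhood of radius `ℓ` is not a tree. The terms account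
for two clauses on the same variables, for a path between two neighbours, and for a cycle in the
neighbourhood of a neighbour. -/
def cycleBound (lam N : ℝ) : ℕ → ℝ
  | 0 => 0
  | ℓ + 1 => N * (64 * lam ^ 2) + N * (N * (64 * lam ^ 2 * pathBound lam N ℓ))
      + N * (8 * lam * cycleBound lam N ℓ)

lemma cycleBound_nonneg {lam N : ℝ} (h : 0 ≤ lam) (hN : 0 ≤ N) (ℓ : ℕ) :
    0 ≤ cycleBound lam N ℓ := by
  induction ℓ with
  | zero => exact le_rfl
  | succ ℓ ih =>
    have := pathBound_nonneg h hN ℓ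
    unfold cycleBound; positivity

lemma measureReal_adj_adj_inBall {S : Finset (Fin n)} {x y y' : Fin n} {N : ℕ} (ℓ : ℕ)
    (hS : S.card ≤ N) (hxS : x ∉ S) (hy : y ∈ S) (hne : y ≠ y') :
    (configLaw n lam).real ({ω | Adj ω x y ∧ Adj ω x y'} ∩ {ω | InBall ω ℓ S y y'})
      ≤ 64 * (lam : ℝ) ^ 2 * pathBound lam N ℓ := by
  have hlam : (0 : ℝ) ≤ lam := NNReal.coe_nonneg _
  rw [measureReal_inter_eq_mul _ (star x) {ω | Adj ω x y ∧ Adj ω x y'} {ω | InBall ω ℓ S y y'}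
    (fun ω ω' h => and_congr (adj_iff_of_star h y) (adj_iff_of_star h y'))
    (fun ω ω' h => inBall_congr ℓ y' (agreeOn_of_off_star hxS h) hy)]
  refine mul_le_mul ?_ (measureReal_inBall ℓ hS hne) measureReal_nonneg (by positivity)
  have hsub : {ω : Config n | Adj ω x y ∧ Adj ω x y'} = {ω | Adj ω y x} ∩ {ω | Adj ω x y'} := by
    ext ω
    exact and_congr ⟨Adj.symm, Adj.symm⟩ Iff.rfl
  rw [hsub]
  refine (measureReal_adj_inter (S := {x, y'}) ?_ _ fun ω ω' h =>
    h.adj_iff (by simp) (by simp)).trans ?_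
  · simp only [Finset.mem_insert, Finset.mem_singleton, not_or]
    exact ⟨fun h => hxS (h ▸ hy), hne⟩
  · have := mul_le_mul_of_nonneg_left (measureReal_adj (lam := lam) x y')
      (by positivity : 0 ≤ 8 * (lam : ℝ))
    exact this.trans (le_of_eq (by ring))

lemma measureReal_not_good {N : ℕ} (ℓ : ℕ) : ∀ {S : Finset (Fin n)} {x : Fin n}, S.card ≤ N →
    x ∈ S → (configLaw n lam).real {ω | ¬ Good ω ℓ S x} ≤ cycleBound lam N ℓ := by
  induction ℓ with
  | zero => intro S x _ _; simp [Good, cycleBound]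
  | succ ℓ ih =>
    intro S x hS hx
    have hlam : (0 : ℝ) ≤ lam := NNReal.coe_nonneg _
    have hp := pathBound_nonneg hlam (Nat.cast_nonneg N) ℓ
    have hc := cycleBound_nonneg hlam (Nat.cast_nonneg N) ℓ
    set S' := S.erase x with hS'
    have hxS' : x ∉ S' := Finset.notMem_erase _ _
    have hcard : S'.card ≤ N := (Finset.card_le_card (Finset.erase_subset _ _)).trans hS
    have hcard' : (S'.card : ℝ) ≤ N := by exact_mod_cast hcard
    have hsub : {ω : Config n | ¬ Good ω (ℓ + 1) S x} ⊆
        ((⋃ y ∈ S', {ω | ¬ totalMult ω x y ≤ 1}) ∪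
          ⋃ y ∈ S', ⋃ y' ∈ S'.erase y,
            ({ω | Adj ω x y ∧ Adj ω x y'} ∩ {ω | InBall ω ℓ S' y y'})) ∪
        ⋃ y ∈ S', ({ω | Adj ω x y} ∩ {ω | ¬ Good ω ℓ S' y}) := by
      intro ω hω
      by_contra hc
      simp only [Set.mem_union, Set.mem_iUnion, not_or, not_exists] at hc
      obtain ⟨⟨h1, h2⟩, h3⟩ := hc
      refine hω ⟨fun y hy => ?_, fun y hy y' hy' hne ha ha' hb => ?_, fun y hy ha => ?_⟩
      · by_contra h; exact h1 y hy h
      · exact h2 y hy y' (Finset.mem_erase.2 ⟨hne.symm, hy'⟩) ⟨⟨ha, ha'⟩, hb⟩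
      · by_contra h; exact h3 y hy ⟨ha, h⟩
    have b1 : (configLaw n lam).real (⋃ y ∈ S', {ω | ¬ totalMult ω x y ≤ 1})
        ≤ S'.card * (64 * (lam : ℝ) ^ 2) := by
      refine (measureReal_biUnion_finset_le _ _).trans ((Finset.sum_le_sum fun y hy =>
        measureReal_totalMult (Finset.ne_of_mem_erase hy).symm).trans (le_of_eq ?_))
      rw [Finset.sum_const, nsmul_eq_mul]
    have b2 : (configLaw n lam).real (⋃ y ∈ S', ⋃ y' ∈ S'.erase y,
        ({ω | Adj ω x y ∧ Adj ω x y'} ∩ {ω | InBall ω ℓ S' y y'}))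
        ≤ S'.card * (N * (64 * (lam : ℝ) ^ 2 * pathBound lam N ℓ)) := by
      refine (measureReal_biUnion_finset_le _ _).trans ((Finset.sum_le_sum (g := fun _ =>
        (N * (64 * (lam : ℝ) ^ 2 * pathBound lam N ℓ))) fun y hy => ?_).trans (le_of_eq ?_))
      · refine (measureReal_biUnion_finset_le _ _).trans ((Finset.sum_le_sum fun y' hy' =>
          measureReal_adj_adj_inBall ℓ hcard hxS' hy
            (Finset.ne_of_mem_erase hy').symm).trans ?_)
        rw [Finset.sum_const, nsmul_eq_mul]
        refine mul_le_mul_of_nonneg_right ?_ (by positivity)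
        exact_mod_cast (Finset.card_le_card (Finset.erase_subset _ _)).trans hcard
      · rw [Finset.sum_const, nsmul_eq_mul]
    have b3 : (configLaw n lam).real (⋃ y ∈ S', ({ω | Adj ω x y} ∩ {ω | ¬ Good ω ℓ S' y}))
        ≤ S'.card * (8 * lam * cycleBound lam N ℓ) := by
      refine (measureReal_biUnion_finset_le _ _).trans ((Finset.sum_le_sum (g := fun _ =>
        8 * lam * cycleBound lam N ℓ) fun y hy => ?_).trans (le_of_eq ?_))
      · refine (measureReal_adj_inter hxS' _ fun ω ω' h => not_congr (good_congr ℓ h hy)).trans ?_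
        exact mul_le_mul_of_nonneg_left (ih hcard hy) (by positivity)
      · rw [Finset.sum_const, nsmul_eq_mul]
    refine (measureReal_mono hsub (measure_ne_top _ _)).trans ((measureReal_union_le _ _).trans
      ((add_le_add (measureReal_union_le _ _) le_rfl).trans ?_))
    refine (add_le_add (add_le_add b1 b2) b3).trans ?_
    rw [cycleBound]
    gcongr

lemma Grow.tendsto_cycleBound {r : ℝ} {κ : Type} {l : Filter κ} {n : κ → ℕ} {lam : κ → ℝ≥0}
    {S : ∀ k, Finset (Fin (n k))} (h : Grow r l n lam S) (ℓ : ℕ) :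
    Tendsto (fun k => cycleBound (lam k) (S k).card ℓ) l (𝓝 0) := by
  induction ℓ with
  | zero => exact tendsto_const_nhds
  | succ ℓ ih =>
    have h1 := ((h.2.mul h.tendsto_lam).const_mul 16).add
      (((h.2.pow 2).mul (h.tendsto_pathBound ℓ)).const_mul 4)
    have h2 := h1.add ((h.2.mul ih).const_mul 2)
    simp only [mul_zero, add_zero] at h2
    refine h2.congr fun k => ?_
    rw [cycleBound]; ring

end tree

/-! ### The implication digraph -/

/-- The opposite literal. -/
def neg {n : ℕ} (l : Literal n) : Literal n := (l.1, !l.2)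

section implication
variable {n : ℕ}

lemma neg_neg_literal (l : Literal n) : neg (neg l) = l := by simp [neg]

lemma neg_ne (l : Literal n) : neg l ≠ l := by
  intro h
  have := congrArg Prod.snd h
  simp [neg] at this

lemma neg_injective : Function.Injective (neg : Literal n → Literal n) := fun a b h => by
  rw [← neg_neg_literal a, h, neg_neg_literal]

lemma eq_or_eq_neg {a b : Literal n} (h : a.1 = b.1) : a = b ∨ a = neg b := by
  obtain ⟨x, s⟩ := a
  obtain ⟨y, t⟩ := b
  simp only at h
  subst h
  cases s <;> cases t <;> simp [neg]

/-- By virtue of a clause, the truth of the literal `a` implies that of `b`. -/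
def Implies (ω : Config n) (a b : Literal n) : Prop := a.1 ≠ b.1 ∧ mult ω (neg a) b ≠ 0

variable {ω : Config n}

lemma Implies.contrapose {a b : Literal n} (h : Implies ω a b) : Implies ω (neg b) (neg a) :=
  ⟨h.1.symm, by rw [neg_neg_literal, mult_comm]; exact h.2⟩

lemma reach_contrapose {a b : Literal n} (h : Relation.ReflTransGen (Implies ω) a b) :
    Relation.ReflTransGen (Implies ω) (neg b) (neg a) := by
  induction h with
  | refl => exact .refl
  | tail _ h ih => exact Relation.ReflTransGen.head h.contrapose ih

/-- A formula is satisfiable if no literal is equivalent to its negation: a maximal consistent set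
of literals that is closed under implication is a satisfying assignment. -/
lemma exists_satOn (h : ∀ l, ¬ (Relation.ReflTransGen (Implies ω) l (neg l) ∧
    Relation.ReflTransGen (Implies ω) (neg l) l)) : ∃ σ, SatOn ω Finset.univ σ := by
  classical
  let P : Set (Set (Literal n)) := {T | (∀ a ∈ T, ∀ b, Implies ω a b → b ∈ T) ∧
    ∀ a ∈ T, neg a ∉ T}
  obtain ⟨T, hT⟩ := P.toFinite.exists_maximal ⟨∅, by simp [P]⟩
  obtain ⟨hcl, hcon⟩ := hT.prop
  have hreach : ∀ a ∈ T, ∀ b, Relation.ReflTransGen (Implies ω) a b → b ∈ T := by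
    intro a ha b hab
    induction hab with
    | refl => exact ha
    | tail _ h ih => exact hcl _ ih _ h
  -- otherwise adding to `T` all that `l` implies would give a larger consistent closed set
  have hcov' : ∀ l, ¬ Relation.ReflTransGen (Implies ω) l (neg l) → neg l ∉ T → l ∈ T := by
    intro l hl hln
    have hmem : T ∪ {b | Relation.ReflTransGen (Implies ω) l b} ∈ P := by
      refine ⟨?_, ?_⟩
      · rintro a (ha | ha) b hab
        · exact Or.inl (hcl a ha b hab)
        · exact Or.inr (Relation.ReflTransGen.tail ha hab)
      · rintro a (ha | ha) (hb | hb)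
        · exact hcon a ha hb
        · refine hln (hreach a ha _ ?_)
          have := reach_contrapose hb
          rwa [neg_neg_literal] at this
        · refine hln (hreach _ hb _ ?_)
          exact reach_contrapose ha
        · refine hl (Relation.ReflTransGen.trans ha ?_)
          have := reach_contrapose hb
          rwa [neg_neg_literal] at this
    exact hT.le_of_ge hmem Set.subset_union_left (Or.inr Relation.ReflTransGen.refl)
  have hcov : ∀ l, l ∈ T ∨ neg l ∈ T := by
    intro l
    by_contra hc
    rw [not_or] at hc
    refine h l ⟨?_, ?_⟩
    · by_contra h'
      exact hc.1 (hcov' l h' hc.2)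
    · by_contra h'
      refine hc.2 (hcov' (neg l) (by rwa [neg_neg_literal]) (by rw [neg_neg_literal]; exact hc.1))
  refine ⟨fun x => decide ((x, true) ∈ T), fun a b _ _ hab hm => ?_⟩
  have hval : ∀ a : Literal n, a ∈ T → decide ((a.1, true) ∈ T) = a.2 := by
    rintro ⟨x, s⟩ ha
    cases s
    · exact decide_eq_false (by simpa [neg] using hcon _ ha)
    · exact decide_eq_true ha
  rcases hcov a with ha | ha
  · exact Or.inl (hval a ha)
  · refine Or.inr (hval b (hcl _ ha b ⟨hab, ?_⟩))
    rwa [neg_neg_literal]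

/-! ### Bicycles -/

lemma exists_split_of_not_nodup {α β : Type*} (f : α → β) {p : List α} (h : ¬ (p.map f).Nodup) :
    ∃ A a B b C, p = A ++ a :: (B ++ b :: C) ∧ f a = f b := by
  induction p with
  | nil => simp at h
  | cons c p ih =>
    by_cases hc : f c ∈ p.map f
    · obtain ⟨b, hb, hcb⟩ := List.mem_map.1 hc
      obtain ⟨B, C, rfl⟩ := List.append_of_mem hb
      exact ⟨[], c, B, b, C, rfl, hcb.symm⟩
    · rw [List.map_cons, List.nodup_cons, not_and] at h
      obtain ⟨A, a, B, b, C, rfl, hab⟩ := ih (h hc)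
      exact ⟨c :: A, a, B, b, C, rfl, hab⟩

/-- A walk from a literal to its negation contains a path with distinct variables that leads to the
negation of one of the literals on the path. -/
lemma exists_path_of_walk {r : Literal n → Literal n → Prop} (N : ℕ) : ∀ (p : List (Literal n))
    (l : Literal n), p.length ≤ N → p.head? = some l → (p ++ [neg l]).IsChain r →
    ∃ q : List (Literal n), (q.map Prod.fst).Nodup ∧ ∃ l' ∈ q, (q ++ [neg l']).IsChain r := by
  induction N with
  | zero =>
    intro p l hp hl _
    rw [List.length_eq_zero_iff.1 (Nat.le_zero.1 hp)] at hl
    simp at hl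
  | succ N ih =>
    intro p l hp hl hch
    by_cases hnd : (p.map Prod.fst).Nodup
    · exact ⟨p, hnd, l, List.mem_of_mem_head? hl, hch⟩
    · obtain ⟨A, a, B, b, C, rfl, hab⟩ := exists_split_of_not_nodup _ hnd
      simp only [List.length_append, List.length_cons] at hp
      simp only [List.append_assoc, List.cons_append] at hch
      obtain ⟨h1, h2⟩ := List.isChain_split.1 hch
      rcases eq_or_eq_neg hab with rfl | rfl
      -- cut out the loop between two occurrences of a literal
      · refine ih (A ++ a :: C) l (by simp only [List.length_append, List.length_cons]; omega) ?_ ?_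
        · cases A <;> simpa using hl
        · rw [List.append_assoc, List.cons_append]
          refine List.isChain_split.2 ⟨h1, ?_⟩
          rw [← List.cons_append] at h2
          exact (List.isChain_split.1 h2).2
      -- keep the part of the walk between a literal and its negation
      · refine ih (neg b :: B) (neg b) (by simp only [List.length_cons]; omega) rfl ?_
        rw [neg_neg_literal]
        rw [← List.cons_append] at h2
        exact (List.isChain_split.1 h2).1

/-- A path `q` with distinct variables together with an implication that leads from its end to the
negation of a literal on the path and an implication that leads to its beginning from a literal
over a variable of the path. -/
def IsBicycle (ω : Config n) (q : List (Literal n)) (u l : Literal n) : Prop :=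
  (q.map Prod.fst).Nodup ∧ l ∈ q ∧ u.1 ∈ q.map Prod.fst ∧ (u :: (q ++ [neg l])).IsChain (Implies ω)

/-- Extend a path from a literal to its negation backwards within a strongly connected component for
as long as possible. -/
lemma exists_bicycle (h : ¬ ∃ σ, SatOn ω Finset.univ σ) : ∃ q u l, IsBicycle ω q u l := by
  obtain ⟨x, hx1, hx2⟩ : ∃ l, Relation.ReflTransGen (Implies ω) l (neg l) ∧
      Relation.ReflTransGen (Implies ω) (neg l) l := by
    by_contra hc
    push Not at hc
    exact h (exists_satOn fun l hl => hc l hl.1 hl.2)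
  set Z : Set (Literal n) := {l | Relation.ReflTransGen (Implies ω) x l ∧
    Relation.ReflTransGen (Implies ω) l x} with hZ
  let r : Literal n → Literal n → Prop := fun a b => Implies ω a b ∧ a ∈ Z ∧ b ∈ Z
  have hr : Relation.ReflTransGen r x (neg x) := by
    have : ∀ c, Relation.ReflTransGen (Implies ω) c (neg x) →
        Relation.ReflTransGen (Implies ω) x c → Relation.ReflTransGen r c (neg x) := by
      intro c hc
      induction hc using Relation.ReflTransGen.head_induction_on with
      | refl => intro _; exact .refl
      | head hcd hd ih =>
        intro hxc
        exact Relation.ReflTransGen.head ⟨hcd, ⟨hxc, (Relation.ReflTransGen.head hcd hd).trans hx2⟩,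
          hxc.tail hcd, hd.trans hx2⟩ (ih (hxc.tail hcd))
    exact this x hx1 .refl
  obtain ⟨p, hp, hlast⟩ := List.exists_isChain_cons_of_relationReflTransGen hr
  have hpne : p ≠ [] := by
    rintro rfl
    simp only [List.getLast_singleton] at hlast
    exact neg_ne x hlast.symm
  rw [List.getLast_cons hpne] at hlast
  rw [← List.dropLast_append_getLast hpne, hlast] at hp
  obtain ⟨q₀, hq₀, l₀, hl₀, hch₀⟩ := exists_path_of_walk (r := r) _ (x :: p.dropLast) x
    le_rfl rfl hp
  -- a longest path
  let Q : ℕ → Prop := fun k => ∃ q : List (Literal n), q.length = k ∧ (q.map Prod.fst).Nodup ∧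
    ∃ l ∈ q, (q ++ [neg l]).IsChain r
  have hbound : ∀ q : List (Literal n), (q.map Prod.fst).Nodup → q.length ≤ n := by
    intro q hq
    have := hq.length_le_card
    simpa using this
  classical
  have hQ : Q (Nat.findGreatest Q n) :=
    Nat.findGreatest_spec (hbound q₀ hq₀) ⟨q₀, rfl, hq₀, l₀, hl₀, hch₀⟩
  obtain ⟨q, hlen, hnd, l, hl, hch⟩ := hQ
  obtain ⟨a, t, rfl⟩ : ∃ a t, q = a :: t := by
    cases q with
    | nil => simp at hl
    | cons a t => exact ⟨a, t, rfl⟩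
  have haZ : a ∈ Z := by
    obtain ⟨b, t', hb⟩ : ∃ b t', t ++ [neg l] = b :: t' := by
      cases t with
      | nil => exact ⟨_, _, rfl⟩
      | cons b t => exact ⟨b, _, rfl⟩
    rw [List.cons_append, hb, List.isChain_cons_cons] at hch
    exact hch.1.2.1
  -- the first literal of the path has a predecessor in the component
  obtain ⟨u, hu⟩ : ∃ u, r u a := by
    obtain ⟨y, hya, hxy, hy⟩ : ∃ y, a ≠ y ∧ Relation.ReflTransGen (Implies ω) x y ∧
        Relation.ReflTransGen (Implies ω) y a := by
      by_cases hax : a = x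
      · exact ⟨neg x, by rw [hax]; exact (neg_ne x).symm, hx1, hx2.trans haZ.1⟩
      · exact ⟨x, hax, .refl, haZ.1⟩
    rcases Relation.ReflTransGen.cases_tail hy with h' | ⟨c, hyc, hca⟩
    · exact absurd h' hya
    · exact ⟨c, hca, ⟨hxy.trans hyc, Relation.ReflTransGen.head hca haZ.2⟩, haZ⟩
  -- its variable lies on the path, which could be extended otherwise
  have huq : u.1 ∈ (a :: t).map Prod.fst := by
    by_contra hu'
    have hnd' : ((u :: a :: t).map Prod.fst).Nodup := by
      rw [List.map_cons, List.nodup_cons]; exact ⟨hu', hnd⟩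
    have : Q ((a :: t).length + 1) := ⟨u :: a :: t, rfl, hnd', l, List.mem_cons_of_mem _ hl, by
      rw [List.cons_append, List.cons_append, List.isChain_cons_cons]
      exact ⟨hu, hch⟩⟩
    have hlt : (a :: t).length + 1 ≤ Nat.findGreatest Q n :=
      Nat.le_findGreatest (hbound _ hnd') this
    omega
  refine ⟨a :: t, u, l, hnd, hl, huq, ?_⟩
  rw [List.cons_append, List.isChain_cons_cons]
  exact ⟨hu.1, hch.imp fun _ _ h => h.1⟩

/-! ### The clauses of a bicycle -/

/-- The clauses behind the implications along the path `q` and from its end to `v`. -/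
def pathClauses (q : List (Literal n)) (v : Literal n) : List (Literal n × Literal n) :=
  List.zip (q.map neg) (q.tail ++ [v])

lemma mem_pathClauses {q : List (Literal n)} {v : Literal n} {c : Literal n × Literal n}
    (h : c ∈ pathClauses q v) : (∃ a ∈ q, c.1 = neg a) ∧ (c.2 ∈ q.tail ∨ c.2 = v) := by
  obtain ⟨h1, h2⟩ := List.of_mem_zip (show (c.1, c.2) ∈ _ from h)
  obtain ⟨a, ha, hac⟩ := List.mem_map.1 h1
  refine ⟨⟨a, ha, hac.symm⟩, ?_⟩
  simpa using h2

lemma length_pathClauses {q : List (Literal n)} (h : q ≠ []) (v : Literal n) :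
    (pathClauses q v).length = q.length := by
  have := List.length_pos_of_ne_nil h
  simp only [pathClauses, List.length_zip, List.length_map, List.length_append, List.length_tail,
    List.length_singleton]
  omega

lemma mult_pathClauses {v : Literal n} {q : List (Literal n)}
    (h : (q ++ [v]).IsChain (Implies ω)) : ∀ c ∈ pathClauses q v, mult ω c.1 c.2 ≠ 0 := by
  induction q with
  | nil => simp [pathClauses]
  | cons a q ih =>
    cases q with
    | nil =>
      simp only [List.singleton_append, List.isChain_cons_cons] at h
      simpa [pathClauses] using h.1.2
    | cons b q =>
      rw [List.cons_append, List.cons_append, List.isChain_cons_cons] at h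
      intro c hc
      have hc' : c ∈ (neg a, b) :: pathClauses (b :: q) v := hc
      rcases List.mem_cons.1 hc' with rfl | hc'
      · exact h.1.2
      · exact ih h.2 c hc'

lemma eq_of_nodup {q : List (Literal n)} (hq : (q.map Prod.fst).Nodup) {a b : Literal n}
    (ha : a ∈ q) (hb : b ∈ q) (h : a.1 = b.1) : a = b :=
  List.inj_on_of_nodup_map hq ha hb h

lemma nodup_pathClauses {v : Literal n} {q : List (Literal n)} (hq : (q.map Prod.fst).Nodup) :
    ((pathClauses q v).map (Function.uncurry Sym2.mk)).Nodup := by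
  induction q with
  | nil => simp [pathClauses]
  | cons a q ih =>
    cases q with
    | nil => simp [pathClauses]
    | cons b q =>
      have hq' := hq
      rw [List.map_cons, List.nodup_cons] at hq'
      have : pathClauses (a :: b :: q) v = (neg a, b) :: pathClauses (b :: q) v := rfl
      rw [this, List.map_cons, List.nodup_cons]
      refine ⟨fun hmem => ?_, ih hq'.2⟩
      obtain ⟨c, hc, hcs⟩ := List.mem_map.1 hmem
      obtain ⟨⟨d, hd, hcd⟩, -⟩ := mem_pathClauses hc
      simp only [Function.uncurry, hcd, Sym2.eq_iff] at hcs
      rcases hcs with ⟨h1, -⟩ | ⟨h1, -⟩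
      · rw [neg_injective h1] at hd
        exact hq'.1 (List.mem_map_of_mem hd)
      · have : d = b := eq_of_nodup hq'.2 hd List.mem_cons_self (congrArg Prod.fst h1 : _)
        exact neg_ne b (this ▸ h1)

/-- All clauses of a bicycle. -/
def bicycleClauses (q : List (Literal n)) (u l : Literal n) : List (Literal n × Literal n) :=
  (q.head?.map fun a => (neg u, a)).toList ++ pathClauses q (neg l)

lemma bicycleClauses_cons (a : Literal n) (t : List (Literal n)) (u l : Literal n) :
    bicycleClauses (a :: t) u l = (neg u, a) :: pathClauses (a :: t) (neg l) := rfl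

/-- The clause `{neg u, a}` that enters the path at its first literal `a` is not a clause of the
path itself: in the latter, `a` occurs only negated. -/
lemma nodup_bicycleClauses {q : List (Literal n)} {u l : Literal n} (hq : (q.map Prod.fst).Nodup)
    (hl : l ∈ q) : ((bicycleClauses q u l).map (Function.uncurry Sym2.mk)).Nodup := by
  cases q with
  | nil => simp at hl
  | cons a t =>
    rw [bicycleClauses_cons, List.map_cons, List.nodup_cons]
    refine ⟨fun hmem => ?_, nodup_pathClauses hq⟩
    obtain ⟨c, hc, hcs⟩ := List.mem_map.1 hmem
    obtain ⟨⟨d, hd, hcd⟩, hc2⟩ := mem_pathClauses hc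
    simp only [Function.uncurry, hcd, Sym2.eq_iff] at hcs
    rcases hcs with ⟨-, h1⟩ | ⟨h1, -⟩
    · rw [h1] at hc2
      rcases hc2 with h2 | h2
      · rw [List.map_cons, List.nodup_cons] at hq
        exact hq.1 (List.mem_map_of_mem h2)
      · have : a = l := eq_of_nodup hq List.mem_cons_self hl (congrArg Prod.fst h2 : _)
        exact neg_ne l (this ▸ h2).symm
    · have : d = a := eq_of_nodup hq hd List.mem_cons_self (congrArg Prod.fst h1 : _)
      exact neg_ne a (this ▸ h1)

lemma length_bicycleClauses {q : List (Literal n)} (h : q ≠ []) (u l : Literal n) :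
    (bicycleClauses q u l).length = q.length + 1 := by
  cases q with
  | nil => exact absurd rfl h
  | cons a t => rw [bicycleClauses_cons, List.length_cons, length_pathClauses h]

lemma IsBicycle.mult_ne_zero {q : List (Literal n)} {u l : Literal n} (h : IsBicycle ω q u l) :
    ∀ c ∈ bicycleClauses q u l, mult ω c.1 c.2 ≠ 0 := by
  obtain ⟨-, hl, -, hch⟩ := h
  cases q with
  | nil => simp at hl
  | cons a t =>
    rw [List.cons_append, List.isChain_cons_cons] at hch
    intro c hc
    rw [bicycleClauses_cons] at hc
    rcases List.mem_cons.1 hc with rfl | hc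
    · exact hch.1.2
    · exact mult_pathClauses hch.2 c hc

end implication

/-! ### Satisfiability with high probability -/

section satisfiability
variable {n : ℕ} {lam : ℝ≥0}

lemma measureReal_mult_ne_zero (a b : Literal n) :
    (configLaw n lam).real {ω | mult ω a b ≠ 0} ≤ 2 * lam := by
  have hsub : {ω : Config n | mult ω a b ≠ 0} ⊆ {ω | ω (a, b) ≠ 0} ∪ {ω | ω (b, a) ≠ 0} := by
    intro ω hω
    by_contra hc
    simp only [Set.mem_union, Set.mem_ofPred_eq, not_or, not_not] at hc
    exact hω (by unfold mult; omega)
  refine (measureReal_mono hsub (measure_ne_top _ _)).trans ((measureReal_union_le _ _).trans ?_)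
  linarith [measureReal_coord_ne_zero (lam := lam) (a, b),
    measureReal_coord_ne_zero (lam := lam) (b, a)]

/-- Distinct unordered clauses are present independently. -/
lemma measureReal_forall_mult_ne_zero (L : List (Literal n × Literal n))
    (hL : (L.map (Function.uncurry Sym2.mk)).Nodup) :
    (configLaw n lam).real {ω | ∀ c ∈ L, mult ω c.1 c.2 ≠ 0} ≤ (2 * lam : ℝ) ^ L.length := by
  induction L with
  | nil => simp
  | cons c L ih =>
    rw [List.map_cons, List.nodup_cons] at hL
    have hset : {ω : Config n | ∀ c' ∈ c :: L, mult ω c'.1 c'.2 ≠ 0} =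
        {ω | mult ω c.1 c.2 ≠ 0} ∩ {ω | ∀ c' ∈ L, mult ω c'.1 c'.2 ≠ 0} := by
      ext ω; simp
    rw [hset, measureReal_inter_eq_mul _ {c, c.swap} {ω | mult ω c.1 c.2 ≠ 0}
      {ω | ∀ c' ∈ L, mult ω c'.1 c'.2 ≠ 0}, List.length_cons, pow_succ']
    · exact mul_le_mul (measureReal_mult_ne_zero _ _) (ih hL.2) measureReal_nonneg (by positivity)
    · intro ω ω' h
      have h1 : ω (c.1, c.2) = ω' (c.1, c.2) := h c (by simp)
      have h2 : ω (c.2, c.1) = ω' (c.2, c.1) := h c.swap (by simp)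
      simp only [Set.mem_ofPred_eq, mult, h1, h2]
    · intro ω ω' h
      refine forall_congr' fun c' => imp_congr_right fun hc' => ?_
      have hne : ∀ d : Literal n × Literal n, Function.uncurry Sym2.mk d =
          Function.uncurry Sym2.mk c' → d ∉ ({c, c.swap} : Set _) := by
        rintro d hd (rfl | hd')
        · exact hL.1 (hd ▸ List.mem_map_of_mem hc')
        · rw [hd'] at hd
          refine hL.1 ?_
          rw [show Function.uncurry Sym2.mk c = Function.uncurry Sym2.mk c' by
            rw [← hd]; exact Sym2.eq_swap]
          exact List.mem_map_of_mem hc'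
      unfold mult
      rw [h (c'.1, c'.2) (hne _ rfl), h (c'.2, c'.1) (hne _ Sym2.eq_swap)]

lemma measureReal_isBicycle (q : List (Literal n)) (u l : Literal n) :
    (configLaw n lam).real {ω | IsBicycle ω q u l} ≤ (2 * lam : ℝ) ^ (q.length + 1) := by
  by_cases h : (q.map Prod.fst).Nodup ∧ l ∈ q
  · have hne : q ≠ [] := List.ne_nil_of_mem h.2
    rw [← length_bicycleClauses hne u l]
    exact (measureReal_mono (fun ω hω => IsBicycle.mult_ne_zero hω) (measure_ne_top _ _)).trans
      (measureReal_forall_mult_ne_zero _ (nodup_bicycleClauses h.1 h.2))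
  · have : {ω : Config n | IsBicycle ω q u l} = ∅ := by
      ext ω
      simp only [Set.mem_ofPred_eq, Set.mem_empty_iff_false, iff_false]
      exact fun h' => h ⟨h'.1, h'.2.1⟩
    rw [this]
    simp only [measureReal_empty]
    positivity

/-- The first moment bound on the number of bicycles. A bicycle on `m` variables is determined by
`m` literals, the positions of the variables of `u` and `l` among them, and the sign of `u`, and it
contains `m + 1` clauses. -/
lemma measureReal_unsat_le (n : ℕ) (lam : ℝ≥0) :
    (configLaw n lam).real {ω | ¬ ∃ σ, SatOn ω Finset.univ σ} ≤
      4 * lam * ∑ m ∈ Finset.range (n + 1), (m : ℝ) ^ 2 * (4 * n * lam) ^ m := by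
  have hsub : {ω : Config n | ¬ ∃ σ, SatOn ω Finset.univ σ} ⊆ ⋃ m ∈ Finset.range (n + 1),
      ⋃ p ∈ (Finset.univ : Finset ((Fin m → Literal n) × Fin m × Fin m × Bool)),
        {ω | IsBicycle ω (List.ofFn p.1) ((p.1 p.2.1).1, p.2.2.2) (p.1 p.2.2.1)} := by
    intro ω hω
    obtain ⟨q, u, l, h⟩ := exists_bicycle hω
    obtain ⟨hnd, hl, hu, -⟩ := id h
    obtain ⟨j, rfl⟩ := List.get_of_mem hl
    obtain ⟨u', hu', huu⟩ := List.mem_map.1 hu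
    obtain ⟨i, rfl⟩ := List.get_of_mem hu'
    have hlen : q.length ≤ n := by simpa using hnd.length_le_card
    simp only [Set.mem_iUnion]
    refine ⟨q.length, Finset.mem_range.2 (by omega), (q.get, i, j, u.2), Finset.mem_univ _, ?_⟩
    show IsBicycle ω (List.ofFn q.get) ((q.get i).1, u.2) (q.get j)
    rw [List.ofFn_get, huu]
    exact h
  refine (measureReal_mono hsub (measure_ne_top _ _)).trans
    ((measureReal_biUnion_finset_le _ _).trans ?_)
  rw [Finset.mul_sum]
  refine Finset.sum_le_sum fun m _ => (measureReal_biUnion_finset_le _ _).trans ?_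
  refine (Finset.sum_le_sum (g := fun _ => (2 * lam : ℝ) ^ (m + 1)) fun p _ => ?_).trans
    (le_of_eq ?_)
  · simpa using measureReal_isBicycle (lam := lam) (List.ofFn p.1) ((p.1 p.2.1).1, p.2.2.2)
      (p.1 p.2.2.1)
  · rw [Finset.sum_const, nsmul_eq_mul, Finset.card_univ]
    simp only [Fintype.card_prod, Fintype.card_fun, Fintype.card_fin, Fintype.card_bool]
    push_cast
    rw [show (4 * n * lam : ℝ) = (n * 2) * (2 * lam) by ring,
      mul_pow ((n : ℝ) * 2) (2 * lam), pow_succ]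
    ring

/-- The bound of `measureReal_unsat_le` is `4 * lam` times a partial sum of a convergent series,
because `4 * n * lam` tends to `r < 1`. -/
lemma tendsto_unsat {r : ℝ} (hr : r < 1) {lam : ℕ → ℝ≥0}
    (h : Grow r atTop (fun n => n) lam fun _ => Finset.univ) :
    Tendsto (fun n => (configLaw n (lam n)).real {ω | ¬ ∃ σ, SatOn ω Finset.univ σ}) atTop
      (𝓝 0) := by
  obtain ⟨ρ, hrρ, hρ⟩ := exists_between hr
  have hρ0 : 0 ≤ max ρ 0 := le_max_right _ _
  have hρ1 : max ρ 0 < 1 := max_lt hρ one_pos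
  have hsum : Summable fun m : ℕ => (m : ℝ) ^ 2 * (max ρ 0) ^ m :=
    summable_pow_mul_geometric_of_norm_lt_one 2 (by rwa [Real.norm_of_nonneg hρ0])
  have hlim := (h.tendsto_lam.const_mul 4).mul_const (∑' m : ℕ, (m : ℝ) ^ 2 * (max ρ 0) ^ m)
  rw [mul_zero, zero_mul] at hlim
  refine tendsto_of_tendsto_of_tendsto_of_le_of_le' tendsto_const_nhds hlim
    (Eventually.of_forall fun n => measureReal_nonneg) ?_
  filter_upwards [h.2.eventually_lt_const hrρ] with n hn
  simp only [Finset.card_univ, Fintype.card_fin] at hn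
  refine (measureReal_unsat_le n (lam n)).trans ?_
  refine mul_le_mul_of_nonneg_left ?_ (by positivity)
  refine (Finset.sum_le_sum fun m _ => ?_).trans (hsum.sum_le_tsum _ fun m _ => by positivity)
  exact mul_le_mul_of_nonneg_left (pow_le_pow_left₀ (by positivity)
    (hn.le.trans (le_max_left _ _)) _)
    (by positivity)

end satisfiability

/-! ### Poisson clause counts of the random formula -/

section counts
variable {n : ℕ}

lemma card_clause (n : ℕ) : Fintype.card (Clause n) = 4 * n * (n - 1) := by
  have h1 : Fintype.card {c : Literal n × Literal n // c.1.1 = c.2.1} = 4 * n := by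
    rw [Fintype.card_congr (β := Fin n × Bool × Bool)
      ⟨fun c => (c.1.1.1, c.1.1.2, c.1.2.2), fun q => ⟨((q.1, q.2.1), (q.1, q.2.2)), rfl⟩,
        fun ⟨⟨⟨a, s⟩, b, t⟩, h⟩ => by simp only at h; subst h; rfl, fun _ => rfl⟩]
    simp only [Fintype.card_prod, Fintype.card_fin, Fintype.card_bool]
    ring
  rw [Fintype.card_subtype_compl fun c : Literal n × Literal n => c.1.1 = c.2.1, h1]
  simp only [Fintype.card_prod, Fintype.card_fin, Fintype.card_bool]
  rw [Nat.mul_sub, mul_one]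
  congr 1
  ring

lemma nonempty_clause (hn : 2 ≤ n) : Nonempty (Clause n) :=
  ⟨⟨((⟨0, by omega⟩, true), (⟨1, by omega⟩, true)), by simp⟩⟩

lemma measurableSet_formula (s : Set (Formula n)) : MeasurableSet s :=
  MeasurableSpace.measurableSet_iInf.2 fun m =>
    show MeasurableSet (Sigma.mk m ⁻¹' s) from (Set.toFinite _).measurableSet

lemma measurable_formula {X : Type*} [MeasurableSpace X] (f : Formula n → X) : Measurable f :=
  fun _ _ => measurableSet_formula _

/-- The multiplicities of the clauses of a formula. -/
def clauseCount (Φ : Formula n) (c : Clause n) : ℕ :=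
  (Finset.univ.filter fun j => Φ.2 j = c).card

/-- The mean multiplicity of a clause in the random formula. -/
def clauseRate (d : ℝ) (n : ℕ) : ℝ≥0 := (d * n / 2).toNNReal / Fintype.card (Clause n)

lemma formulaLaw_map_clauseCount (d : ℝ) (hn : 2 ≤ n) :
    (formulaLaw d n).map clauseCount
      = Measure.pi fun _ : Clause n => poissonMeasure (clauseRate d n) := by
  have := nonempty_clause hn
  unfold clauseRate
  rw [← poisson_bind_count]
  refine Measure.ext fun s hs => ?_
  rw [Measure.map_apply (measurable_formula _) hs, formulaLaw,
    Measure.bind_apply (measurableSet_formula _) (Measurable.of_discrete).aemeasurable,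
    Measure.bind_apply hs (Measurable.of_discrete).aemeasurable]
  refine lintegral_congr fun m => ?_
  rw [Measure.map_apply (measurable_of_finite _) (measurableSet_formula _),
    Measure.map_apply (measurable_of_finite _) hs]
  rfl

lemma configLaw_map_clause (lam : ℝ≥0) :
    (configLaw n lam).map (fun ω (c : Clause n) => ω c)
      = Measure.pi fun _ : Clause n => poissonMeasure lam := by
  symm
  refine Measure.pi_eq fun s hs => ?_
  rw [Measure.map_apply (measurable_of_countable _) (MeasurableSet.univ_pi hs)]
  have : (fun (ω : Config n) (c : Clause n) => ω c) ⁻¹' Set.univ.pi s = Set.univ.pi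
      fun p => if h : p.1.1 ≠ p.2.1 then s ⟨p, h⟩ else Set.univ := by
    ext ω
    simp only [Set.mem_preimage, Set.mem_univ_pi]
    constructor
    · intro h p
      split_ifs with hp
      · exact h ⟨p, hp⟩
      · trivial
    · rintro h ⟨p, hp⟩
      have := h p
      rwa [dif_pos hp] at this
  rw [this, Measure.pi_pi]
  rw [← Fintype.prod_subtype_mul_prod_subtype (fun p : Literal n × Literal n => p.1.1 ≠ p.2.1)]
  have h1 : ∏ p : {p : Literal n × Literal n // ¬ p.1.1 ≠ p.2.1}, (poissonMeasure lam)
      (if h : p.1.1.1 ≠ p.1.2.1 then s ⟨p.1, h⟩ else Set.univ) = 1 :=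
    Finset.prod_eq_one fun p _ => by rw [dif_neg p.2, measure_univ]
  rw [h1, mul_one]
  exact Finset.prod_congr rfl fun p _ => by rw [dif_pos p.2]

lemma solutions_eq (Φ : Formula n) :
    solutions Φ = {σ | ∀ c : Clause n, clauseCount Φ c ≠ 0 → c.Sat σ} := by
  ext σ
  constructor
  · intro h c hc
    obtain ⟨j, hj⟩ := Finset.card_ne_zero.1 hc
    rw [← (Finset.mem_filter.1 hj).2]
    exact h j
  · intro h j
    exact h _ (Finset.card_ne_zero.2 ⟨j, Finset.mem_filter.2 ⟨Finset.mem_univ _, rfl⟩⟩)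

lemma setOf_satOn_eq (ω : Config n) :
    {σ | SatOn ω Finset.univ σ} = {σ | ∀ c : Clause n, ω c ≠ 0 → c.Sat σ} := by
  ext σ
  constructor
  · intro h c hc
    have hc' : ω (c.1.1, c.1.2) ≠ 0 := hc
    exact h c.1.1 c.1.2 (Finset.mem_univ _) (Finset.mem_univ _) c.2 (by unfold mult; omega)
  · intro h a b _ _ hab hm
    by_cases h0 : ω (a, b) = 0
    · refine (h ⟨(b, a), hab.symm⟩ ?_).symm
      unfold mult at hm
      show ω (b, a) ≠ 0
      omega
    · exact h ⟨(a, b), hab⟩ h0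

/-- Functions of the solution set may be averaged over independent Poisson multiplicities. -/
lemma integral_formulaLaw (d : ℝ) (hn : 2 ≤ n) (F : Set (Assignment n) → ℝ) :
    ∫ Φ, F (solutions Φ) ∂formulaLaw d n
      = ∫ ω, F {σ | SatOn ω Finset.univ σ} ∂configLaw n (clauseRate d n) := by
  let G : (Clause n → ℕ) → ℝ := fun k => F {σ | ∀ c : Clause n, k c ≠ 0 → c.Sat σ}
  have hG : Measurable G := measurable_of_countable _
  calc ∫ Φ, F (solutions Φ) ∂formulaLaw d n
      = ∫ Φ, G (clauseCount Φ) ∂formulaLaw d n := by simp only [G, solutions_eq]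
    _ = ∫ k, G k ∂(Measure.pi fun _ : Clause n => poissonMeasure (clauseRate d n)) := by
        rw [← formulaLaw_map_clauseCount d hn,
          integral_map (measurable_formula _).aemeasurable hG.aestronglyMeasurable]
    _ = ∫ ω, F {σ | SatOn ω Finset.univ σ} ∂configLaw n (clauseRate d n) := by
        rw [← configLaw_map_clause, integral_map (measurable_of_countable _).aemeasurable
          hG.aestronglyMeasurable]
        simp only [G, setOf_satOn_eq]

end counts

lemma grow_clauseRate {d : ℝ} (hd : 0 < d) :
    Grow ((d / 2).toNNReal : ℝ) atTop (fun n => n) (clauseRate d) fun _ => Finset.univ := by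
  simp only [Grow, Finset.card_univ, Fintype.card_fin]
  refine ⟨tendsto_natCast_atTop_atTop, ?_⟩
  rw [Real.coe_toNNReal _ (by positivity)]
  have h := (tendsto_natCast_div_add_atTop (-1 : ℝ)).const_mul (d / 2)
  rw [mul_one] at h
  refine h.congr' ?_
  filter_upwards [eventually_ge_atTop 2] with n hn
  have h1 : (1 : ℝ) ≤ n := by exact_mod_cast (by omega : 1 ≤ n)
  have h2 : (n : ℝ) + -1 ≠ 0 := by
    have : (2 : ℝ) ≤ n := by exact_mod_cast hn
    linarith
  rw [clauseRate, card_clause, NNReal.coe_div, Real.coe_toNNReal _ (by positivity)]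
  rw [NNReal.coe_natCast, Nat.cast_mul, Nat.cast_mul, Nat.cast_sub (show 1 ≤ n by omega)]
  push_cast
  have h3 : (n : ℝ) - 1 ≠ 0 := by rwa [sub_eq_add_neg]
  have h4 : (n : ℝ) ≠ 0 := by positivity
  rw [← sub_eq_add_neg]
  field_simp

/-! ### Approximation of marginals by messages -/

/-- Uniform continuity in the form of an affine bound. -/
lemma exists_modulus (f : C(unitInterval, ℝ)) {ε : ℝ} (hε : 0 < ε) :
    ∃ K, 0 ≤ K ∧ ∀ u v : unitInterval, |f u - f v| ≤ ε + K * |(u : ℝ) - v| := by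
  obtain ⟨δ, hδ, h⟩ := Metric.uniformContinuous_iff.1
    (CompactSpace.uniformContinuous_of_continuous f.continuous) ε hε
  refine ⟨2 * ‖f‖ / δ, by positivity, fun u v => ?_⟩
  by_cases huv : |(u : ℝ) - v| < δ
  · have := h (a := u) (b := v) huv
    rw [Real.dist_eq] at this
    have h2 : 0 ≤ 2 * ‖f‖ / δ * |(u : ℝ) - v| := by positivity
    linarith
  · have h1 : |f u - f v| ≤ 2 * ‖f‖ := by
      have hu := f.norm_coe_le_norm u
      have hv := f.norm_coe_le_norm v
      rw [Real.norm_eq_abs] at hu hv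
      linarith [abs_sub (f u) (f v)]
    have h2 : 2 * ‖f‖ ≤ 2 * ‖f‖ / δ * |(u : ℝ) - v| := by
      rw [div_mul_eq_mul_div, le_div_iff₀ hδ]
      exact mul_le_mul_of_nonneg_left (not_lt.1 huv) (by positivity)
    linarith

/-- The distance between the two bounds in a message. -/
def gap : C(Msg, ℝ) := ⟨fun u => (u.2 : ℝ) - u.1, by fun_prop⟩

/-- A test function, evaluated at the lower bound of a message. -/
def evalFst (f : C(unitInterval, ℝ)) : C(Msg, ℝ) := ⟨fun u => f u.1, by fun_prop⟩

/-- The average of a function of the messages of depth `ℓ`. -/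
def average {n : ℕ} (F : C(Msg, ℝ)) (u : Msg) (ω : Config n) (ℓ : ℕ) : ℝ :=
  (∑ x, F (msg u ω ℓ Finset.univ x)) / n

lemma bddMeas_average {n : ℕ} (F : C(Msg, ℝ)) (u : Msg) (ℓ : ℕ) :
    BddMeas fun ω : Config n => average F u ω ℓ := by
  refine ⟨measurable_of_countable _, (∑ _x : Fin n, ‖F‖) / n, fun ω => ?_⟩
  unfold average
  rw [abs_div, Nat.abs_cast]
  gcongr
  refine (Finset.abs_sum_le_sum_abs _ _).trans (Finset.sum_le_sum fun x _ => F.norm_coe_le_norm _)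

/-- The integral of a test function against the marginals of a uniformly random element of `T`. It
depends on a formula through its solution set only, and for `T = solutions Φ` it is the integral
against `empiricalMarginals κ Φ` by definition. -/
def marginalIntegral {n : ℕ} (κ : Measure unitInterval) (f : C(unitInterval, ℝ))
    (T : Set (Assignment n)) : ℝ :=
  open Classical in
  ∫ z, f z ∂(if T.Nonempty then (n : ℝ≥0∞)⁻¹ • ∑ i : Fin n, Measure.dirac
    (⟨(uniformOn T).real {σ | σ i = true}, measureReal_nonneg, by
      unfold uniformOn; exact measureReal_le_one⟩ : unitInterval) else κ)

lemma abs_marginalIntegral_le {n : ℕ} (hn : 0 < n) (κ : Measure unitInterval)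
    [IsProbabilityMeasure κ] (f : C(unitInterval, ℝ)) (T : Set (Assignment n)) :
    |marginalIntegral κ f T| ≤ ‖f‖ := by
  unfold marginalIntegral
  split_ifs
  · rw [integral_smul_measure, integral_finsetSum_measure fun i _ =>
      (bddMeas_of_continuous f).integrable _]
    simp_rw [integral_dirac]
    have hn' : (0 : ℝ) < n := by exact_mod_cast hn
    rw [ENNReal.toReal_inv, ENNReal.toReal_natCast, smul_eq_mul, abs_mul, abs_inv, Nat.abs_cast,
      inv_mul_le_iff₀ hn']
    refine (Finset.abs_sum_le_sum_abs _ _).trans ((Finset.sum_le_sum fun i _ =>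
      f.norm_coe_le_norm _).trans (le_of_eq (by simp)))
  · exact abs_integral_le_of_bound f.norm_coe_le_norm

lemma measureReal_uniformOn_eq {n : ℕ} (ω : Config n) (i : Fin n) :
    (uniformOn {σ | SatOn ω Finset.univ σ}).real {σ | σ i = true}
      = (satCount ω Finset.univ fun σ => True ∧ σ i = true)
        / satCount ω Finset.univ fun _ => True := by
  classical
  have hT : ({σ | SatOn ω Finset.univ σ} : Set (Assignment n)).Finite := Set.toFinite _
  have hc : ∀ s : Set (Assignment n), Measure.count s = (s.ncard : ℝ≥0∞) := fun s => by
    rw [Measure.count_apply (Set.toFinite s).measurableSet, ← Set.Finite.cast_ncard_eq s.toFinite]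
    rfl
  rw [uniformOn, measureReal_def, cond_apply hT.measurableSet, hc, hc, ENNReal.toReal_mul,
    ENNReal.toReal_inv, ENNReal.toReal_natCast, ENNReal.toReal_natCast]
  rw [div_eq_inv_mul]
  congr 2
  · unfold satCount
    rw [← Set.ncard_coe_finset]
    congr 2
    ext σ; simp
  · unfold satCount
    rw [← Set.ncard_coe_finset]
    congr 2
    ext σ; simp

lemma abs_sub_le_gap {m m' : unitInterval} {M : Msg} (h1 : M.1 ≤ m) (h2 : m ≤ M.2)
    (h1' : M.1 ≤ m') (h2' : m' ≤ M.2) : |(m : ℝ) - m'| ≤ gap M := by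
  have a1 : (M.1 : ℝ) ≤ m := h1
  have a2 : (m : ℝ) ≤ M.2 := h2
  have a3 : (M.1 : ℝ) ≤ m' := h1'
  have a4 : (m' : ℝ) ≤ M.2 := h2'
  show _ ≤ (M.2 : ℝ) - M.1
  rw [abs_le]
  constructor <;> linarith

/-- On a satisfiable formula, at each variable whose neighbourhood is a tree, both the message
started from `halfMsg` and the marginal lie between the two bounds of the message started from
`trivialMsg`. -/
lemma abs_average_sub_marginalIntegral_le {n : ℕ} (hn : 0 < n) (κ : Measure unitInterval)
    [IsProbabilityMeasure κ] (f : C(unitInterval, ℝ)) {ε K : ℝ} (hε : 0 ≤ ε) (hK : 0 ≤ K)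
    (hf : ∀ u v : unitInterval, |f u - f v| ≤ ε + K * |(u : ℝ) - v|) (ω : Config n) (ℓ : ℕ) :
    |average (evalFst f) halfMsg ω ℓ - marginalIntegral κ f {σ | SatOn ω Finset.univ σ}| ≤
      (ε + K * average gap trivialMsg ω ℓ)
      + ((∑ x, {ω | ¬ Good ω ℓ Finset.univ x}.indicator (fun _ => 2 * ‖f‖) ω) / n
        + {ω | ¬ ∃ σ, SatOn ω Finset.univ σ}.indicator (fun _ => 2 * ‖f‖) ω) := by
  have hn' : (0 : ℝ) < n := by exact_mod_cast hn
  have hgap : ∀ x, 0 ≤ gap (msg trivialMsg ω ℓ Finset.univ x) := by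
    intro x
    obtain ⟨w1, w2⟩ := within_msg ω ℓ 0 Finset.univ x
    have hs := (isSharp_msg ω (ℓ + 0) Finset.univ x).1
    exact (abs_nonneg _).trans (abs_sub_le_gap w1 (hs ▸ w2) w1 (hs ▸ w2))
  have hind : ∀ x, 0 ≤ {ω : Config n | ¬ Good ω ℓ Finset.univ x}.indicator
      (fun _ => 2 * ‖f‖) ω := fun x => Set.indicator_nonneg (fun _ _ => by positivity) _
  have hdiff : ∀ u v, |f u - f v| ≤ 2 * ‖f‖ := by
    intro u v
    have hu := f.norm_coe_le_norm u
    have hv := f.norm_coe_le_norm v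
    rw [Real.norm_eq_abs] at hu hv
    linarith [abs_sub (f u) (f v)]
  by_cases hsat : ∃ σ, SatOn ω Finset.univ σ
  · have hne : ({σ | SatOn ω Finset.univ σ} : Set (Assignment n)).Nonempty := hsat
    rw [Set.indicator_of_notMem (by simpa using hsat), add_zero, marginalIntegral, if_pos hne,
      integral_smul_measure, integral_finsetSum_measure fun i _ =>
      (bddMeas_of_continuous f).integrable _]
    simp_rw [integral_dirac]
    rw [ENNReal.toReal_inv, ENNReal.toReal_natCast, smul_eq_mul, ← div_eq_inv_mul, average, average,
      ← sub_div, ← Finset.sum_sub_distrib, abs_div, Nat.abs_cast]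
    have : (ε + K * ((∑ x, gap (msg trivialMsg ω ℓ Finset.univ x)) / n)) +
        (∑ x, {ω : Config n | ¬ Good ω ℓ Finset.univ x}.indicator (fun _ => 2 * ‖f‖) ω) / n
        = (∑ x, (ε + K * gap (msg trivialMsg ω ℓ Finset.univ x) +
          {ω : Config n | ¬ Good ω ℓ Finset.univ x}.indicator (fun _ => 2 * ‖f‖) ω)) / n := by
      rw [Finset.sum_add_distrib, Finset.sum_add_distrib, ← Finset.mul_sum, Finset.sum_const,
        Finset.card_univ, Fintype.card_fin, nsmul_eq_mul]
      field_simp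
    rw [this]
    refine div_le_div_of_nonneg_right ((Finset.abs_sum_le_sum_abs _ _).trans
      (Finset.sum_le_sum fun x _ => ?_)) hn'.le
    by_cases hg : Good ω ℓ Finset.univ x
    · refine (hf _ _).trans ?_
      have hbr := brackets_msg ℓ (C := fun _ => True) (Finset.mem_univ x) hg
        (fun _ _ _ _ => Iff.rfl)
      obtain ⟨w1, w2⟩ := within_msg ω ℓ 0 Finset.univ x
      have hs := (isSharp_msg ω (ℓ + 0) Finset.univ x).1
      have hpos : (0 : ℝ) < satCount ω Finset.univ fun _ => True := by
        obtain ⟨σ, hσ⟩ := hsat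
        unfold satCount
        exact_mod_cast Finset.card_pos.2 ⟨σ, by simpa using hσ⟩
      have hle := abs_sub_le_gap (m := (msg halfMsg ω ℓ Finset.univ x).1)
        (m' := ⟨(uniformOn {σ | SatOn ω Finset.univ σ}).real {σ | σ x = true}, measureReal_nonneg,
          by unfold uniformOn; exact measureReal_le_one⟩) (M := msg trivialMsg ω ℓ Finset.univ x)
        w1 (hs ▸ w2)
        (by
          show (_ : ℝ) ≤ (uniformOn {σ | SatOn ω Finset.univ σ}).real {σ | σ x = true}
          rw [measureReal_uniformOn_eq, le_div_iff₀ hpos]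
          exact hbr.1)
        (by
          show (uniformOn {σ | SatOn ω Finset.univ σ}).real {σ | σ x = true} ≤ (_ : ℝ)
          rw [measureReal_uniformOn_eq, div_le_iff₀ hpos]
          exact hbr.2)
      have := mul_le_mul_of_nonneg_left hle hK
      have := hind x
      show ε + K * |((msg halfMsg ω ℓ Finset.univ x).1 : ℝ) -
        (uniformOn {σ | SatOn ω Finset.univ σ}).real {σ | σ x = true}| ≤ _
      linarith
    · rw [Set.indicator_of_mem (show ω ∈ {ω : Config n | ¬ Good ω ℓ Finset.univ x} from hg)]
      have := mul_nonneg hK (hgap x)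
      have := hdiff (msg halfMsg ω ℓ Finset.univ x).1
        ⟨(uniformOn {σ | SatOn ω Finset.univ σ}).real {σ | σ x = true}, measureReal_nonneg,
          by unfold uniformOn; exact measureReal_le_one⟩
      refine this.trans ?_
      linarith
  · rw [Set.indicator_of_mem (show ω ∈ {ω : Config n | ¬ ∃ σ, SatOn ω Finset.univ σ} from hsat)]
    have h1 : |average (evalFst f) halfMsg ω ℓ| ≤ ‖f‖ := by
      unfold average
      rw [abs_div, Nat.abs_cast, div_le_iff₀ hn']
      refine (Finset.abs_sum_le_sum_abs _ _).trans ((Finset.sum_le_sum fun i _ =>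
        f.norm_coe_le_norm _).trans (le_of_eq (by simp [mul_comm])))
    have h2 := abs_marginalIntegral_le hn κ f {σ | SatOn ω Finset.univ σ}
    have h3 : 0 ≤ average gap trivialMsg ω ℓ :=
      div_nonneg (Finset.sum_nonneg fun x _ => hgap x) hn'.le
    have h4 : 0 ≤ (∑ x, {ω : Config n | ¬ Good ω ℓ Finset.univ x}.indicator
        (fun _ => 2 * ‖f‖) ω) / n := div_nonneg (Finset.sum_nonneg fun x _ => hind x) hn'.le
    have h5 := mul_nonneg hK h3
    refine (abs_sub _ _).trans ?_
    linarith

/-- Messages of all depths at least `ℓ` lie between the bounds obtained at depth `ℓ`. -/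
lemma abs_average_sub_average_le {n : ℕ} (hn : 0 < n) (f : C(unitInterval, ℝ)) {ε K : ℝ}
    (hK : 0 ≤ K) (hf : ∀ u v : unitInterval, |f u - f v| ≤ ε + K * |(u : ℝ) - v|) (ω : Config n)
    (ℓ k : ℕ) : |average (evalFst f) halfMsg ω ℓ - average (evalFst f) halfMsg ω (ℓ + k)| ≤
      ε + K * average gap trivialMsg ω ℓ := by
  have hn' : (0 : ℝ) < n := by exact_mod_cast hn
  have : ε + K * ((∑ x, gap (msg trivialMsg ω ℓ Finset.univ x)) / n)
      = (∑ x, (ε + K * gap (msg trivialMsg ω ℓ Finset.univ x))) / n := by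
    rw [Finset.sum_add_distrib, ← Finset.mul_sum, Finset.sum_const,
      Finset.card_univ, Fintype.card_fin, nsmul_eq_mul]
    field_simp
  rw [average, average, average, this, ← sub_div, ← Finset.sum_sub_distrib, abs_div, Nat.abs_cast]
  refine div_le_div_of_nonneg_right ((Finset.abs_sum_le_sum_abs _ _).trans
    (Finset.sum_le_sum fun x _ => ?_)) hn'.le
  obtain ⟨w1, w2⟩ := within_msg ω ℓ 0 Finset.univ x
  obtain ⟨v1, v2⟩ := within_msg ω ℓ k Finset.univ x
  have hs := (isSharp_msg ω (ℓ + 0) Finset.univ x).1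
  have ht := (isSharp_msg ω (ℓ + k) Finset.univ x).1
  refine (hf _ _).trans ?_
  have := mul_le_mul_of_nonneg_left (abs_sub_le_gap w1 (hs ▸ w2) v1 (ht ▸ v2)) hK
  exact add_le_add le_rfl this

/-! ### Existence of the limit of the Belief Propagation iterates -/

section limit
variable {d : ℝ}

lemma toNNReal_half_lt_one (hd2 : d < 2) : (d / 2).toNNReal < 1 := by
  rw [Real.toNNReal_lt_one]; linarith

/-- The integral of a test function against the law of a message is the limit of the mean averages
over the random formula. -/
lemma tendsto_average_error (hd : 0 < d) {u : Msg} (hu : flip u = u) (hub : IsBound u) (ℓ : ℕ)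
    (F : C(Msg, ℝ)) :
    Tendsto (fun n => ∫ ω, |average F u ω ℓ - ∫ v, F v ∂msgLaw (d / 2).toNNReal u ℓ|
      ∂configLaw n (clauseRate d n)) atTop (𝓝 0) := by
  have := conv hu hub ℓ ℕ atTop _ _ _ (grow_clauseRate hd) F
  simpa only [average, Finset.card_univ, Fintype.card_fin] using this

lemma BddMeas.abs_sub_const {X : Type*} [MeasurableSpace X] {φ : X → ℝ} (h : BddMeas φ) (c : ℝ) :
    BddMeas fun x => |φ x - c| := by
  obtain ⟨h1, C, h2⟩ := h
  refine ⟨(h1.sub_const c).abs, C + |c|, fun x => ?_⟩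
  rw [abs_abs]
  exact (abs_sub _ _).trans (add_le_add (h2 x) le_rfl)

lemma tendsto_integral_average (hd : 0 < d) {u : Msg} (hu : flip u = u) (hub : IsBound u) (ℓ : ℕ)
    (F : C(Msg, ℝ)) :
    Tendsto (fun n => ∫ ω, average F u ω ℓ ∂configLaw n (clauseRate d n)) atTop
      (𝓝 (∫ v, F v ∂msgLaw (d / 2).toNNReal u ℓ)) := by
  rw [tendsto_iff_norm_sub_tendsto_zero]
  refine squeeze_zero (fun n => norm_nonneg _) (fun n => ?_) (tendsto_average_error hd hu hub ℓ F)
  have hi : Integrable (fun ω => average F u ω ℓ) (configLaw n (clauseRate d n)) :=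
    (bddMeas_average F u ℓ).integrable _
  have : ∫ ω, average F u ω ℓ ∂configLaw n (clauseRate d n)
      - ∫ v, F v ∂msgLaw (d / 2).toNNReal u ℓ
      = ∫ ω, (average F u ω ℓ - ∫ v, F v ∂msgLaw (d / 2).toNNReal u ℓ)
        ∂configLaw n (clauseRate d n) := by
    rw [integral_sub hi (integrable_const _)]; simp
  rw [this]
  exact norm_integral_le_integral_norm _

/-- The mean distance between the two bounds in a message of depth `ℓ`. -/
def meanGap (d : ℝ) (ℓ : ℕ) : ℝ := ∫ v, gap v ∂msgLaw (d / 2).toNNReal trivialMsg ℓ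

lemma tendsto_meanGap (hd2 : d < 2) : Tendsto (meanGap d) atTop (𝓝 0) := by
  have h := (ENNReal.tendsto_toReal ENNReal.zero_ne_top).comp
    (tendsto_gap (toNNReal_half_lt_one hd2))
  rw [ENNReal.toReal_zero] at h
  refine h.congr fun ℓ => ?_
  rw [meanGap, integral_eq_lintegral_of_nonneg_ae]
  · rfl
  · filter_upwards [ae_isBound_msgLaw isBound_trivialMsg ℓ] with v hv
    exact sub_nonneg.2 hv.1
  · exact gap.continuous.aestronglyMeasurable

/-- The integral of a test function against an iterate of the Belief Propagation operator. -/
def bpIntegral (d : ℝ) (f : C(unitInterval, ℝ)) (ℓ : ℕ) : ℝ :=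
  ∫ z, f (toUnitInterval z) ∂((BP d)^[ℓ] diracHalf : ProbabilityMeasure OpenUnit)

lemma bpIntegral_eq (d : ℝ) (f : C(unitInterval, ℝ)) (ℓ : ℕ) :
    bpIntegral d f ℓ = ∫ v, evalFst f v ∂msgLaw (d / 2).toNNReal halfMsg ℓ := by
  rw [msgLaw_halfMsg, integral_map continuous_sharp.measurable.aemeasurable
    (evalFst f).continuous.aestronglyMeasurable]
  rfl

/-- Later iterates remain close to the `ℓ`-th one. The bound is inherited from the messages on the
random formula in the limit of large `n`. -/
lemma abs_bpIntegral_sub_le (hd : 0 < d) (f : C(unitInterval, ℝ)) {ε K : ℝ} (hK : 0 ≤ K)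
    (hf : ∀ u v : unitInterval, |f u - f v| ≤ ε + K * |(u : ℝ) - v|) (ℓ k : ℕ) :
    |bpIntegral d f ℓ - bpIntegral d f (ℓ + k)| ≤ ε + K * meanGap d ℓ := by
  have t1 := tendsto_average_error hd flip_halfMsg isBound_halfMsg ℓ (evalFst f)
  have t2 := tendsto_average_error hd flip_halfMsg isBound_halfMsg (ℓ + k) (evalFst f)
  have t3 := tendsto_integral_average hd flip_trivialMsg isBound_trivialMsg ℓ gap
  rw [← bpIntegral_eq] at t1 t2
  have t := (t1.add ((t3.const_mul K).const_add ε)).add t2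
  rw [zero_add, add_zero] at t
  refine ge_of_tendsto t ?_
  filter_upwards [eventually_gt_atTop 0] with n hn
  set P := configLaw n (clauseRate d n)
  have i1 : Integrable (fun ω => |average (evalFst f) halfMsg ω ℓ - bpIntegral d f ℓ|) P :=
    ((bddMeas_average _ _ _).abs_sub_const _).integrable _
  have i2 : Integrable (fun ω => |average (evalFst f) halfMsg ω (ℓ + k) -
      bpIntegral d f (ℓ + k)|) P :=
    ((bddMeas_average _ _ _).abs_sub_const _).integrable _
  have i3 : Integrable (fun ω => K * average gap trivialMsg ω ℓ) P :=
    ((bddMeas_average _ _ _).const_mul K).integrable _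
  have i4 : Integrable (fun ω => ε + K * average gap trivialMsg ω ℓ) P :=
    (integrable_const ε).add i3
  have i5 : Integrable (fun ω => |average (evalFst f) halfMsg ω ℓ - bpIntegral d f ℓ|
      + (ε + K * average gap trivialMsg ω ℓ)) P := i1.add i4
  have e : ∫ ω, (|average (evalFst f) halfMsg ω ℓ - bpIntegral d f ℓ|
      + (ε + K * average gap trivialMsg ω ℓ)
      + |average (evalFst f) halfMsg ω (ℓ + k) - bpIntegral d f (ℓ + k)|) ∂P
      = ∫ ω, |average (evalFst f) halfMsg ω ℓ - bpIntegral d f ℓ| ∂P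
      + (ε + K * ∫ ω, average gap trivialMsg ω ℓ ∂P)
      + ∫ ω, |average (evalFst f) halfMsg ω (ℓ + k) - bpIntegral d f (ℓ + k)| ∂P := by
    rw [integral_add i5 i2, integral_add i1 i4, integral_add (integrable_const ε) i3,
      integral_const_mul]
    simp
  rw [← e]
  have hc : |bpIntegral d f ℓ - bpIntegral d f (ℓ + k)|
      = ∫ _ω, |bpIntegral d f ℓ - bpIntegral d f (ℓ + k)| ∂P := by simp
  rw [hc]
  refine integral_mono (integrable_const _) (i5.add i2) fun ω => ?_
  have h1 := abs_average_sub_average_le hn f hK hf ω ℓ k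
  have h2 := abs_sub_le (bpIntegral d f ℓ) (average (evalFst f) halfMsg ω ℓ)
    (bpIntegral d f (ℓ + k))
  have h3 := abs_sub_le (average (evalFst f) halfMsg ω ℓ) (average (evalFst f) halfMsg ω (ℓ + k))
    (bpIntegral d f (ℓ + k))
  rw [abs_sub_comm (bpIntegral d f ℓ) (average (evalFst f) halfMsg ω ℓ)] at h2
  show _ ≤ |average (evalFst f) halfMsg ω ℓ - bpIntegral d f ℓ|
      + (ε + K * average gap trivialMsg ω ℓ)
      + |average (evalFst f) halfMsg ω (ℓ + k) - bpIntegral d f (ℓ + k)|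
  linarith

lemma cauchySeq_bpIntegral (hd : 0 < d) (hd2 : d < 2) (f : C(unitInterval, ℝ)) :
    CauchySeq (bpIntegral d f) := by
  rw [Metric.cauchySeq_iff']
  intro ε hε
  obtain ⟨K, hK, hf⟩ := exists_modulus f (half_pos hε)
  have h := (tendsto_meanGap hd2).const_mul K
  rw [mul_zero] at h
  obtain ⟨N, hN⟩ := (h.eventually_lt_const (half_pos hε)).exists
  refine ⟨N, fun n hn => ?_⟩
  obtain ⟨k, rfl⟩ := Nat.exists_eq_add_of_le hn
  rw [dist_comm, Real.dist_eq]
  have := abs_bpIntegral_sub_le hd f hK hf N k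
  linarith

/-- Markov's inequality for the negative logarithm: the iterates put little mass near `0`, uniformly
in `ℓ`. -/
lemma bp_small_le {K : ℝ≥0} (hK : ENNReal.ofReal (Real.log 2) + (d / 2).toNNReal * K ≤ K)
    (hK2 : ENNReal.ofReal (Real.log 2) ≤ K) (ℓ t : ℕ) :
    t * (((BP d)^[ℓ] diracHalf : ProbabilityMeasure OpenUnit) : Measure OpenUnit)
      {z | (z : ℝ) < Real.exp (-t)} ≤ K := by
  have hlog : negLog halfMsg ≤ K := by
    refine le_trans (le_of_eq ?_) hK2
    show ENNReal.ofReal (-Real.log (1 / 2)) = _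
    rw [one_div, Real.log_inv, neg_neg]
  have h := lintegral_negLog_le hK hlog ℓ
  rw [msgLaw_halfMsg, lintegral_map measurable_negLog continuous_sharp.measurable] at h
  refine le_trans ?_ ((mul_meas_ge_le_lintegral
    (measurable_negLog.comp continuous_sharp.measurable) (t : ℝ≥0∞)).trans h)
  refine mul_le_mul' le_rfl (measure_mono fun z hz => ?_)
  have hz' : Real.log (z : ℝ) < -t := by
    rw [← Real.log_exp (-(t : ℝ))]
    exact Real.log_lt_log z.2.1 hz
  show (t : ℝ≥0∞) ≤ ENNReal.ofReal (-Real.log z)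
  rw [← ENNReal.ofReal_natCast]
  exact ENNReal.ofReal_le_ofReal (by linarith)

/-- The iterates are symmetric about `1 / 2`. -/
lemma bp_large_eq (ℓ : ℕ) (a : ℝ) :
    (((BP d)^[ℓ] diracHalf : ProbabilityMeasure OpenUnit) : Measure OpenUnit) {z | 1 - a < (z : ℝ)}
      = (((BP d)^[ℓ] diracHalf : ProbabilityMeasure OpenUnit) : Measure OpenUnit)
        {z | (z : ℝ) < a} := by
  have h := msgLaw_map_flip (d / 2).toNNReal flip_halfMsg ℓ
  rw [msgLaw_halfMsg] at h
  have hm : MeasurableSet {u : Msg | 1 - a < (u.1 : ℝ)} :=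
    measurableSet_lt measurable_const measurable_fst.subtype_val
  have h2 := congrArg (fun μ : Measure Msg => μ {u : Msg | 1 - a < (u.1 : ℝ)}) h
  beta_reduce at h2
  rw [Measure.map_apply continuous_flip.measurable hm,
    Measure.map_apply continuous_sharp.measurable (continuous_flip.measurable hm),
    Measure.map_apply continuous_sharp.measurable hm] at h2
  refine h2.symm.trans (congrArg _ ?_)
  ext z
  show 1 - a < 1 - (z : ℝ) ↔ (z : ℝ) < a
  constructor <;> intro <;> linarith

lemma isOpenEmbedding_toUnitInterval : IsOpenEmbedding toUnitInterval := by
  have he : IsEmbedding toUnitInterval :=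
    IsEmbedding.of_comp continuous_toUnitInterval continuous_subtype_val
      (show IsEmbedding (fun z : OpenUnit => (z : ℝ)) from IsEmbedding.subtypeVal)
  refine ⟨he, ?_⟩
  have : Set.range toUnitInterval = {z : unitInterval | (0 : ℝ) < z ∧ (z : ℝ) < 1} := by
    ext z
    constructor
    · rintro ⟨w, rfl⟩
      exact w.2
    · intro hz
      exact ⟨⟨z, hz⟩, rfl⟩
  rw [this]
  exact (isOpen_lt continuous_const continuous_subtype_val).inter
    (isOpen_lt continuous_subtype_val continuous_const)

lemma measure_eq_zero_of_mul_le {X : Type*} [MeasurableSpace X] {π : Measure X} {A : Set X}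
    {K : ℝ≥0}
    (h : ∀ t : ℕ, t * π A ≤ K) : π A = 0 := by
  by_contra h0
  obtain ⟨t, ht⟩ := ENNReal.exists_nat_mul_gt h0 (ENNReal.coe_ne_top (r := K))
  exact absurd (h t) (not_le.2 ht)

/-- The iterates of the Belief Propagation operator converge weakly on the open interval: they
converge on the compact interval, and the limit gives no mass to the end points. -/
lemma exists_bp_limit (hd : 0 < d) (hd2 : d < 2) : ∃ π : ProbabilityMeasure OpenUnit,
    Tendsto (fun ℓ : ℕ => (BP d)^[ℓ] diracHalf) atTop (𝓝 π) := by
  let ν : ℕ → ProbabilityMeasure unitInterval := fun ℓ =>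
    ((BP d)^[ℓ] diracHalf).map continuous_toUnitInterval.measurable.aemeasurable
  have hν : ∀ ℓ {G : Set unitInterval}, MeasurableSet G → (ν ℓ : Measure unitInterval) G =
      (((BP d)^[ℓ] diracHalf : ProbabilityMeasure OpenUnit) : Measure OpenUnit)
        (toUnitInterval ⁻¹' G) := fun ℓ G hG =>
    Measure.map_apply continuous_toUnitInterval.measurable hG
  obtain ⟨π, hπ⟩ := exists_clusterPt_of_compactSpace (map ν atTop)
  -- the integrals form a Cauchy sequence, so they converge to the value at the cluster point `π`
  have hlim : Tendsto ν atTop (𝓝 π) := by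
    rw [ProbabilityMeasure.tendsto_iff_forall_integral_tendsto]
    intro f
    have hcl : MapClusterPt π atTop ν := hπ
    refine le_nhds_of_cauchy_adhp ?_ (hcl.continuousAt_comp
      (ProbabilityMeasure.continuous_integral_boundedContinuousFunction f).continuousAt)
    have hc := cauchySeq_bpIntegral hd hd2 f.toContinuousMap
    have heq : (fun ℓ => ∫ z, f z ∂(ν ℓ : Measure unitInterval))
        = bpIntegral d f.toContinuousMap := funext fun ℓ =>
      integral_map continuous_toUnitInterval.measurable.aemeasurable
        f.continuous.aestronglyMeasurable
    rw [heq]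
    exact hc
  obtain ⟨K, hK, hK2⟩ := exists_negLog_bound (toNNReal_half_lt_one hd2)
  have hopen : ∀ {G : Set unitInterval}, IsOpen G → ∀ {c : ℝ≥0∞},
      (∀ ℓ, (ν ℓ : Measure unitInterval) G ≤ c) → (π : Measure unitInterval) G ≤ c := by
    intro G hG c hc
    refine (ProbabilityMeasure.le_liminf_measure_open_of_tendsto hlim hG).trans ?_
    exact (liminf_le_liminf (Eventually.of_forall hc)).trans_eq (liminf_const c)
  have hmul : ∀ {G : Set unitInterval}, IsOpen G → ∀ t : ℕ,
      (∀ ℓ, t * (ν ℓ : Measure unitInterval) G ≤ K) → t * (π : Measure unitInterval) G ≤ K := by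
    intro G hG t ht
    rcases Nat.eq_zero_or_pos t with rfl | hpos
    · simp
    · have h0 : (t : ℝ≥0∞) ≠ 0 := by exact_mod_cast hpos.ne'
      rw [mul_comm, ← ENNReal.le_div_iff_mul_le (Or.inl h0) (Or.inl (ENNReal.natCast_ne_top t))]
      refine hopen hG fun ℓ => ?_
      rw [ENNReal.le_div_iff_mul_le (Or.inl h0) (Or.inl (ENNReal.natCast_ne_top t)), mul_comm]
      exact ht ℓ
  -- no mass at the end points
  have h0 : (π : Measure unitInterval) {0} = 0 := by
    refine measure_eq_zero_of_mul_le (K := K) fun t => ?_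
    have hG : IsOpen {z : unitInterval | (z : ℝ) < Real.exp (-t)} :=
      isOpen_lt continuous_subtype_val continuous_const
    refine le_trans (mul_le_mul' le_rfl (measure_mono ?_)) (hmul hG t fun ℓ => ?_)
    · rintro z rfl
      exact Real.exp_pos _
    · rw [hν ℓ hG.measurableSet]
      exact bp_small_le hK hK2 ℓ t
  have h1 : (π : Measure unitInterval) {1} = 0 := by
    refine measure_eq_zero_of_mul_le (K := K) fun t => ?_
    have hG : IsOpen {z : unitInterval | 1 - Real.exp (-t) < (z : ℝ)} :=
      isOpen_lt continuous_const continuous_subtype_val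
    refine le_trans (mul_le_mul' le_rfl (measure_mono ?_)) (hmul hG t fun ℓ => ?_)
    · rintro z rfl
      show 1 - Real.exp (-t) < (1 : ℝ)
      linarith [Real.exp_pos (-(t : ℝ))]
    · rw [hν ℓ hG.measurableSet]
      exact (congrArg _ (bp_large_eq ℓ _)).trans_le (bp_small_le hK hK2 ℓ t)
  have hemb := isOpenEmbedding_toUnitInterval
  have hcompl : (π : Measure unitInterval) (Set.range toUnitInterval)ᶜ = 0 := by
    refine measure_mono_null (t := {0} ∪ {1}) ?_ (measure_union_null h0 h1)
    intro z hz
    by_contra hc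
    simp only [Set.mem_union, Set.mem_singleton_iff, not_or] at hc
    exact hz ⟨⟨z, unitInterval.pos_iff_ne_zero.2 hc.1, unitInterval.lt_one_iff_ne_one.2 hc.2⟩, rfl⟩
  have hcomap : ∀ G : Set OpenUnit, ((π : Measure unitInterval).comap toUnitInterval) G
      = (π : Measure unitInterval) (toUnitInterval '' G) := fun G =>
    hemb.measurableEmbedding.comap_apply _ G
  have hprob : IsProbabilityMeasure ((π : Measure unitInterval).comap toUnitInterval) := by
    refine ⟨?_⟩
    rw [hcomap, Set.image_univ]
    exact (prob_compl_eq_zero_iff hemb.isOpen_range.measurableSet).1 hcompl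
  refine ⟨⟨_, hprob⟩, tendsto_of_forall_isOpen_le_liminf' fun G hG => ?_⟩
  have hG' := hemb.isOpenMap G hG
  show ((π : Measure unitInterval).comap toUnitInterval) G ≤ _
  rw [hcomap]
  refine (ProbabilityMeasure.le_liminf_measure_open_of_tendsto hlim hG').trans (le_of_eq ?_)
  congr 1
  funext ℓ
  rw [hν ℓ hG'.measurableSet, Set.preimage_image_eq _ hemb.injective]

end limit

/-! ### Convergence of the empirical marginals -/

/-- A large depth `ℓ` is fixed first, for which the mean gap is small and the integral against the
`ℓ`-th iterate of `BP` is close to its limit `A`. Then `n` tends to infinity, so that averages over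
the formula approach expectations on the tree, and short cycles and unsatisfiability become
negligible. -/
lemma tendsto_marginalIntegral {d : ℝ} (hd : 0 < d) (hd2 : d < 2) (κ : Measure unitInterval)
    [IsProbabilityMeasure κ] (f : C(unitInterval, ℝ)) {A : ℝ}
    (hA : Tendsto (bpIntegral d f) atTop (𝓝 A)) :
    Tendsto (fun n => ∫ ω, |A - marginalIntegral κ f {σ | SatOn ω Finset.univ σ}|
      ∂configLaw n (clauseRate d n)) atTop (𝓝 0) := by
  refine tendsto_order.2 ⟨fun a ha => Eventually.of_forall fun n =>
    ha.trans_le (integral_nonneg fun _ => abs_nonneg _), fun δ hδ => ?_⟩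
  set C := 2 * ‖f‖ with hC
  have hC0 : 0 ≤ C := by positivity
  obtain ⟨ε, hε, hεδ⟩ : ∃ ε, 0 < ε ∧ 3 * ε = δ := ⟨δ / 3, by positivity, by ring⟩
  obtain ⟨K, hK, hf⟩ := exists_modulus f hε
  have hg := (tendsto_meanGap hd2).const_mul K
  rw [mul_zero] at hg
  have hA' : Tendsto (fun ℓ => |A - bpIntegral d f ℓ|) atTop (𝓝 0) := by
    simpa using (hA.const_sub A).abs
  obtain ⟨ℓ, hℓ1, hℓ2⟩ := ((hg.eventually_lt_const hε).and (hA'.eventually_lt_const hε)).exists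
  have t1 := tendsto_average_error hd flip_halfMsg isBound_halfMsg ℓ (evalFst f)
  rw [← bpIntegral_eq] at t1
  have t3 := tendsto_integral_average hd flip_trivialMsg isBound_trivialMsg ℓ gap
  have t4 := (grow_clauseRate hd).tendsto_cycleBound ℓ
  have t5 := tendsto_unsat (toNNReal_half_lt_one hd2) (grow_clauseRate hd)
  have t := ((t1.const_add |A - bpIntegral d f ℓ|).add ((t3.const_mul K).const_add ε)).add
    ((t4.const_mul C).add (t5.const_mul C))
  simp only [mul_zero, add_zero] at t
  have hlt : |A - bpIntegral d f ℓ| + (ε + K * meanGap d ℓ) < δ := by linarith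
  filter_upwards [t.eventually_lt_const hlt, eventually_gt_atTop 0] with n hn hn0
  refine lt_of_le_of_lt ?_ hn
  set P := configLaw n (clauseRate d n)
  have hn' : (0 : ℝ) < n := by exact_mod_cast hn0
  have i1 : Integrable (fun ω => |average (evalFst f) halfMsg ω ℓ - bpIntegral d f ℓ|) P :=
    ((bddMeas_average _ _ _).abs_sub_const _).integrable _
  have i1' : Integrable (fun ω => |A - bpIntegral d f ℓ| +
      |average (evalFst f) halfMsg ω ℓ - bpIntegral d f ℓ|) P := (integrable_const _).add i1
  have i3 : Integrable (fun ω => K * average gap trivialMsg ω ℓ) P :=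
    ((bddMeas_average _ _ _).const_mul K).integrable _
  have i4 : Integrable (fun ω => ε + K * average gap trivialMsg ω ℓ) P :=
    (integrable_const _).add i3
  have i5 : Integrable (fun ω => |A - bpIntegral d f ℓ| +
      |average (evalFst f) halfMsg ω ℓ - bpIntegral d f ℓ| +
      (ε + K * average gap trivialMsg ω ℓ)) P := i1'.add i4
  have i6 : ∀ x, Integrable ({ω : Config n | ¬ Good ω ℓ Finset.univ x}.indicator fun _ => C) P :=
    fun x => (integrable_const C).indicator (measurableSet_config _)
  have i7 : Integrable (fun ω =>
      (∑ x, {ω : Config n | ¬ Good ω ℓ Finset.univ x}.indicator (fun _ => C) ω) / n) P :=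
    (integrable_finsetSum _ fun x _ => i6 x).div_const _
  have i8 : Integrable ({ω : Config n | ¬ ∃ σ, SatOn ω Finset.univ σ}.indicator fun _ => C) P :=
    (integrable_const C).indicator (measurableSet_config _)
  have i9 : Integrable (fun ω =>
      (∑ x, {ω : Config n | ¬ Good ω ℓ Finset.univ x}.indicator (fun _ => C) ω) / n +
      {ω : Config n | ¬ ∃ σ, SatOn ω Finset.univ σ}.indicator (fun _ => C) ω) P := i7.add i8
  have hbound : ∀ ω : Config n, |A - marginalIntegral κ f {σ | SatOn ω Finset.univ σ}| ≤
      |A - bpIntegral d f ℓ| + |average (evalFst f) halfMsg ω ℓ - bpIntegral d f ℓ| +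
      (ε + K * average gap trivialMsg ω ℓ) +
      ((∑ x, {ω : Config n | ¬ Good ω ℓ Finset.univ x}.indicator (fun _ => C) ω) / n +
      {ω : Config n | ¬ ∃ σ, SatOn ω Finset.univ σ}.indicator (fun _ => C) ω) := by
    intro ω
    have h1 := abs_average_sub_marginalIntegral_le hn0 κ f hε.le hK hf ω ℓ
    have h2 := abs_sub_le A (bpIntegral d f ℓ) (marginalIntegral κ f {σ | SatOn ω Finset.univ σ})
    have h3 := abs_sub_le (bpIntegral d f ℓ) (average (evalFst f) halfMsg ω ℓ)
      (marginalIntegral κ f {σ | SatOn ω Finset.univ σ})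
    rw [abs_sub_comm (bpIntegral d f ℓ) (average (evalFst f) halfMsg ω ℓ)] at h3
    linarith
  have hsum : (∑ x : Fin n, P.real {ω : Config n | ¬ Good ω ℓ Finset.univ x} * C) / n
      ≤ C * cycleBound (clauseRate d n) (Finset.univ : Finset (Fin n)).card ℓ := by
    rw [div_le_iff₀ hn']
    refine (Finset.sum_le_sum fun x _ => mul_le_mul_of_nonneg_right
      (measureReal_not_good ℓ le_rfl (Finset.mem_univ x)) hC0).trans (le_of_eq ?_)
    rw [Finset.sum_const, nsmul_eq_mul, Finset.card_univ, Fintype.card_fin]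
    ring
  calc _ ≤ _ := integral_mono_of_nonneg (ae_of_all _ fun _ => abs_nonneg _) (i5.add i9)
        (ae_of_all _ hbound)
    _ = (|A - bpIntegral d f ℓ| + ∫ ω, |average (evalFst f) halfMsg ω ℓ - bpIntegral d f ℓ| ∂P) +
        (ε + K * ∫ ω, average gap trivialMsg ω ℓ ∂P) +
        ((∑ x : Fin n, P.real {ω : Config n | ¬ Good ω ℓ Finset.univ x} * C) / n +
          C * P.real {ω | ¬ ∃ σ, SatOn ω Finset.univ σ}) := by
      simp only [Pi.add_apply]
      rw [integral_add i5 i9, integral_add i1' i4, integral_add (integrable_const _) i1,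
        integral_add (integrable_const _) i3, integral_add i7 i8, integral_const_mul,
        integral_div, integral_finsetSum _ fun x _ => i6 x,
        integral_indicator_const _ (measurableSet_config _)]
      simp_rw [integral_indicator_const _ (measurableSet_config _)]
      simp only [integral_const, probReal_univ, smul_eq_mul, one_mul]
      rw [mul_comm C]
    _ ≤ _ := by gcongr

end RandomTwoSat

end

theorem corollary1p3 (d : ℝ) (hd0 : 0 < d) (hd2 : d < 2) :
    ∃ π_d : ProbabilityMeasure RandomTwoSat.OpenUnit,
      -- the weak limit of the iterates of the BP operator exists in the space of
      -- probability measures on the open unit interval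
      Tendsto (fun ℓ : ℕ => (RandomTwoSat.BP d)^[ℓ] RandomTwoSat.diracHalf) atTop (𝓝 π_d) ∧
      -- weak convergence in probability, whatever value the empirical
      -- distribution is given on unsatisfiable formulas
      ∀ κ : ProbabilityMeasure unitInterval, ∀ f : C(unitInterval, ℝ),
        Tendsto
          (fun n : ℕ =>
            ∫ Φ : RandomTwoSat.Formula n,
              |(∫ z, f (RandomTwoSat.toUnitInterval z) ∂(π_d : Measure RandomTwoSat.OpenUnit)) -
                ∫ z, f z ∂(RandomTwoSat.empiricalMarginals (κ : Measure unitInterval) Φ)|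
              ∂(RandomTwoSat.formulaLaw d n))
          atTop (𝓝 0) := by
  obtain ⟨π, hπ⟩ := RandomTwoSat.exists_bp_limit hd0 hd2
  refine ⟨π, hπ, fun κ f => ?_⟩
  have hA : Tendsto (RandomTwoSat.bpIntegral d f) atTop
      (𝓝 (∫ z, f (RandomTwoSat.toUnitInterval z) ∂(π : Measure RandomTwoSat.OpenUnit))) :=
    ProbabilityMeasure.tendsto_iff_forall_integral_tendsto.1 hπ
      ((BoundedContinuousFunction.mkOfCompact f).compContinuous
        ⟨_, RandomTwoSat.continuous_toUnitInterval⟩)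
  refine (RandomTwoSat.tendsto_marginalIntegral hd0 hd2 κ f hA).congr' ?_
  filter_upwards [eventually_ge_atTop 2] with n hn
  exact (RandomTwoSat.integral_formulaLaw d hn fun T =>
    |∫ z, f (RandomTwoSat.toUnitInterval z) ∂(π : Measure RandomTwoSat.OpenUnit) -
      RandomTwoSat.marginalIntegral κ f T|).symm
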